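/- **Theorem.** Let $L>1$ and let $a,b\in C^0([0,1])$ be real functions with $a(0)=0$, $a>0$ on $(0,1]$ and $b/a\in L^1(0,1)$. Put $\eta(x)=\exp\left(\int_{1/2}^x \frac{b(s)}{a(s)}\,ds\right)$ and $\sigma=a/\eta$ on $[0,1]$. All functions are complex valued. Let $L^2_{1/\sigma}(0,1)=\{v\in L^2(0,1):\int_0^1|v|^2/\sigma\,dx<\infty\}$, $H^1_{1/\sigma,\ell}(0,1)=\{u\in L^2_{1/\sigma}(0,1)\cap H^1(0,1): u(0)=0\}$ and $H^2_{1/\sigma,\ell}(0,1)=\{u\in H^1_{1/\sigma,\ell}(0,1): \sigma(\eta u_x)_x\in L^2_{1/\sigma}(0,1)\}$. Let $$\mathcal H_1=\{(u,v,y,z)\in H^1_{1/\sigma,\ell}(0,1)\times L^2_{1/\sigma}(0,1)\times H^1(1,L)\times L^2(1,L):\ u(1)=y(1)\}$$ carry the energy inner product $$\langle (u,v,y,z),(\tilde u,\tilde v,\tilde y,\tilde z)\rangle=\int_0^1\Big(\eta u_x\overline{\tilde u_x}+\tfrac1\sigma v\overline{\tilde v}\Big)dx+\int_1^L\Big(y_x\overline{\tilde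 y_x}+z\overline{\tilde z}\Big)dx ,$$ and let $\mathcal A_1(u,v,y,z)=(v,\sigma(\eta u_x)_x,z,y_{xx})$ on the domain $D(\mathcal A_1)$ of all $(u,v,y,z)\in\mathcal H_1$ such that $u\in H^2_{1/\sigma,\ell}(0,1)$, $v\in H^1_{1/\sigma,\ell}(0,1)$, $y\in H^2(1,L)$, $z\in H^1(1,L)$, $v(1)=z(1)$, $(\eta u_x)(1)=y_x(1)$ and $y_x(L)=-z(L)$. This operator describes the transmission system $u_{tt}=\sigma(\eta u_x)_x$ on $(0,1)$, $y_{tt}=y_{xx}$ on $(1,L)$ with boundary damping at $x=L$. Then: 1. If there is $\alpha\in(0,2]$ such that $x\mapsto x^\alpha/a(x)$ is non-decreasing in a right neighbourhood of $0$, then $\mathcal H_1$ is complete, that is, a Hilbert space. 2. $\mathcal A_1$ is m-dissipative: $\operatorname{Re}\langle \mathcal A_1\mathcal U,\mathcal U\rangle\le 0$ for all $\mathcal U\in D(\mathcal A_1)$, and $\lambda-\mathcal A_1$ maps $D(\mathcal A_1)$ onto $\mathcal H_1$ for every $\lambda>0$. 3. $\mathcal A_1$ is the infinitesimal generator of a $C_0$-semigroup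 of contractions $(\mathcal T_1(t))_{t\ge0}$ on $\mathcal H_1$. 4. For every $\mathcal U_0\in\mathcal H_1$ the Cauchy problem $\mathcal U_t=\mathcal A_1\mathcal U$, $\mathcal U(0)=\mathcal U_0$ has a unique weak solution $\mathcal U\in C^0(\mathbb R^+;\mathcal H_1)$, namely $\mathcal U(t)=\mathcal T_1(t)\mathcal U_0$. Here a weak solution is a continuous $\mathcal U:[0,\infty)\to\mathcal H_1$ with $\mathcal U(0)=\mathcal U_0$ and $\frac{d}{dt}\langle \mathcal U(t),\mathcal W\rangle=\langle\mathcal U(t),\mathcal W'\rangle$ for all $t\ge0$ and all $\mathcal W,\mathcal W'\in\mathcal H_1$ that satisfy $\langle\mathcal A_1\mathcal X,\mathcal W\rangle=\langle \mathcal X,\mathcal W'\rangle$ for every $\mathcal X\in D(\mathcal A_1)$ (that is, $\mathcal W\in D(\mathcal A_1^*)$ and $\mathcal W'=\mathcal A_1^*\mathcal W$). 5. If $\mathcal U_0\in D(\mathcal A_1)$, the problem has a unique strong solution $\mathcal U\in C^1(\mathbb R^+;\mathcal H_1)\cap C^0(\mathbb R^+;D(\mathcal A_1))$, namely $\mathcal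 U(t)=\mathcal T_1(t)\mathcal U_0$, where $D(\mathcal A_1)$ carries the graph norm. -/

import Mathlib

open MeasureTheory Set Filter Topology
open scoped ContDiff ComplexConjugate

noncomputable section

namespace Transmission

/-! ### Sobolev functions on an interval -/

/-- The complex space `L²(α, β)`. -/
abbrev L2 (α β : ℝ) : Type := Lp ℂ 2 (volume.restrict (Ioo α β))

/-- `g` is the weak derivative of `f` on `(α, β)`: both functions are locally integrable and
`∫ φ' f = - ∫ φ g` for every test function `φ ∈ C_c^∞(α, β)`. -/
def HasWeakDeriv (α β : ℝ) (f g : ℝ → ℂ) : Prop :=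
  LocallyIntegrableOn f (Ioo α β) ∧ LocallyIntegrableOn g (Ioo α β) ∧
    ∀ φ : ℝ → ℝ, ContDiff ℝ ∞ φ → HasCompactSupport φ → tsupport φ ⊆ Ioo α β →
      ∫ x in Ioo α β, deriv φ x • f x = -∫ x in Ioo α β, φ x • g x

/-- The function `f`, given up to null sets on `(α, β)`, has the value `v` at the point `c`
(an end point in all uses): its continuous representative on `(α, β)` tends to `v` at `c`. -/
def HasBoundaryValue (α β : ℝ) (f : ℝ → ℂ) (c : ℝ) (v : ℂ) : Prop :=
  ∃ F : ℝ → ℂ, ContinuousOn F (Ioo α β) ∧ f =ᵐ[volume.restrict (Ioo α β)] F ∧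
    Tendsto F (𝓝[Ioo α β] c) (𝓝 v)

section weakDerivLemmas

variable {α β : ℝ} {f f₁ f₂ g g₁ g₂ : ℝ → ℂ}

theorem integrable_test {φ : ℝ → ℝ} (hf : LocallyIntegrableOn f (Ioo α β)) (hφ : Continuous φ)
    (hc : HasCompactSupport φ) (hs : tsupport φ ⊆ Ioo α β) :
    IntegrableOn (fun x => φ x • f x) (Ioo α β) := by
  have h1 : IntegrableOn (fun x => φ x • f x) (tsupport φ) :=
    (hf.integrableOn_compact_subset hs hc).continuousOn_smul hφ.continuousOn hc
  have h2 : Integrable (fun x => φ x • f x) := by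
    rwa [integrableOn_iff_integrable_of_support_subset] at h1
    intro x hx
    apply subset_tsupport
    intro h0
    exact hx (by simp [h0])
  exact h2.integrableOn

theorem integrable_test_deriv {φ : ℝ → ℝ} (hf : LocallyIntegrableOn f (Ioo α β))
    (hφ : ContDiff ℝ ∞ φ) (hc : HasCompactSupport φ) (hs : tsupport φ ⊆ Ioo α β) :
    IntegrableOn (fun x => deriv φ x • f x) (Ioo α β) :=
  integrable_test hf (hφ.continuous_deriv (by simp)) hc.deriv
    ((tsupport_deriv_subset (𝕜 := ℝ)).trans hs)

theorem locallyIntegrableOn_congr (h : f₁ =ᵐ[volume.restrict (Ioo α β)] f₂)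
    (hf : LocallyIntegrableOn f₁ (Ioo α β)) : LocallyIntegrableOn f₂ (Ioo α β) := by
  rw [locallyIntegrableOn_iff isOpen_Ioo.isLocallyClosed] at hf ⊢
  intro k hk hkc
  exact (hf k hk hkc).congr (ae_mono (Measure.restrict_mono hk le_rfl) h)

theorem HasWeakDeriv.congr (h : HasWeakDeriv α β f₁ g₁)
    (hf : f₁ =ᵐ[volume.restrict (Ioo α β)] f₂) (hg : g₁ =ᵐ[volume.restrict (Ioo α β)] g₂) :
    HasWeakDeriv α β f₂ g₂ := by
  refine ⟨locallyIntegrableOn_congr hf h.1, locallyIntegrableOn_congr hg h.2.1, ?_⟩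
  intro φ h1 h2 h3
  have e1 : ∫ x in Ioo α β, deriv φ x • f₂ x = ∫ x in Ioo α β, deriv φ x • f₁ x :=
    integral_congr_ae (by filter_upwards [hf] with x hx; rw [hx])
  have e2 : ∫ x in Ioo α β, φ x • g₂ x = ∫ x in Ioo α β, φ x • g₁ x :=
    integral_congr_ae (by filter_upwards [hg] with x hx; rw [hx])
  rw [e1, e2]
  exact h.2.2 φ h1 h2 h3

theorem HasWeakDeriv.add (h₁ : HasWeakDeriv α β f₁ g₁) (h₂ : HasWeakDeriv α β f₂ g₂) :
    HasWeakDeriv α β (f₁ + f₂) (g₁ + g₂) := by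
  refine ⟨h₁.1.add h₂.1, h₁.2.1.add h₂.2.1, ?_⟩
  intro φ a1 a2 a3
  simp only [Pi.add_apply, smul_add]
  rw [integral_add (integrable_test_deriv h₁.1 a1 a2 a3) (integrable_test_deriv h₂.1 a1 a2 a3),
    integral_add (integrable_test h₁.2.1 a1.continuous a2 a3)
      (integrable_test h₂.2.1 a1.continuous a2 a3),
    h₁.2.2 φ a1 a2 a3, h₂.2.2 φ a1 a2 a3]
  ring

theorem HasWeakDeriv.smul (c : ℂ) (h : HasWeakDeriv α β f g) :
    HasWeakDeriv α β (c • f) (c • g) := by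
  refine ⟨h.1.smul c, h.2.1.smul c, ?_⟩
  intro φ a1 a2 a3
  simp only [Pi.smul_apply, smul_comm _ c]
  rw [integral_smul, integral_smul, h.2.2 φ a1 a2 a3, smul_neg]

theorem HasWeakDeriv.unique (h₁ : HasWeakDeriv α β f g₁) (h₂ : HasWeakDeriv α β f g₂) :
    g₁ =ᵐ[volume.restrict (Ioo α β)] g₂ := by
  have key := isOpen_Ioo.ae_eq_zero_of_integral_contDiff_smul_eq_zero (μ := volume)
    (h₁.2.1.sub h₂.2.1) ?_
  · rw [EventuallyEq, ae_restrict_iff' measurableSet_Ioo]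
    filter_upwards [key] with x hx hx'
    exact sub_eq_zero.1 (hx hx')
  · intro φ a1 a2 a3
    have e : ∫ x, φ x • (g₁ - g₂) x = ∫ x in Ioo α β, φ x • (g₁ - g₂) x := by
      symm
      apply setIntegral_eq_integral_of_forall_compl_eq_zero
      intro x hx
      have : φ x = 0 := by
        by_contra h0
        exact hx (a3 (subset_tsupport _ h0))
      simp [this]
    rw [e]
    simp only [Pi.sub_apply, smul_sub]
    rw [integral_sub (integrable_test h₁.2.1 a1.continuous a2 a3)
      (integrable_test h₂.2.1 a1.continuous a2 a3), sub_eq_zero]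
    have := (h₁.2.2 φ a1 a2 a3).symm.trans (h₂.2.2 φ a1 a2 a3)
    exact neg_injective this

theorem HasWeakDeriv.zero : HasWeakDeriv α β 0 0 := by
  refine ⟨locallyIntegrableOn_zero, locallyIntegrableOn_zero, ?_⟩
  intro φ _ _ _
  simp

/-- A function with vanishing weak derivative is constant. -/
theorem HasWeakDeriv.ae_const (hαβ : α < β) (h : HasWeakDeriv α β f 0) :
    ∃ c : ℂ, f =ᵐ[volume.restrict (Ioo α β)] fun _ => c := by
  -- a normalised bump function
  let ψ₀ : ContDiffBump ((α + β) / 2) :=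
    { rIn := (β - α) / 8, rOut := (β - α) / 4, rIn_pos := by linarith, rIn_lt_rOut := by linarith }
  let ψ : ℝ → ℝ := ψ₀.normed volume
  have ψs : ContDiff ℝ ∞ ψ := ψ₀.contDiff_normed
  have ψc : HasCompactSupport ψ := ψ₀.hasCompactSupport_normed
  have ψi : ∫ x, ψ x = 1 := ψ₀.integral_normed
  have ψt : tsupport ψ ⊆ Ioo α β := by
    have e : tsupport ψ = Metric.closedBall ((α + β) / 2) ((β - α) / 4) :=
      ψ₀.tsupport_normed_eq
    rw [e, Real.closedBall_eq_Icc]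
    intro x hx
    exact ⟨by linarith [hx.1], by linarith [hx.2]⟩
  refine ⟨∫ x in Ioo α β, ψ x • f x, ?_⟩
  set c := ∫ x in Ioo α β, ψ x • f x with hc
  have key := isOpen_Ioo.ae_eq_zero_of_integral_contDiff_smul_eq_zero (μ := volume)
    (h.1.sub (locallyIntegrableOn_const c)) ?_
  · rw [EventuallyEq, ae_restrict_iff' measurableSet_Ioo]
    filter_upwards [key] with x hx hx'
    exact sub_eq_zero.1 (hx hx')
  intro φ a1 a2 a3
  have e : ∫ x, φ x • (f - fun _ : ℝ => c) x = ∫ x in Ioo α β, φ x • (f - fun _ : ℝ => c) x := by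
    symm
    apply setIntegral_eq_integral_of_forall_compl_eq_zero
    intro x hx
    have : φ x = 0 := by
      by_contra h0
      exact hx (a3 (subset_tsupport _ h0))
    simp [this]
  have e2 : ∫ x in Ioo α β, φ x = ∫ x, φ x := by
    apply setIntegral_eq_integral_of_forall_compl_eq_zero
    intro x hx
    by_contra h0
    exact hx (a3 (subset_tsupport _ h0))
  rw [e]
  simp only [Pi.sub_apply, smul_sub]
  rw [integral_sub (integrable_test h.1 a1.continuous a2 a3)
    (integrable_test (locallyIntegrableOn_const c) a1.continuous a2 a3), integral_smul_const, e2,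
    sub_eq_zero]
  -- the primitive of `φ - (∫ φ) ψ` is a test function
  set m := ∫ x, φ x with hm
  let θ : ℝ → ℝ := fun x => φ x - m * ψ x
  have θs : ContDiff ℝ ∞ θ := a1.sub (contDiff_const.mul ψs)
  have θt : ∀ x, x ∉ tsupport φ ∪ tsupport ψ → θ x = 0 := by
    intro x hx
    have h1 : φ x = 0 := by
      by_contra h0
      exact hx (Or.inl (subset_tsupport _ h0))
    have h2 : ψ x = 0 := by
      by_contra h0
      exact hx (Or.inr (subset_tsupport _ h0))
    simp [θ, h1, h2]
  have Kc : IsCompact (tsupport φ ∪ tsupport ψ) := IsCompact.union a2 ψc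
  have Ks : tsupport φ ∪ tsupport ψ ⊆ Ioo α β := union_subset a3 ψt
  have θi : ∫ x, θ x = 0 := by
    simp only [θ]
    rw [integral_sub (a1.continuous.integrable_of_hasCompactSupport a2)
      ((ψs.continuous.integrable_of_hasCompactSupport ψc).const_mul m), integral_const_mul, ψi]
    simp [hm]
  have Kne : (tsupport φ ∪ tsupport ψ).Nonempty := by
    refine ⟨(α + β) / 2, Or.inr ?_⟩
    have e : tsupport ψ = Metric.closedBall ((α + β) / 2) ((β - α) / 4) :=
      ψ₀.tsupport_normed_eq
    rw [e]
    exact Metric.mem_closedBall_self (by linarith)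
  obtain ⟨p, hp⟩ := Kc.exists_isLeast Kne
  obtain ⟨q, hq⟩ := Kc.exists_isGreatest Kne
  let Θ : ℝ → ℝ := fun x => ∫ t in α..x, θ t
  have Θd : ∀ x, HasDerivAt Θ (θ x) x := fun x =>
    intervalIntegral.integral_hasDerivAt_right (θs.continuous.intervalIntegrable _ _)
      (θs.continuous.stronglyMeasurableAtFilter _ _) θs.continuous.continuousAt
  have Θd' : deriv Θ = θ := funext fun x => (Θd x).deriv
  have Θs : ContDiff ℝ ∞ Θ := by
    rw [contDiff_infty_iff_deriv]
    exact ⟨fun x => (Θd x).differentiableAt, by rw [Θd']; exact θs⟩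
  have hαp : α < p := (Ks hp.1).1
  have hqβ : q < β := (Ks hq.1).2
  have Θl : ∀ x, x < p → Θ x = 0 := by
    intro x hx
    have : ∀ t ∈ uIcc α x, θ t = 0 := by
      intro t ht
      apply θt
      intro hmem
      have h1 := hp.2 hmem
      have h2 : t ≤ max α x := ht.2
      have h3 : max α x < p := max_lt hαp hx
      linarith
    simp only [Θ]
    rw [intervalIntegral.integral_congr (g := fun _ => (0 : ℝ)) this]
    simp
  have Θr : ∀ x, q < x → Θ x = 0 := by
    intro x hx
    have hpq : p ≤ q := hp.2 hq.1
    simp only [Θ]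
    rw [intervalIntegral.integral_eq_integral_of_support_subset, θi]
    intro t ht
    have hmem : t ∈ tsupport φ ∪ tsupport ψ := by
      by_contra h0
      exact ht (θt t h0)
    exact ⟨by linarith [hp.2 hmem], by linarith [hq.2 hmem]⟩
  have Θsupp : tsupport Θ ⊆ Icc p q := by
    apply closure_minimal _ isClosed_Icc
    intro x hx
    by_contra h0
    rw [mem_Icc, not_and_or, not_le, not_le] at h0
    rcases h0 with h0 | h0
    · exact hx (Θl x h0)
    · exact hx (Θr x h0)
  have Θc : HasCompactSupport Θ := isCompact_Icc.of_isClosed_subset (isClosed_tsupport _) Θsupp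
  have main := h.2.2 Θ Θs Θc (Θsupp.trans (Icc_subset_Ioo hαp hqβ))
  rw [Θd'] at main
  simp only [Pi.zero_apply, smul_zero, integral_zero, neg_zero, θ, sub_smul, mul_smul] at main
  have i2 : IntegrableOn (fun x => m • ψ x • f x) (Ioo α β) :=
    (integrable_test h.1 ψs.continuous ψc ψt).smul m
  rw [integral_sub (integrable_test h.1 a1.continuous a2 a3) i2, integral_smul,
    sub_eq_zero] at main
  exact main

theorem HasBoundaryValue.add {c : ℝ} {v₁ v₂ : ℂ} (h₁ : HasBoundaryValue α β f₁ c v₁)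
    (h₂ : HasBoundaryValue α β f₂ c v₂) : HasBoundaryValue α β (f₁ + f₂) c (v₁ + v₂) := by
  obtain ⟨F₁, a1, a2, a3⟩ := h₁
  obtain ⟨F₂, b1, b2, b3⟩ := h₂
  exact ⟨F₁ + F₂, a1.add b1, a2.add b2, a3.add b3⟩

theorem HasBoundaryValue.smul {c : ℝ} {v : ℂ} (k : ℂ) (h : HasBoundaryValue α β f c v) :
    HasBoundaryValue α β (k • f) c (k • v) := by
  obtain ⟨F, a1, a2, a3⟩ := h
  exact ⟨k • F, a1.const_smul k, a2.const_smul k, a3.const_smul k⟩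

theorem HasBoundaryValue.zero {c : ℝ} : HasBoundaryValue α β 0 c 0 :=
  ⟨0, continuousOn_const, EventuallyEq.rfl, tendsto_const_nhds⟩

theorem HasBoundaryValue.congr {c : ℝ} {v : ℂ} (h : HasBoundaryValue α β f₁ c v)
    (e : f₁ =ᵐ[volume.restrict (Ioo α β)] f₂) : HasBoundaryValue α β f₂ c v := by
  obtain ⟨F, a1, a2, a3⟩ := h
  exact ⟨F, a1, e.symm.trans a2, a3⟩

theorem HasBoundaryValue.unique {c : ℝ} {v₁ v₂ : ℂ} (hαβ : α < β) (hc : c ∈ Icc α β)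
    (h₁ : HasBoundaryValue α β f c v₁) (h₂ : HasBoundaryValue α β f c v₂) : v₁ = v₂ := by
  obtain ⟨F₁, a1, a2, a3⟩ := h₁
  obtain ⟨F₂, b1, b2, b3⟩ := h₂
  have e : EqOn F₁ F₂ (Ioo α β) :=
    Measure.eqOn_open_of_ae_eq (a2.symm.trans b2) isOpen_Ioo a1 b1
  have : (𝓝[Ioo α β] c).NeBot := by
    rw [← mem_closure_iff_nhdsWithin_neBot, closure_Ioo hαβ.ne]
    exact hc
  refine tendsto_nhds_unique a3 (b3.congr' ?_)
  filter_upwards [self_mem_nhdsWithin] with x hx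
  exact (e hx).symm

theorem hasBoundaryValue_const {c : ℝ} (k : ℂ) : HasBoundaryValue α β (fun _ => k) c k :=
  ⟨fun _ => k, continuousOn_const, EventuallyEq.rfl, tendsto_const_nhds⟩

end weakDerivLemmas

/-- The Sobolev space `H¹(α, β)`, as a subspace of `L²(α, β)`. -/
def H1 (α β : ℝ) : Submodule ℂ (L2 α β) where
  carrier := {f | ∃ g : L2 α β, HasWeakDeriv α β f g}
  add_mem' := by
    rintro f₁ f₂ ⟨g₁, h₁⟩ ⟨g₂, h₂⟩
    exact ⟨g₁ + g₂, (h₁.add h₂).congr (Lp.coeFn_add _ _).symm (Lp.coeFn_add _ _).symm⟩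
  zero_mem' :=
    ⟨0, HasWeakDeriv.zero.congr (Lp.coeFn_zero _ _ _).symm (Lp.coeFn_zero _ _ _).symm⟩
  smul_mem' := by
    rintro c f ⟨g, h⟩
    exact ⟨c • g, (h.smul c).congr (Lp.coeFn_smul _ _).symm (Lp.coeFn_smul _ _).symm⟩

open Classical in
/-- The weak derivative `f_x ∈ L²(α, β)` of `f ∈ H¹(α, β)` (and `0` if `f ∉ H¹(α, β)`). -/
def dx {α β : ℝ} (f : L2 α β) : L2 α β :=
  if h : ∃ g : L2 α β, HasWeakDeriv α β f g then h.choose else 0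

theorem hasWeakDeriv_dx {α β : ℝ} {f : L2 α β} (hf : f ∈ H1 α β) :
    HasWeakDeriv α β f (dx f) := by
  have h : ∃ g : L2 α β, HasWeakDeriv α β f g := hf
  rw [dx, dif_pos h]
  exact h.choose_spec

theorem dx_eq {α β : ℝ} {f g : L2 α β} (h : HasWeakDeriv α β f g) : dx f = g :=
  Lp.ext ((hasWeakDeriv_dx ⟨g, h⟩).unique h)

theorem dx_add {α β : ℝ} {f g : L2 α β} (hf : f ∈ H1 α β) (hg : g ∈ H1 α β) :
    dx (f + g) = dx f + dx g :=
  dx_eq (((hasWeakDeriv_dx hf).add (hasWeakDeriv_dx hg)).congr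
    (Lp.coeFn_add _ _).symm (Lp.coeFn_add _ _).symm)

theorem dx_smul {α β : ℝ} {f : L2 α β} (c : ℂ) (hf : f ∈ H1 α β) : dx (c • f) = c • dx f :=
  dx_eq (((hasWeakDeriv_dx hf).smul c).congr
    (Lp.coeFn_smul _ _).symm (Lp.coeFn_smul _ _).symm)

end Transmission

/-! ### The data of the transmission problem and the weighted spaces -/

/-- The coefficients `a`, `b` of the degenerate equation on `(0, 1)` and the right end point `L`
of the interval `(1, L)` of the non-degenerate one, with the standing assumptions on them. -/
structure TransmissionData where
  a : ℝ → ℝ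
  b : ℝ → ℝ
  L : ℝ
  continuousOn_a : ContinuousOn a (Icc 0 1)
  continuousOn_b : ContinuousOn b (Icc 0 1)
  a_zero : a 0 = 0
  a_pos : ∀ x ∈ Ioc (0 : ℝ) 1, 0 < a x
  integrable_b_div_a : IntegrableOn (fun x => b x / a x) (Ioo 0 1)
  one_lt_L : 1 < L

namespace TransmissionData

open Transmission

variable (P : TransmissionData)

/-- `η(x) = exp (∫_{1/2}^x b(s)/a(s) ds)`. -/
def eta (x : ℝ) : ℝ := Real.exp (∫ s in (1 / 2 : ℝ)..x, P.b s / P.a s)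

/-- `σ = a / η`. -/
def sigma (x : ℝ) : ℝ := P.a x / P.eta x

theorem eta_pos (x : ℝ) : 0 < P.eta x := Real.exp_pos _

theorem sigma_pos {x : ℝ} (hx : x ∈ Ioo (0 : ℝ) 1) : 0 < P.sigma x :=
  div_pos (P.a_pos x ⟨hx.1, hx.2.le⟩) (P.eta_pos x)

theorem continuousOn_eta : ContinuousOn P.eta (Icc 0 1) := by
  have h2 := intervalIntegral.continuousOn_primitive_interval' (μ := volume) (a := (1 / 2 : ℝ))
    (b₁ := 0) (b₂ := 1) ((intervalIntegrable_iff_integrableOn_Ioo_of_le zero_le_one).2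
      P.integrable_b_div_a) (by rw [uIcc_of_le zero_le_one]; norm_num)
  rw [uIcc_of_le zero_le_one] at h2
  exact Real.continuous_exp.comp_continuousOn h2

theorem continuousOn_sigma : ContinuousOn P.sigma (Icc 0 1) :=
  P.continuousOn_a.div P.continuousOn_eta fun x _ => (P.eta_pos x).ne'

theorem aesm_sigma : AEStronglyMeasurable P.sigma (volume.restrict (Ioo 0 1)) :=
  (P.continuousOn_sigma.mono Ioo_subset_Icc_self).aestronglyMeasurable measurableSet_Ioo

theorem aesm_eta : AEStronglyMeasurable P.eta (volume.restrict (Ioo 0 1)) :=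
  (P.continuousOn_eta.mono Ioo_subset_Icc_self).aestronglyMeasurable measurableSet_Ioo

/-- The weighted space `L²_{1/σ}(0, 1)`. -/
def L2w : Submodule ℂ (L2 0 1) where
  carrier := {v | IntegrableOn (fun x => ‖v x‖ ^ 2 / P.sigma x) (Ioo 0 1)}
  add_mem' := by
    intro v w hv hw
    have hv' : IntegrableOn (fun x => ‖v x‖ ^ 2 / P.sigma x) (Ioo 0 1) := hv
    have hw' : IntegrableOn (fun x => ‖w x‖ ^ 2 / P.sigma x) (Ioo 0 1) := hw
    refine Integrable.mono' ((hv'.const_mul 2).add (hw'.const_mul 2)) ?_ ?_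
    · exact ((Lp.aestronglyMeasurable (v + w)).norm.pow 2).div₀ P.aesm_sigma
    · filter_upwards [Lp.coeFn_add v w, ae_restrict_mem measurableSet_Ioo] with x hx hx'
      have hs := P.sigma_pos hx'
      rw [hx, Real.norm_of_nonneg (by positivity)]
      simp only [Pi.add_apply]
      rw [← mul_div_assoc, ← mul_div_assoc, ← add_div]
      gcongr
      nlinarith [norm_add_le (v x) (w x), norm_nonneg (v x + w x), norm_nonneg (v x),
        norm_nonneg (w x), sq_nonneg (‖v x‖ - ‖w x‖)]
  zero_mem' := by
    have : IntegrableOn (fun _ : ℝ => (0 : ℝ)) (Ioo 0 1) := integrableOn_zero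
    refine this.congr ?_
    filter_upwards [Lp.coeFn_zero ℂ 2 (volume.restrict (Ioo (0 : ℝ) 1))] with x hx
    rw [hx]
    simp
  smul_mem' := by
    intro c v hv
    have hv' : IntegrableOn (fun x => ‖v x‖ ^ 2 / P.sigma x) (Ioo 0 1) := hv
    refine (hv'.const_mul (‖c‖ ^ 2)).congr ?_
    filter_upwards [Lp.coeFn_smul c v] with x hx
    rw [hx, Pi.smul_apply, norm_smul]
    ring

/-- The space `H¹_{1/σ,ℓ}(0, 1)` of all `u ∈ L²_{1/σ}(0, 1) ∩ H¹(0, 1)` with `u(0) = 0`. -/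
def H1w : Submodule ℂ (L2 0 1) where
  carrier := {u | u ∈ P.L2w ∧ u ∈ H1 0 1 ∧ HasBoundaryValue 0 1 u 0 0}
  add_mem' := by
    rintro u v ⟨a1, a2, a3⟩ ⟨b1, b2, b3⟩
    refine ⟨add_mem a1 b1, add_mem a2 b2, ?_⟩
    have := (a3.add b3).congr (Lp.coeFn_add u v).symm
    rwa [add_zero] at this
  zero_mem' := ⟨zero_mem _, zero_mem _, HasBoundaryValue.zero.congr (Lp.coeFn_zero _ _ _).symm⟩
  smul_mem' := by
    rintro c u ⟨a1, a2, a3⟩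
    refine ⟨Submodule.smul_mem _ c a1, Submodule.smul_mem _ c a2, ?_⟩
    have := (a3.smul c).congr (Lp.coeFn_smul c u).symm
    rwa [smul_zero] at this

/-- `w = B u`, that is `w = σ (η u_x)_x`, for `w ∈ L²(0, 1)`: the weak derivative of `η u_x`
on `(0, 1)` is `w / σ`. -/
def IsB (u w : L2 0 1) : Prop :=
  HasWeakDeriv 0 1 (fun x => (P.eta x : ℂ) * dx u x) (fun x => w x / (P.sigma x : ℂ))

open Classical in
/-- `B u = σ (η u_x)_x` (and `0` if this is not a function in `L²(0, 1)`). -/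
def B (u : L2 0 1) : L2 0 1 := if h : ∃ w, P.IsB u w then h.choose else 0

variable {P} in
theorem IsB.eq {u w : L2 0 1} (h : P.IsB u w) : P.B u = w := by
  have h0 : ∃ w, P.IsB u w := ⟨w, h⟩
  have h1 : P.IsB u (P.B u) := by
    rw [B, dif_pos h0]
    exact h0.choose_spec
  apply Lp.ext
  filter_upwards [HasWeakDeriv.unique h1 h, ae_restrict_mem measurableSet_Ioo] with x hx hx'
  have : (P.sigma x : ℂ) ≠ 0 := by exact_mod_cast (P.sigma_pos hx').ne'
  exact (div_left_inj' this).1 hx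

variable {P} in
theorem IsB.add {u₁ u₂ w₁ w₂ : L2 0 1} (k₁ : u₁ ∈ H1 0 1) (k₂ : u₂ ∈ H1 0 1)
    (h₁ : P.IsB u₁ w₁) (h₂ : P.IsB u₂ w₂) : P.IsB (u₁ + u₂) (w₁ + w₂) := by
  refine (HasWeakDeriv.add h₁ h₂).congr ?_ ?_
  · rw [dx_add k₁ k₂]
    filter_upwards [Lp.coeFn_add (dx u₁) (dx u₂)] with x hx
    rw [hx]
    simp [mul_add]
  · filter_upwards [Lp.coeFn_add w₁ w₂] with x hx
    rw [hx]
    simp [add_div]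

variable {P} in
theorem IsB.smul {u w : L2 0 1} (c : ℂ) (k : u ∈ H1 0 1) (h : P.IsB u w) :
    P.IsB (c • u) (c • w) := by
  refine (HasWeakDeriv.smul c h).congr ?_ ?_
  · rw [dx_smul c k]
    filter_upwards [Lp.coeFn_smul c (dx u)] with x hx
    rw [hx]
    simp only [Pi.smul_apply, smul_eq_mul]
    ring
  · filter_upwards [Lp.coeFn_smul c w] with x hx
    rw [hx]
    simp only [Pi.smul_apply, smul_eq_mul]
    ring

theorem IsB.zero : P.IsB 0 0 := by
  have := IsB.smul (P := P) (u := 0) (w := 0) 0 (zero_mem _) ?_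
  · simpa using this
  · have e : dx (0 : L2 0 1) = 0 := by
      have := dx_smul (0 : ℂ) (zero_mem (H1 0 1))
      simpa using this
    refine HasWeakDeriv.zero.congr ?_ ?_
    · rw [e]
      filter_upwards [Lp.coeFn_zero ℂ 2 (volume.restrict (Ioo (0 : ℝ) 1))] with x hx
      rw [hx]
      simp
    · filter_upwards [Lp.coeFn_zero ℂ 2 (volume.restrict (Ioo (0 : ℝ) 1))] with x hx
      rw [hx]
      simp

/-- The space `H²_{1/σ,ℓ}(0, 1)` of all `u ∈ H¹_{1/σ,ℓ}(0, 1)` with `B u ∈ L²_{1/σ}(0, 1)`. -/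
def H2w : Submodule ℂ (L2 0 1) where
  carrier := {u | u ∈ P.H1w ∧ ∃ w ∈ P.L2w, P.IsB u w}
  add_mem' := by
    rintro u₁ u₂ ⟨a1, w₁, a2, a3⟩ ⟨b1, w₂, b2, b3⟩
    exact ⟨add_mem a1 b1, w₁ + w₂, add_mem a2 b2, IsB.add a1.2.1 b1.2.1 a3 b3⟩
  zero_mem' := ⟨zero_mem _, 0, zero_mem _, IsB.zero P⟩
  smul_mem' := by
    rintro c u ⟨a1, w, a2, a3⟩
    exact ⟨Submodule.smul_mem _ c a1, c • w, Submodule.smul_mem _ c a2, IsB.smul c a1.2.1 a3⟩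

/-- The space `H²(1, L)`. -/
def H2 : Submodule ℂ (L2 1 P.L) where
  carrier := {y | y ∈ H1 1 P.L ∧ dx y ∈ H1 1 P.L}
  add_mem' := by
    rintro y z ⟨a1, a2⟩ ⟨b1, b2⟩
    exact ⟨add_mem a1 b1, by rw [dx_add a1 b1]; exact add_mem a2 b2⟩
  zero_mem' := by
    refine ⟨zero_mem _, ?_⟩
    have := dx_smul (0 : ℂ) (zero_mem (H1 1 P.L))
    rw [zero_smul, zero_smul] at this
    rw [this]
    exact zero_mem _
  smul_mem' := by
    rintro c y ⟨a1, a2⟩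
    exact ⟨Submodule.smul_mem _ c a1, by rw [dx_smul c a1]; exact Submodule.smul_mem _ c a2⟩

/-- The values at `1` of `f`, defined on `(0, 1)`, and of `g`, defined on `(1, L)`, coincide. -/
def Matches (f g : ℝ → ℂ) : Prop :=
  ∃ c : ℂ, HasBoundaryValue 0 1 f 1 c ∧ HasBoundaryValue 1 P.L g 1 c

/-! ### The energy space -/

/-- The vector space underlying `H_1`: all `(u, v, y, z)` in
`H¹_{1/σ,ℓ}(0, 1) × L²_{1/σ}(0, 1) × H¹(1, L) × L²(1, L)` with `u(1) = y(1)`. -/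
def energySubmodule : Submodule ℂ (L2 0 1 × L2 0 1 × L2 1 P.L × L2 1 P.L) where
  carrier := {U | U.1 ∈ P.H1w ∧ U.2.1 ∈ P.L2w ∧ U.2.2.1 ∈ H1 1 P.L ∧ P.Matches U.1 U.2.2.1}
  add_mem' := by
    rintro U W ⟨a1, a2, a3, c, a4, a5⟩ ⟨b1, b2, b3, d, b4, b5⟩
    exact ⟨add_mem a1 b1, add_mem a2 b2, add_mem a3 b3, c + d,
      (a4.add b4).congr (Lp.coeFn_add _ _).symm, (a5.add b5).congr (Lp.coeFn_add _ _).symm⟩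
  zero_mem' := ⟨zero_mem _, zero_mem _, zero_mem _, 0,
    HasBoundaryValue.zero.congr (Lp.coeFn_zero _ _ _).symm,
    HasBoundaryValue.zero.congr (Lp.coeFn_zero _ _ _).symm⟩
  smul_mem' := by
    rintro k U ⟨a1, a2, a3, c, a4, a5⟩
    exact ⟨Submodule.smul_mem _ k a1, Submodule.smul_mem _ k a2, Submodule.smul_mem _ k a3, k • c,
      (a4.smul k).congr (Lp.coeFn_smul _ _).symm, (a5.smul k).congr (Lp.coeFn_smul _ _).symm⟩

/-- The energy space `H_1`, which will carry the energy inner product (not the product norm). -/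
def EnergySpace : Type := P.energySubmodule

instance : AddCommGroup P.EnergySpace := inferInstanceAs (AddCommGroup P.energySubmodule)

instance : Module ℂ P.EnergySpace := inferInstanceAs (Module ℂ P.energySubmodule)

variable {P}

/-- The component `u` of `(u, v, y, z)`. -/
def EnergySpace.u (U : P.EnergySpace) : L2 0 1 := U.1.1

/-- The component `v` of `(u, v, y, z)`. -/
def EnergySpace.v (U : P.EnergySpace) : L2 0 1 := U.1.2.1

/-- The component `y` of `(u, v, y, z)`. -/
def EnergySpace.y (U : P.EnergySpace) : L2 1 P.L := U.1.2.2.1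

/-- The component `z` of `(u, v, y, z)`. -/
def EnergySpace.z (U : P.EnergySpace) : L2 1 P.L := U.1.2.2.2

/-- The element `(u, v, y, z)` of `H_1`. -/
def EnergySpace.mk (u v : L2 0 1) (y z : L2 1 P.L) (hu : u ∈ P.H1w) (hv : v ∈ P.L2w)
    (hy : y ∈ H1 1 P.L) (h : P.Matches u y) : P.EnergySpace :=
  ⟨(u, v, y, z), hu, hv, hy, h⟩

section mkLemmas

variable (u v : L2 0 1) (y z : L2 1 P.L) (hu : u ∈ P.H1w) (hv : v ∈ P.L2w)
  (hy : y ∈ H1 1 P.L) (h : P.Matches u y)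

@[simp] theorem EnergySpace.mk_u : (EnergySpace.mk u v y z hu hv hy h).u = u := rfl
@[simp] theorem EnergySpace.mk_v : (EnergySpace.mk u v y z hu hv hy h).v = v := rfl
@[simp] theorem EnergySpace.mk_y : (EnergySpace.mk u v y z hu hv hy h).y = y := rfl
@[simp] theorem EnergySpace.mk_z : (EnergySpace.mk u v y z hu hv hy h).z = z := rfl

end mkLemmas

theorem EnergySpace.hu (U : P.EnergySpace) : U.u ∈ P.H1w := U.2.1
theorem EnergySpace.hv (U : P.EnergySpace) : U.v ∈ P.L2w := U.2.2.1
theorem EnergySpace.hy (U : P.EnergySpace) : U.y ∈ H1 1 P.L := U.2.2.2.1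
theorem EnergySpace.huy (U : P.EnergySpace) : P.Matches U.u U.y := U.2.2.2.2

theorem EnergySpace.ext {U W : P.EnergySpace} (h1 : U.u = W.u) (h2 : U.v = W.v) (h3 : U.y = W.y)
    (h4 : U.z = W.z) : U = W :=
  Subtype.ext (Prod.ext h1 (Prod.ext h2 (Prod.ext h3 h4)))

@[simp] theorem EnergySpace.u_add (U W : P.EnergySpace) : (U + W).u = U.u + W.u := rfl
@[simp] theorem EnergySpace.v_add (U W : P.EnergySpace) : (U + W).v = U.v + W.v := rfl
@[simp] theorem EnergySpace.y_add (U W : P.EnergySpace) : (U + W).y = U.y + W.y := rfl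
@[simp] theorem EnergySpace.z_add (U W : P.EnergySpace) : (U + W).z = U.z + W.z := rfl
@[simp] theorem EnergySpace.u_smul (c : ℂ) (U : P.EnergySpace) : (c • U).u = c • U.u := rfl
@[simp] theorem EnergySpace.v_smul (c : ℂ) (U : P.EnergySpace) : (c • U).v = c • U.v := rfl
@[simp] theorem EnergySpace.y_smul (c : ℂ) (U : P.EnergySpace) : (c • U).y = c • U.y := rfl
@[simp] theorem EnergySpace.z_smul (c : ℂ) (U : P.EnergySpace) : (c • U).z = c • U.z := rfl

/-- The energy inner product; as usual in Mathlib it is conjugate-linear in the first argument. -/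
def energyInner (U W : P.EnergySpace) : ℂ :=
  (∫ x in Ioo (0 : ℝ) 1, ((P.eta x : ℂ) * (conj (dx U.u x) * dx W.u x)
      + (1 / (P.sigma x : ℂ)) * (conj (U.v x) * W.v x)))
    + ∫ x in Ioo 1 P.L, (conj (dx U.y x) * dx W.y x + conj (U.z x) * W.z x)

theorem integrable_conj_mul {α β : ℝ} (f g : L2 α β) :
    IntegrableOn (fun x => conj (f x) * g x) (Ioo α β) := by
  refine (L2.integrable_inner (𝕜 := ℂ) f g).congr ?_
  filter_upwards with x
  rw [RCLike.inner_apply, mul_comm]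

theorem integrable_eta (f g : L2 0 1) :
    IntegrableOn (fun x => (P.eta x : ℂ) * (conj (f x) * g x)) (Ioo 0 1) := by
  obtain ⟨C, hC⟩ := isCompact_Icc.exists_bound_of_continuousOn P.continuousOn_eta
  refine Integrable.bdd_mul (c := C) (integrable_conj_mul f g) ?_ ?_
  · exact Complex.continuous_ofReal.comp_aestronglyMeasurable P.aesm_eta
  · filter_upwards [ae_restrict_mem measurableSet_Ioo] with x hx
    simpa using hC x (Ioo_subset_Icc_self hx)

theorem integrable_sigma {f g : L2 0 1} (hf : f ∈ P.L2w) (hg : g ∈ P.L2w) :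
    IntegrableOn (fun x => (1 / (P.sigma x : ℂ)) * (conj (f x) * g x)) (Ioo 0 1) := by
  have hf' : IntegrableOn (fun x => ‖f x‖ ^ 2 / P.sigma x) (Ioo 0 1) := hf
  have hg' : IntegrableOn (fun x => ‖g x‖ ^ 2 / P.sigma x) (Ioo 0 1) := hg
  refine Integrable.mono' (hf'.add hg') ?_ ?_
  · refine AEStronglyMeasurable.mul ?_ (integrable_conj_mul f g).1
    exact (aestronglyMeasurable_const).div₀
      (Complex.continuous_ofReal.comp_aestronglyMeasurable P.aesm_sigma)
  · filter_upwards [ae_restrict_mem measurableSet_Ioo] with x hx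
    have hs := P.sigma_pos hx
    simp only [norm_mul, norm_div, norm_one, RCLike.norm_conj, Pi.add_apply, Complex.norm_real,
      Real.norm_of_nonneg hs.le]
    rw [← add_div, one_div, inv_mul_eq_div]
    gcongr
    nlinarith [norm_nonneg (f x), norm_nonneg (g x), sq_nonneg (‖f x‖ - ‖g x‖)]

theorem integrable_left (U W : P.EnergySpace) :
    IntegrableOn (fun x => (P.eta x : ℂ) * (conj (dx U.u x) * dx W.u x)
      + (1 / (P.sigma x : ℂ)) * (conj (U.v x) * W.v x)) (Ioo 0 1) :=
  (integrable_eta _ _).add (integrable_sigma U.hv W.hv)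

theorem integrable_right (U W : P.EnergySpace) :
    IntegrableOn (fun x => conj (dx U.y x) * dx W.y x + conj (U.z x) * W.z x) (Ioo 1 P.L) :=
  (integrable_conj_mul _ _).add (integrable_conj_mul _ _)

theorem energyInner_self (U : P.EnergySpace) :
    energyInner U U = (((∫ x in Ioo (0 : ℝ) 1, (P.eta x * ‖dx U.u x‖ ^ 2
      + 1 / P.sigma x * ‖U.v x‖ ^ 2))
      + ∫ x in Ioo 1 P.L, (‖dx U.y x‖ ^ 2 + ‖U.z x‖ ^ 2) : ℝ) : ℂ) := by
  rw [energyInner, Complex.ofReal_add, ← integral_complex_ofReal, ← integral_complex_ofReal]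
  simp only [RCLike.conj_mul]
  push_cast
  rfl

theorem integrable_left_self (U : P.EnergySpace) :
    IntegrableOn (fun x => P.eta x * ‖dx U.u x‖ ^ 2 + 1 / P.sigma x * ‖U.v x‖ ^ 2) (Ioo 0 1) := by
  refine (integrable_left U U).re.congr ?_
  filter_upwards with x
  simp only [RCLike.conj_mul]
  have : ((P.eta x : ℂ) * ((‖dx U.u x‖ : ℂ)) ^ 2 + 1 / (P.sigma x : ℂ) * ((‖U.v x‖ : ℂ)) ^ 2)
    = ((P.eta x * ‖dx U.u x‖ ^ 2 + 1 / P.sigma x * ‖U.v x‖ ^ 2 : ℝ) : ℂ) := by push_cast; rfl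
  erw [this]
  exact Complex.ofReal_re _

theorem integrable_right_self (U : P.EnergySpace) :
    IntegrableOn (fun x => ‖dx U.y x‖ ^ 2 + ‖U.z x‖ ^ 2) (Ioo 1 P.L) := by
  refine (integrable_right U U).re.congr ?_
  filter_upwards with x
  simp only [RCLike.conj_mul]
  have : (((‖dx U.y x‖ : ℂ)) ^ 2 + ((‖U.z x‖ : ℂ)) ^ 2)
    = ((‖dx U.y x‖ ^ 2 + ‖U.z x‖ ^ 2 : ℝ) : ℂ) := by push_cast; rfl
  erw [this]
  exact Complex.ofReal_re _

theorem left_nonneg (U : P.EnergySpace) : 0 ≤ᵐ[volume.restrict (Ioo (0 : ℝ) 1)]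
    fun x => P.eta x * ‖dx U.u x‖ ^ 2 + 1 / P.sigma x * ‖U.v x‖ ^ 2 := by
  filter_upwards [ae_restrict_mem measurableSet_Ioo] with x hx
  have h1 := P.sigma_pos hx
  have h2 := P.eta_pos x
  simp only [Pi.zero_apply]
  positivity

theorem energyInner_definite (U : P.EnergySpace) (h : energyInner U U = 0) : U = 0 := by
  rw [energyInner_self, Complex.ofReal_eq_zero] at h
  have n1 := integral_nonneg_of_ae (left_nonneg U)
  have n2 : 0 ≤ ∫ x in Ioo 1 P.L, (‖dx U.y x‖ ^ 2 + ‖U.z x‖ ^ 2) :=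
    integral_nonneg fun x => by positivity
  have i1 := (integral_eq_zero_iff_of_nonneg_ae (left_nonneg U) (integrable_left_self U)).1
    (by linarith)
  have i2 := (integral_eq_zero_iff_of_nonneg_ae (Eventually.of_forall fun x => by
    simp only [Pi.zero_apply]; positivity) (integrable_right_self U)).1
    (by linarith)
  have ux : dx U.u =ᵐ[volume.restrict (Ioo (0 : ℝ) 1)] 0 := by
    filter_upwards [i1, ae_restrict_mem measurableSet_Ioo] with x hx hx'
    have h1 := P.sigma_pos hx'
    have h2 := P.eta_pos x
    have h3 : P.eta x * ‖dx U.u x‖ ^ 2 = 0 := by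
      have a1 : 0 ≤ P.eta x * ‖dx U.u x‖ ^ 2 := by positivity
      have a2 : 0 ≤ 1 / P.sigma x * ‖U.v x‖ ^ 2 := by positivity
      simp only [Pi.zero_apply] at hx
      linarith
    simpa [h2.ne'] using h3
  have v0 : U.v = 0 := by
    apply Lp.ext
    refine EventuallyEq.trans ?_ (Lp.coeFn_zero _ _ _).symm
    filter_upwards [i1, ae_restrict_mem measurableSet_Ioo] with x hx hx'
    have h1 := P.sigma_pos hx'
    have h2 := P.eta_pos x
    have h3 : 1 / P.sigma x * ‖U.v x‖ ^ 2 = 0 := by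
      have a1 : 0 ≤ P.eta x * ‖dx U.u x‖ ^ 2 := by positivity
      have a2 : 0 ≤ 1 / P.sigma x * ‖U.v x‖ ^ 2 := by positivity
      simp only [Pi.zero_apply] at hx
      linarith
    simpa [h1.ne'] using h3
  have yx : dx U.y =ᵐ[volume.restrict (Ioo 1 P.L)] 0 := by
    filter_upwards [i2] with x hx
    have h3 : ‖dx U.y x‖ ^ 2 = 0 := by
      simp only [Pi.zero_apply] at hx
      nlinarith [sq_nonneg ‖dx U.y x‖, sq_nonneg ‖U.z x‖]
    simpa using h3
  have z0 : U.z = 0 := by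
    apply Lp.ext
    refine EventuallyEq.trans ?_ (Lp.coeFn_zero _ _ _).symm
    filter_upwards [i2] with x hx
    have h3 : ‖U.z x‖ ^ 2 = 0 := by
      simp only [Pi.zero_apply] at hx
      nlinarith [sq_nonneg ‖dx U.y x‖, sq_nonneg ‖U.z x‖]
    simpa using h3
  obtain ⟨c, hc⟩ := ((hasWeakDeriv_dx U.hu.2.1).congr EventuallyEq.rfl ux).ae_const zero_lt_one
  have c0 : c = 0 := ((hasBoundaryValue_const c).congr hc.symm).unique zero_lt_one
    (by norm_num) U.hu.2.2
  subst c0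
  have u0 : U.u = 0 := Lp.ext (hc.trans (Lp.coeFn_zero _ _ _).symm)
  obtain ⟨d, hd⟩ := ((hasWeakDeriv_dx U.hy).congr EventuallyEq.rfl yx).ae_const P.one_lt_L
  obtain ⟨k, k1, k2⟩ := U.huy
  have k0 : k = 0 := k1.unique zero_lt_one (by norm_num)
    ((hasBoundaryValue_const 0).congr hc.symm)
  have d0 : d = 0 := by
    rw [← k0]
    exact ((hasBoundaryValue_const d).congr hd.symm).unique P.one_lt_L
      (left_mem_Icc.2 P.one_lt_L.le) k2
  subst d0
  have y0 : U.y = 0 := Lp.ext (hd.trans (Lp.coeFn_zero _ _ _).symm)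
  exact EnergySpace.ext u0 v0 y0 z0

/-- The energy inner product on `H_1`. -/
@[reducible] def energyCore : InnerProductSpace.Core ℂ P.EnergySpace where
  inner := energyInner
  conj_inner_symm U W := by
    change conj (energyInner W U) = energyInner U W
    simp only [energyInner, map_add, ← integral_conj, map_mul, Complex.conj_conj,
      Complex.conj_ofReal, map_div₀, map_one]
    simp only [mul_comm]
  re_inner_nonneg U := by
    change 0 ≤ (energyInner U U).re
    rw [energyInner_self, Complex.ofReal_re]
    exact add_nonneg (integral_nonneg_of_ae (left_nonneg U))
      (integral_nonneg fun x => by positivity)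
  add_left U V W := by
    change energyInner (U + V) W = energyInner U W + energyInner V W
    simp only [energyInner, EnergySpace.u_add, EnergySpace.v_add, EnergySpace.y_add,
      EnergySpace.z_add, dx_add U.hu.2.1 V.hu.2.1, dx_add U.hy V.hy]
    rw [add_add_add_comm, ← integral_add (integrable_left U W) (integrable_left V W),
      ← integral_add (integrable_right U W) (integrable_right V W)]
    congr 1
    · apply integral_congr_ae
      filter_upwards [Lp.coeFn_add (dx U.u) (dx V.u), Lp.coeFn_add U.v V.v] with x h1 h2
      rw [h1, h2]
      simp only [Pi.add_apply, map_add]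
      ring
    · apply integral_congr_ae
      filter_upwards [Lp.coeFn_add (dx U.y) (dx V.y), Lp.coeFn_add U.z V.z] with x h1 h2
      rw [h1, h2]
      simp only [Pi.add_apply, map_add]
      ring
  smul_left U W c := by
    change energyInner (c • U) W = conj c * energyInner U W
    simp only [energyInner, EnergySpace.u_smul, EnergySpace.v_smul, EnergySpace.y_smul,
      EnergySpace.z_smul, dx_smul c U.hu.2.1, dx_smul c U.hy]
    rw [mul_add, ← integral_const_mul, ← integral_const_mul]
    congr 1
    · apply integral_congr_ae
      filter_upwards [Lp.coeFn_smul c (dx U.u), Lp.coeFn_smul c U.v] with x h1 h2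
      rw [h1, h2]
      simp only [Pi.smul_apply, smul_eq_mul, map_mul]
      ring
    · apply integral_congr_ae
      filter_upwards [Lp.coeFn_smul c (dx U.y), Lp.coeFn_smul c U.z] with x h1 h2
      rw [h1, h2]
      simp only [Pi.smul_apply, smul_eq_mul, map_mul]
      ring
  definite := energyInner_definite

instance : NormedAddCommGroup P.EnergySpace := energyCore.toNormedAddCommGroup

instance : InnerProductSpace ℂ P.EnergySpace := InnerProductSpace.ofCore energyCore.toCore

/-! ### The operator -/

variable (P)

/-- The domain of `A_1`. The condition `v(1) = z(1)` expresses that the value of the operator,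
whose first and third components are `v` and `z`, belongs to `H_1`. -/
def domA1 : Submodule ℂ P.EnergySpace where
  carrier := {U | U.v ∈ P.H1w ∧ U.z ∈ H1 1 P.L ∧ P.Matches U.v U.z ∧
    U.u ∈ P.H2w ∧ U.y ∈ P.H2 ∧
    P.Matches (fun x => (P.eta x : ℂ) * dx U.u x) (dx U.y) ∧
    ∃ c : ℂ, HasBoundaryValue 1 P.L (dx U.y) P.L (-c) ∧ HasBoundaryValue 1 P.L U.z P.L c}
  add_mem' := by
    rintro U W ⟨a1, a2, ⟨c, a3, a4⟩, a5, a6, ⟨d, a7, a8⟩, e, a9, a10⟩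
      ⟨b1, b2, ⟨c', b3, b4⟩, b5, b6, ⟨d', b7, b8⟩, e', b9, b10⟩
    refine ⟨add_mem a1 b1, add_mem a2 b2, ⟨c + c', ?_, ?_⟩, add_mem a5 b5, add_mem a6 b6,
      ⟨d + d', ?_, ?_⟩, e + e', ?_, ?_⟩
    · exact (a3.add b3).congr (Lp.coeFn_add _ _).symm
    · exact (a4.add b4).congr (Lp.coeFn_add _ _).symm
    · refine (a7.add b7).congr ?_
      rw [EnergySpace.u_add, dx_add U.hu.2.1 W.hu.2.1]
      filter_upwards [Lp.coeFn_add (dx U.u) (dx W.u)] with x hx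
      rw [hx]
      simp [mul_add]
    · rw [EnergySpace.y_add, dx_add U.hy W.hy]
      exact (a8.add b8).congr (Lp.coeFn_add _ _).symm
    · rw [EnergySpace.y_add, dx_add U.hy W.hy, neg_add]
      exact (a9.add b9).congr (Lp.coeFn_add _ _).symm
    · exact (a10.add b10).congr (Lp.coeFn_add _ _).symm
  zero_mem' := by
    have z1 : dx (0 : L2 0 1) = 0 := dx_eq (HasWeakDeriv.zero.congr
      (Lp.coeFn_zero _ _ _).symm (Lp.coeFn_zero _ _ _).symm)
    have z2 : dx (0 : L2 1 P.L) = 0 := dx_eq (HasWeakDeriv.zero.congr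
      (Lp.coeFn_zero _ _ _).symm (Lp.coeFn_zero _ _ _).symm)
    have e1 : (0 : P.EnergySpace).u = 0 := rfl
    have e2 : (0 : P.EnergySpace).y = 0 := rfl
    refine ⟨zero_mem P.H1w, zero_mem (H1 1 P.L), ⟨0, ?_, ?_⟩, zero_mem P.H2w, zero_mem P.H2,
      ⟨0, ?_, ?_⟩, 0, ?_, ?_⟩
    · exact HasBoundaryValue.zero.congr (Lp.coeFn_zero _ _ _).symm
    · exact HasBoundaryValue.zero.congr (Lp.coeFn_zero _ _ _).symm
    · refine HasBoundaryValue.zero.congr ?_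
      rw [e1, z1]
      filter_upwards [Lp.coeFn_zero ℂ 2 (volume.restrict (Ioo (0 : ℝ) 1))] with x hx
      rw [hx]
      simp
    · rw [e2, z2]
      exact HasBoundaryValue.zero.congr (Lp.coeFn_zero _ _ _).symm
    · rw [e2, z2, neg_zero]
      exact HasBoundaryValue.zero.congr (Lp.coeFn_zero _ _ _).symm
    · exact HasBoundaryValue.zero.congr (Lp.coeFn_zero _ _ _).symm
  smul_mem' := by
    rintro k U ⟨a1, a2, ⟨c, a3, a4⟩, a5, a6, ⟨d, a7, a8⟩, e, a9, a10⟩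
    refine ⟨Submodule.smul_mem _ k a1, Submodule.smul_mem _ k a2, ⟨k • c, ?_, ?_⟩,
      Submodule.smul_mem _ k a5, Submodule.smul_mem _ k a6, ⟨k • d, ?_, ?_⟩, k • e, ?_, ?_⟩
    · exact (a3.smul k).congr (Lp.coeFn_smul _ _).symm
    · exact (a4.smul k).congr (Lp.coeFn_smul _ _).symm
    · refine (a7.smul k).congr ?_
      rw [EnergySpace.u_smul, dx_smul k U.hu.2.1]
      filter_upwards [Lp.coeFn_smul k (dx U.u)] with x hx
      rw [hx]
      simp only [Pi.smul_apply, smul_eq_mul]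
      ring
    · rw [EnergySpace.y_smul, dx_smul k U.hy]
      exact (a8.smul k).congr (Lp.coeFn_smul _ _).symm
    · rw [EnergySpace.y_smul, dx_smul k U.hy, ← smul_neg]
      exact (a9.smul k).congr (Lp.coeFn_smul _ _).symm
    · exact (a10.smul k).congr (Lp.coeFn_smul _ _).symm

variable {P} in
theorem B_mem {u : L2 0 1} (h : u ∈ P.H2w) : P.B u ∈ P.L2w := by
  obtain ⟨-, w, hw, hB⟩ := h
  rw [hB.eq]
  exact hw

variable {P} in
theorem B_add {u₁ u₂ : L2 0 1} (h₁ : u₁ ∈ P.H2w) (h₂ : u₂ ∈ P.H2w) :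
    P.B (u₁ + u₂) = P.B u₁ + P.B u₂ := by
  obtain ⟨k₁, w₁, -, b₁⟩ := h₁
  obtain ⟨k₂, w₂, -, b₂⟩ := h₂
  rw [(b₁.add k₁.2.1 k₂.2.1 b₂).eq, b₁.eq, b₂.eq]

variable {P} in
theorem B_smul {u : L2 0 1} (c : ℂ) (h : u ∈ P.H2w) : P.B (c • u) = c • P.B u := by
  obtain ⟨k, w, -, b⟩ := h
  rw [(b.smul c k.2.1).eq, b.eq]

/-- The value `A_1 (u, v, y, z) = (v, σ (η u_x)_x, z, y_xx)`. -/
def A1val (U : P.EnergySpace) (h : U ∈ P.domA1) : P.EnergySpace :=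
  EnergySpace.mk U.v (P.B U.u) U.z (dx (dx U.y)) h.1 (B_mem h.2.2.2.1) h.2.1 h.2.2.1

@[simp] theorem A1val_u (U : P.EnergySpace) (h : U ∈ P.domA1) : (P.A1val U h).u = U.v :=
  EnergySpace.mk_u ..
@[simp] theorem A1val_v (U : P.EnergySpace) (h : U ∈ P.domA1) : (P.A1val U h).v = P.B U.u :=
  EnergySpace.mk_v ..
@[simp] theorem A1val_y (U : P.EnergySpace) (h : U ∈ P.domA1) : (P.A1val U h).y = U.z :=
  EnergySpace.mk_y ..
@[simp] theorem A1val_z (U : P.EnergySpace) (h : U ∈ P.domA1) : (P.A1val U h).z = dx (dx U.y) :=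
  EnergySpace.mk_z ..

theorem A1val_add (U W : P.EnergySpace) (h : U ∈ P.domA1) (k : W ∈ P.domA1)
    (hk : U + W ∈ P.domA1) : P.A1val (U + W) hk = P.A1val U h + P.A1val W k := by
  apply EnergySpace.ext
  · rw [EnergySpace.u_add, A1val_u, A1val_u, A1val_u, EnergySpace.v_add]
  · rw [EnergySpace.v_add, A1val_v, A1val_v, A1val_v, EnergySpace.u_add,
      B_add h.2.2.2.1 k.2.2.2.1]
  · rw [EnergySpace.y_add, A1val_y, A1val_y, A1val_y, EnergySpace.z_add]
  · rw [EnergySpace.z_add, A1val_z, A1val_z, A1val_z, EnergySpace.y_add,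
      dx_add h.2.2.2.2.1.1 k.2.2.2.2.1.1, dx_add h.2.2.2.2.1.2 k.2.2.2.2.1.2]

theorem A1val_smul (c : ℂ) (U : P.EnergySpace) (h : U ∈ P.domA1) (hc : c • U ∈ P.domA1) :
    P.A1val (c • U) hc = c • P.A1val U h := by
  apply EnergySpace.ext
  · rw [EnergySpace.u_smul, A1val_u, A1val_u, EnergySpace.v_smul]
  · rw [EnergySpace.v_smul, A1val_v, A1val_v, EnergySpace.u_smul, B_smul c h.2.2.2.1]
  · rw [EnergySpace.y_smul, A1val_y, A1val_y, EnergySpace.z_smul]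
  · rw [EnergySpace.z_smul, A1val_z, A1val_z, EnergySpace.y_smul,
      dx_smul c h.2.2.2.2.1.1, dx_smul c h.2.2.2.2.1.2]

/-- The unbounded operator `A_1` in `H_1` with domain `D(A_1)`. -/
def A1 : P.EnergySpace →ₗ.[ℂ] P.EnergySpace where
  domain := P.domA1
  toFun :=
    { toFun := fun U => P.A1val U.1 U.2
      map_add' := fun U W => P.A1val_add U.1 W.1 U.2 W.2 (U + W).2
      map_smul' := fun c U => P.A1val_smul c U.1 U.2 (c • U).2 }

end TransmissionData

/-! ### Abstract notions for an unbounded operator -/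

namespace Transmission

variable {H : Type*} [NormedAddCommGroup H] [InnerProductSpace ℂ H]

/-- `A` is m-dissipative: `Re (A U, U) ≤ 0` on `D(A)`, and `λ - A` maps `D(A)` onto the whole
space for every `λ > 0`. -/
def IsMDissipative (A : H →ₗ.[ℂ] H) : Prop :=
  (∀ U : A.domain, (inner ℂ (A U) (U : H)).re ≤ 0) ∧
    ∀ r : ℝ, 0 < r → ∀ G : H, ∃ U : A.domain, (r : ℂ) • (U : H) - A U = G

/-- `(T t)_{t ≥ 0}` is a strongly continuous semigroup of contractions (the values of `T` at
negative times are irrelevant). -/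
structure IsC0ContractionSemigroup (T : ℝ → H →L[ℂ] H) : Prop where
  zero : T 0 = ContinuousLinearMap.id ℂ H
  add : ∀ s t : ℝ, 0 ≤ s → 0 ≤ t → T (s + t) = (T s).comp (T t)
  contraction : ∀ t : ℝ, 0 ≤ t → ‖T t‖ ≤ 1
  continuous : ∀ U : H, ContinuousOn (fun t => T t U) (Ici 0)

/-- `A` is the infinitesimal generator of `(T t)_{t ≥ 0}`: one has `U ∈ D(A)` and `A U = F` if
and only if `(T t U - U) / t → F` as `t → 0⁺`. -/
def IsGenerator (A : H →ₗ.[ℂ] H) (T : ℝ → H →L[ℂ] H) : Prop :=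
  ∀ U F : H, (∃ h : U ∈ A.domain, A ⟨U, h⟩ = F) ↔
    Tendsto (fun t : ℝ => t⁻¹ • (T t U - U)) (𝓝[>] 0) (𝓝 F)

/-- `W ∈ D(A*)` and `A* W = W'`. -/
def IsAdjointPair (A : H →ₗ.[ℂ] H) (W W' : H) : Prop :=
  ∀ X : A.domain, inner ℂ W (A X) = inner ℂ W' (X : H)

/-- `U` is a weak solution in `C⁰(ℝ⁺; H)` of `U_t = A U`, `U(0) = U₀`: it is continuous and
`d/dt (U(t), W) = (U(t), A* W)` for all `t ≥ 0` and `W ∈ D(A*)`. -/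
def IsWeakSolution (A : H →ₗ.[ℂ] H) (U₀ : H) (U : ℝ → H) : Prop :=
  ContinuousOn U (Ici 0) ∧ U 0 = U₀ ∧
    ∀ W W' : H, IsAdjointPair A W W' → ∀ t : ℝ, 0 ≤ t →
      HasDerivWithinAt (fun s => inner ℂ W (U s)) (inner ℂ W' (U t)) (Ici 0) t

/-- `U` is a strong solution in `C¹(ℝ⁺; H) ∩ C⁰(ℝ⁺; D(A))` of `U_t = A U`, `U(0) = U₀`, where
`D(A)` carries the graph norm: `U` is differentiable, takes its values in `D(A)`, and `U` (which is
continuous) has a continuous derivative, equal to `A U`. -/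
def IsStrongSolution (A : H →ₗ.[ℂ] H) (U₀ : H) (U : ℝ → H) : Prop :=
  U 0 = U₀ ∧ ∃ V : ℝ → H, ContinuousOn V (Ici 0) ∧
    ∀ t : ℝ, 0 ≤ t → HasDerivWithinAt U (V t) (Ici 0) t ∧
      ∃ h : U t ∈ A.domain, A ⟨U t, h⟩ = V t

end Transmission

end

/-! ### Abstract theory of m-dissipative operators. -/

namespace Transmission

variable {H : Type*} [NormedAddCommGroup H] [InnerProductSpace ℂ H]

/-! The energy norm does not control `u / √σ`, so without a growth condition on `a` the space `H_1`
may fail to be complete, and the Lumer-Phillips theorem cannot be applied to it directly. The remedy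
is the operator `N U = u / √σ` (`weightU`). For the graph norm, whose square is `‖U‖² + ‖N U‖²`, the
space is always complete: `u_x`, `v / √σ`, `y_x`, `z` and `u / √σ` converge in `L²`, and the
relation between the limits of `u_x` and `u / √σ` persists (`isGraphComplete_weightU`). Moreover `N
A_1 U = v / √σ`, whence `‖N A_1 U‖ ≤ ‖U‖`, so that `A_1 - 1/2` is m-dissipative in the graph Hilbert
space (`isMDissipative_graphOp`). The Hille-Yosida theorem, proved by Yosida approximation in
`IsMDissipative.exists_semigroup`, gives a contraction semigroup `S` there. Then `T t = e^{t/2} S t`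
consists of contractions for the energy norm, because `A_1` itself is dissipative for it and its
domain is dense for the graph norm (`IsMDissipative.exists_semigroup_of_graphComplete`).

The operator is dissipative because integration by parts leaves `Re ⟨A_1 U, U⟩ = -|z(L)|²`. At the
degenerate end `0` the boundary term vanishes although the flux `η u_x` is not known to have a limit
there (`green_degenerate`). For the surjectivity of `l - A_1`, the elimination of `v = l u - f` and
`z = l y - h` leaves a variational problem for `(u, y)` with a Hermitian form. It is solved by an
orthogonal projection in a graph space (`exists_variational`), and `strong_of_weak` recovers the
equations, the transmission condition and the damping condition.

Strong solutions are unique by dissipativity. For weak ones, conjugation by time reversal turns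
`A_1` into its adjoint, so `1 - A_1*` is onto (`exists_isAdjointPair_sub_eq`). The resolvent `(1 -
A_1)⁻¹` then maps the difference of two weak solutions to a strong solution with initial value zero
(`IsWeakSolution.eqOn`).

Finally, the growth condition on `a` bounds `x² / σ`. Hardy's inequality then bounds `u / √σ` by
`u_x`, the graph norm is equivalent to the energy norm, and `H_1` is complete. -/

theorem hasDerivWithinAt_integral_of_continuousOn {E : Type*} [NormedAddCommGroup E]
    [NormedSpace ℝ E] [CompleteSpace E] {f : ℝ → E} (hf : ContinuousOn f (Ici 0)) {t : ℝ}
    (ht : 0 ≤ t) : HasDerivWithinAt (fun u => ∫ s in (0 : ℝ)..u, f s) (f t) (Ici 0) t := by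
  have h2 : ContinuousOn f (Icc 0 (t + 1)) := hf.mono Icc_subset_Ici_self
  have : Fact (t ∈ Icc 0 (t + 1)) := ⟨⟨ht, by linarith⟩⟩
  have h3 : HasDerivWithinAt (fun u => ∫ s in (0 : ℝ)..u, f s) (f t) (Icc 0 (t + 1)) t := by
    refine intervalIntegral.integral_hasDerivWithinAt_right ?_ ?_ (h2 t this.1)
    · refine (hf.mono ?_).intervalIntegrable
      rw [uIcc_of_le ht]
      exact Icc_subset_Ici_self
    · exact h2.stronglyMeasurableAtFilter_nhdsWithin measurableSet_Icc t
  refine h3.mono_of_mem_nhdsWithin ?_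
  have : Icc 0 (t + 1) = Ici 0 ∩ Iic (t + 1) := rfl
  rw [this]
  exact inter_mem self_mem_nhdsWithin (mem_nhdsWithin_of_mem_nhds (Iic_mem_nhds (by linarith)))

/-! ### Dissipative operators and their resolvents -/

/-- A trajectory whose velocity is dissipative does not increase in norm. -/
theorem norm_le_of_dissipative_flow {g g' : ℝ → H}
    (hg : ∀ t, 0 ≤ t → HasDerivWithinAt g (g' t) (Ici 0) t)
    (hd : ∀ t, 0 ≤ t → (inner ℂ (g' t) (g t)).re ≤ 0) {t : ℝ} (ht : 0 ≤ t) : ‖g t‖ ≤ ‖g 0‖ := by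
  have hderiv : ∀ s, 0 ≤ s →
      HasDerivWithinAt (fun s => ‖g s‖ ^ 2) (2 * (inner ℂ (g' s) (g s)).re) (Ici 0) s := by
    intro s hs
    have h1 : HasDerivWithinAt (fun s => inner ℂ (g s) (g s))
        (inner ℂ (g s) (g' s) + inner ℂ (g' s) (g s)) (Ici 0) s := (hg s hs).inner ℂ (hg s hs)
    have h2 := Complex.reCLM.hasFDerivAt.comp_hasDerivWithinAt s h1
    have e1 : (fun s => ‖g s‖ ^ 2) = (Complex.reCLM ∘ fun s => inner ℂ (g s) (g s)) := by
      funext s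
      simp only [Function.comp_apply, Complex.reCLM_apply]
      exact (inner_self_eq_norm_sq (𝕜 := ℂ) (g s)).symm
    rw [e1]
    refine h2.congr_deriv ?_
    rw [Complex.reCLM_apply, Complex.add_re, ← inner_conj_symm (g s) (g' s), Complex.conj_re]
    ring
  have hanti : AntitoneOn (fun s => ‖g s‖ ^ 2) (Ici 0) := by
    refine antitoneOn_of_hasDerivWithinAt_nonpos (f' := fun s => 2 * (inner ℂ (g' s) (g s)).re)
      (convex_Ici 0) (fun s hs => (hderiv s hs).continuousWithinAt) ?_ ?_
    · intro s hs
      rw [interior_Ici, mem_Ioi] at hs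
      exact (hderiv s hs.le).mono interior_subset
    · intro s hs
      rw [interior_Ici, mem_Ioi] at hs
      linarith [hd s hs.le]
  exact (sq_le_sq₀ (norm_nonneg _) (norm_nonneg _)).1 (hanti (mem_Ici.2 le_rfl) ht ht)

/-- `R` is the resolvent `(r - A)⁻¹`, bounded by `1 / r`. -/
structure IsResolventAt (A : H →ₗ.[ℂ] H) (r : ℝ) (R : H →L[ℂ] H) : Prop where
  mem : ∀ G, R G ∈ A.domain
  right_inv : ∀ G, (r : ℂ) • R G - A ⟨R G, mem G⟩ = G
  left_inv : ∀ U : A.domain, R ((r : ℂ) • (U : H) - A U) = U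
  norm_le : ‖R‖ ≤ r⁻¹

variable {A : H →ₗ.[ℂ] H}

/-- Pair `(r - A) U` with `U`: the real part is at least `r ‖U‖²`, and Cauchy-Schwarz concludes.
This gives the injectivity of `r - A` and the norm of the resolvent without any completeness of `H`.
-/
theorem mul_norm_le_norm_smul_sub (hA : ∀ U : A.domain, (inner ℂ (A U) (U : H)).re ≤ 0) (r : ℝ)
    (U : A.domain) : r * ‖(U : H)‖ ≤ ‖(r : ℂ) • (U : H) - A U‖ := by
  rcases eq_or_lt_of_le (norm_nonneg (U : H)) with h0 | h0
  · rw [← h0, mul_zero]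
    exact norm_nonneg _
  have h1 : (inner ℂ ((r : ℂ) • (U : H) - A U) (U : H)).re
      = r * ‖(U : H)‖ ^ 2 - (inner ℂ (A U) (U : H)).re := by
    rw [inner_sub_left, inner_smul_left, Complex.sub_re, Complex.conj_ofReal,
      Complex.re_ofReal_mul]
    congr 2
    exact inner_self_eq_norm_sq (𝕜 := ℂ) (U : H)
  have h2 : (inner ℂ ((r : ℂ) • (U : H) - A U) (U : H)).re
      ≤ ‖(r : ℂ) • (U : H) - A U‖ * ‖(U : H)‖ :=
    (Complex.re_le_norm _).trans (norm_inner_le_norm _ _)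
  have h3 := hA U
  have h4 : (r * ‖(U : H)‖) * ‖(U : H)‖ ≤ ‖(r : ℂ) • (U : H) - A U‖ * ‖(U : H)‖ := by
    nlinarith
  exact le_of_mul_le_mul_right h4 h0

theorem IsMDissipative.smul_sub_injective (hA : IsMDissipative A) {r : ℝ} (hr : 0 < r)
    {U W : A.domain} (h : (r : ℂ) • (U : H) - A U = (r : ℂ) • (W : H) - A W) : (U : H) = W := by
  have h1 := mul_norm_le_norm_smul_sub hA.1 r (U - W)
  have h2 : (r : ℂ) • ((U - W : A.domain) : H) - A (U - W) = 0 := by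
    rw [A.map_sub, Submodule.coe_sub, smul_sub, ← sub_eq_zero.2 h]
    abel
  rw [h2, norm_zero] at h1
  have h3 : ‖((U - W : A.domain) : H)‖ = 0 := by
    nlinarith [norm_nonneg ((U - W : A.domain) : H)]
  rw [norm_eq_zero, Submodule.coe_sub, sub_eq_zero] at h3
  exact h3

theorem IsMDissipative.exists_resolvent (hA : IsMDissipative A) {r : ℝ} (hr : 0 < r) :
    ∃ R : H →L[ℂ] H, IsResolventAt A r R := by
  choose R hR using hA.2 r hr
  have hRu : ∀ (U : A.domain) (G : H), (r : ℂ) • (U : H) - A U = G → (R G : H) = U := by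
    intro U G h
    exact hA.smul_sub_injective hr ((hR G).trans h.symm)
  let R₀ : H →ₗ[ℂ] H :=
    { toFun := fun G => R G
      map_add' := fun F G => by
        rw [hRu (R F + R G) (F + G), Submodule.coe_add]
        rw [A.map_add, Submodule.coe_add, smul_add, add_sub_add_comm, hR, hR]
      map_smul' := fun c G => by
        rw [hRu (c • R G) (c • G), Submodule.coe_smul, RingHom.id_apply]
        rw [A.map_smul, Submodule.coe_smul, smul_comm, ← smul_sub, hR] }
  have hb : ∀ G, ‖R₀ G‖ ≤ r⁻¹ * ‖G‖ := by
    intro G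
    have := mul_norm_le_norm_smul_sub hA.1 r (R G)
    rw [hR] at this
    rw [inv_mul_eq_div, le_div_iff₀ hr, mul_comm]
    exact this
  refine ⟨R₀.mkContinuous r⁻¹ hb, fun G => (R G).2, fun G => hR G, fun U => ?_,
    R₀.mkContinuous_norm_le (inv_nonneg.2 hr.le) hb⟩
  exact hRu U _ rfl

namespace IsResolventAt

variable {r s : ℝ} {R S : H →L[ℂ] H}

/-- Both sides equal `r R U - U`. -/
theorem apply_map (hR : IsResolventAt A r R) (U : A.domain) :
    R (A U) = A ⟨R U, hR.mem U⟩ := by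
  have h1 := hR.left_inv U
  have h2 := hR.right_inv U
  rw [map_sub, map_smul] at h1
  rw [sub_eq_iff_eq_add] at h1 h2
  rw [h1] at h2
  exact add_left_cancel h2

theorem comm (hR : IsResolventAt A r R) (hS : IsResolventAt A s S) (x : H) :
    R (S x) = S (R x) := by
  have h1 := hR.left_inv ⟨S (R x), hS.mem _⟩
  -- As `A` commutes with `S` on its domain, `r - A` may be moved past `S` and meets `R x`.
  have h2 : (r : ℂ) • S (R x) - A ⟨S (R x), hS.mem _⟩ = S x := by
    rw [← hS.apply_map ⟨R x, hR.mem x⟩, ← map_smul, ← map_sub, hR.right_inv]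
  rw [h2] at h1
  exact h1

theorem norm_smul_apply_le (hR : IsResolventAt A r R) (hr : 0 < r) (x : H) :
    ‖(r : ℂ) • R x‖ ≤ ‖x‖ := by
  have h1 := R.le_of_opNorm_le hR.norm_le x
  rw [norm_smul, Complex.norm_real, Real.norm_of_nonneg hr.le]
  calc r * ‖R x‖ ≤ r * (r⁻¹ * ‖x‖) := by gcongr
    _ = ‖x‖ := by rw [← mul_assoc, mul_inv_cancel₀ hr.ne', one_mul]

/-- The Yosida approximation `r (r R - 1) = A (r R)` of `A`. -/
def yosida (r : ℝ) (R : H →L[ℂ] H) : H →L[ℂ] H :=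
  (r : ℂ) • ((r : ℂ) • R - ContinuousLinearMap.id ℂ H)

theorem yosida_apply (r : ℝ) (R : H →L[ℂ] H) (x : H) :
    yosida r R x = (r : ℂ) • ((r : ℂ) • R x - x) := rfl

/-- On the domain the approximation is `r R` applied to `A U`; it tends to `A U` as soon as `r R`
tends strongly to the identity. -/
theorem yosida_apply_domain (hR : IsResolventAt A r R) (U : A.domain) :
    yosida r R U = (r : ℂ) • R (A U) := by
  have h1 := hR.left_inv U
  rw [map_sub, map_smul, sub_eq_iff_eq_add] at h1
  rw [yosida_apply]
  rw [h1, add_sub_cancel_left]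

/-- The operator `r R` is a contraction, so `Re ⟨r R x, x⟩ ≤ ‖x‖²`. -/
theorem yosida_dissipative (hR : IsResolventAt A r R) (hr : 0 < r) (x : H) :
    (inner ℂ (yosida r R x) x).re ≤ 0 := by
  rw [yosida_apply, inner_smul_left, Complex.conj_ofReal, Complex.re_ofReal_mul, inner_sub_left,
    Complex.sub_re]
  have h1 : (inner ℂ ((r : ℂ) • R x) x).re ≤ ‖x‖ * ‖x‖ :=
    (Complex.re_le_norm _).trans ((norm_inner_le_norm _ _).trans
      (mul_le_mul_of_nonneg_right (hR.norm_smul_apply_le hr x) (norm_nonneg x)))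
  have h2 : (inner ℂ x x).re = ‖x‖ ^ 2 := inner_self_eq_norm_sq (𝕜 := ℂ) x
  nlinarith

theorem yosida_commute (hR : IsResolventAt A r R) (hS : IsResolventAt A s S) :
    Commute (yosida r R) (yosida s S) := by
  have h : Commute R S := ContinuousLinearMap.ext fun x => hR.comm hS x
  have h1 : ∀ T : H →L[ℂ] H, Commute (ContinuousLinearMap.id ℂ H) T := fun T =>
    Commute.one_left T
  have h2 : ∀ T : H →L[ℂ] H, Commute T (ContinuousLinearMap.id ℂ H) := fun T =>
    Commute.one_right T
  refine Commute.smul_left (Commute.smul_right ?_ _) _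
  exact Commute.sub_left (Commute.sub_right ((h.smul_left _).smul_right _) (h2 _)) (h1 _)

theorem yosida_commute_self (hR : IsResolventAt A r R) (hS : IsResolventAt A s S) :
    Commute (yosida r R) S := by
  have h : Commute R S := ContinuousLinearMap.ext fun x => hR.comm hS x
  exact Commute.smul_left (Commute.sub_left (h.smul_left _) (Commute.one_left S)) _

end IsResolventAt

/-! ### Exponentials of bounded dissipative operators -/

section exponential

variable [CompleteSpace H] {B C : H →L[ℂ] H}

theorem hasDerivAt_exp_smul_apply (B : H →L[ℂ] H) (x : H) (t : ℝ) :
    HasDerivAt (fun s : ℝ => NormedSpace.exp (s • B) x) (NormedSpace.exp (t • B) (B x)) t := by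
  have h := hasDerivAt_exp_smul_const (𝕂 := ℝ) B t
  exact ((ContinuousLinearMap.apply ℂ H x).restrictScalars ℝ).hasFDerivAt.comp_hasDerivAt t h

theorem exp_smul_apply_comm (h : Commute B C) (t : ℝ) (x : H) :
    NormedSpace.exp (t • B) (C x) = C (NormedSpace.exp (t • B) x) :=
  congrArg (fun T : H →L[ℂ] H => T x) ((h.smul_left t).exp_left).eq

theorem norm_exp_smul_apply_le (hB : ∀ x, (inner ℂ (B x) x).re ≤ 0) {t : ℝ} (ht : 0 ≤ t) (x : H) :
    ‖NormedSpace.exp (t • B) x‖ ≤ ‖x‖ := by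
  have := norm_le_of_dissipative_flow (g := fun s : ℝ => NormedSpace.exp (s • B) x)
    (fun s _ => (hasDerivAt_exp_smul_apply B x s).hasDerivWithinAt)
    (fun s _ => by rw [exp_smul_apply_comm (Commute.refl B)]; exact hB _) ht
  simpa using this

/-- Duhamel's interpolation: the path `s ↦ e^{sB} e^{(t-s)C} x` joins the two vectors on `[0, t]`.
By commutation its velocity is `e^{sB} e^{(t-s)C} (B x - C x)`, and both exponentials are
contractions. -/
theorem norm_exp_smul_apply_sub_le (hB : ∀ x, (inner ℂ (B x) x).re ≤ 0)
    (hC : ∀ x, (inner ℂ (C x) x).re ≤ 0) (h : Commute B C) {t : ℝ} (ht : 0 ≤ t) (x : H) :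
    ‖NormedSpace.exp (t • B) x - NormedSpace.exp (t • C) x‖ ≤ t * ‖B x - C x‖ := by
  let k : ℝ → H := fun s => NormedSpace.exp (s • B) (NormedSpace.exp ((t - s) • C) x)
  have hk : ∀ s, HasDerivAt k
      (NormedSpace.exp (s • B) (NormedSpace.exp ((t - s) • C) (B x - C x))) s := by
    intro s
    have h1 := hasDerivAt_exp_smul_const (𝕂 := ℝ) B s
    have h2 : HasDerivAt (fun s : ℝ => NormedSpace.exp ((t - s) • C) x)
        (-(NormedSpace.exp ((t - s) • C) (C x))) s := by
      have := (hasDerivAt_exp_smul_apply C x (t - s)).scomp s ((hasDerivAt_id s).const_sub t)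
      simpa [Function.comp_def] using this
    have h3 := ((ContinuousLinearMap.restrictScalarsL ℂ H H ℝ ℝ).hasFDerivAt.comp_hasDerivAt s
      h1).clm_apply h2
    refine h3.congr_deriv ?_
    rw [map_sub, map_sub, exp_smul_apply_comm h.symm (t - s)]
    exact (congrArg₂ (· + ·) rfl (map_neg (NormedSpace.exp (s • B)) _)).trans
      (sub_eq_add_neg _ _).symm
  have := norm_image_sub_le_of_norm_deriv_le_segment' (f := k) (a := 0) (b := t)
    (C := ‖B x - C x‖) (fun s _ => (hk s).hasDerivWithinAt)
    (fun s hs => (norm_exp_smul_apply_le hB hs.1 _).trans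
      (norm_exp_smul_apply_le hC (by linarith [hs.2]) _)) t ⟨ht, le_rfl⟩
  simpa [k, mul_comm] using this

end exponential

/-! ### The semigroup of an m-dissipative operator -/

section generation

/-- A vector `W` orthogonal to the domain can be written `X - A X`. Orthogonality to `X` gives `‖X‖²
= Re ⟨A X, X⟩ ≤ 0`, so `X = 0` and `W = 0`. Completeness enters through the criterion of density by
orthogonality. -/
theorem IsMDissipative.dense_domain [CompleteSpace H] (hA : IsMDissipative A) :
    Dense (A.domain : Set H) := by
  rw [Submodule.dense_iff_topologicalClosure_eq_top, Submodule.topologicalClosure_eq_top_iff,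
    Submodule.eq_bot_iff]
  intro W hW
  obtain ⟨X, hX⟩ := hA.2 1 one_pos W
  have h1 : inner ℂ W (X : H) = 0 := (Submodule.mem_orthogonal' _ _).1 hW X X.2
  rw [Complex.ofReal_one, one_smul] at hX
  have h2 : (inner ℂ (X : H) (X : H)).re = ‖(X : H)‖ ^ 2 := inner_self_eq_norm_sq (𝕜 := ℂ) (X : H)
  have h3 := hA.1 X
  rw [← hX, inner_sub_left, sub_eq_zero] at h1
  rw [← h1, h2] at h3
  have h4 : (X : H) = 0 := by
    rw [← norm_eq_zero]
    nlinarith [norm_nonneg (X : H)]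
  have h5 : X = 0 := Subtype.ext h4
  rw [← hX, h5, A.map_zero, Submodule.coe_zero, sub_zero]

/-- Pointwise convergence of a sequence of contractions, along a convergent sequence. -/
theorem tendsto_apply_of_contraction {E : ℕ → H →L[ℂ] H} (hE : ∀ n x, ‖E n x‖ ≤ ‖x‖) {y : ℕ → H}
    {x z : H} (hx : Tendsto (fun n => E n x) atTop (𝓝 z)) (hy : Tendsto y atTop (𝓝 x)) :
    Tendsto (fun n => E n (y n)) atTop (𝓝 z) := by
  have h : Tendsto (fun n => E n (y n - x)) atTop (𝓝 0) := by
    refine squeeze_zero_norm (fun n => hE n _) ?_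
    simpa using (hy.sub_const x).norm
  simpa using h.add hx

theorem cauchySeq_apply_of_dense {E : ℕ → H →L[ℂ] H} (hE : ∀ n x, ‖E n x‖ ≤ ‖x‖) {D : Set H}
    (hD : Dense D) (h : ∀ x ∈ D, CauchySeq fun n => E n x) (x : H) : CauchySeq fun n => E n x := by
  rw [Metric.cauchySeq_iff']
  intro ε hε
  obtain ⟨y, hy, hxy⟩ := hD.exists_dist_lt x (show 0 < ε / 3 by positivity)
  obtain ⟨N, hN⟩ := Metric.cauchySeq_iff'.1 (h y hy) (ε / 3) (by positivity)
  refine ⟨N, fun n hn => ?_⟩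
  have key : ∀ n, dist (E n x) (E n y) ≤ dist x y := fun n => by
    rw [dist_eq_norm, dist_eq_norm, ← map_sub]
    exact hE n _
  calc dist (E n x) (E N x) ≤ dist (E n x) (E n y) + dist (E n y) (E N y) + dist (E N y) (E N x) :=
        dist_triangle4 _ _ _ _
    _ < ε / 3 + ε / 3 + ε / 3 := by
        have h1 := key n
        have h2 := key N
        rw [dist_comm] at h2
        linarith [hN n hn]
    _ = ε := by ring

theorem continuousOn_apply_of_dense {G : Type*} [NormedAddCommGroup G] [InnerProductSpace ℂ G]
    {T : ℝ → H →L[ℂ] G} {s : Set ℝ} {c : ℝ} (hT : ∀ t ∈ s, ∀ x, ‖T t x‖ ≤ c * ‖x‖) {D : Set H}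
    (hD : Dense D) (h : ∀ x ∈ D, ContinuousOn (fun t => T t x) s) (x : H) :
    ContinuousOn (fun t => T t x) s := by
  refine continuousOn_of_uniform_approx_of_continuousOn fun u hu => ?_
  obtain ⟨ε, hε, hu⟩ := Metric.mem_uniformity_dist.1 hu
  obtain ⟨y, hy, hxy⟩ := hD.exists_dist_lt x (show 0 < ε / (|c| + 1) by positivity)
  refine ⟨fun t => T t y, h y hy, fun t ht => hu ?_⟩
  rw [dist_eq_norm, ← map_sub]
  rw [dist_eq_norm, lt_div_iff₀ (by positivity)] at hxy
  have := hT t ht (x - y)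
  have h2 := le_abs_self c
  nlinarith [norm_nonneg (x - y)]

variable {R : ℕ → H →L[ℂ] H}

/-- For `y` in the domain, `r R y - y = R (A y)` has norm at most `‖A y‖ / r`. The operators `r R`
being contractions, the convergence extends to the closure of the domain. -/
theorem tendsto_smul_resolvent (hR : ∀ n : ℕ, IsResolventAt A (n + 1 : ℝ) (R n))
    (hD : Dense (A.domain : Set H)) (x : H) :
    Tendsto (fun n : ℕ => ((n + 1 : ℝ) : ℂ) • R n x) atTop (𝓝 x) := by
  have hc : ∀ (n : ℕ) (x : H), ‖(((n + 1 : ℝ) : ℂ) • R n) x‖ ≤ ‖x‖ := fun n x =>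
    (hR n).norm_smul_apply_le (by positivity) x
  rw [Metric.tendsto_atTop]
  intro ε hε
  obtain ⟨y, hy, hxy⟩ := hD.exists_dist_lt x (show 0 < ε / 3 by positivity)
  have hlim : Tendsto (fun n : ℕ => (n + 1 : ℝ)⁻¹ * ‖A ⟨y, hy⟩‖) atTop (𝓝 0) := by
    have := (tendsto_one_div_add_atTop_nhds_zero_nat (𝕜 := ℝ)).mul_const ‖A ⟨y, hy⟩‖
    simpa [one_div] using this
  obtain ⟨N, hN⟩ := (hlim.eventually (gt_mem_nhds (show 0 < ε / 3 by positivity))).exists_forall_of_atTop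
  refine ⟨N, fun n hn => ?_⟩
  have h1 : ((n + 1 : ℝ) : ℂ) • R n y - y = R n (A ⟨y, hy⟩) := by
    have := (hR n).left_inv ⟨y, hy⟩
    rw [map_sub, map_smul, sub_eq_iff_eq_add] at this
    rw [this, add_sub_cancel_left]
  have h2 : dist (((n + 1 : ℝ) : ℂ) • R n y) y < ε / 3 := by
    rw [dist_eq_norm, h1]
    exact ((R n).le_of_opNorm_le (hR n).norm_le _).trans_lt (hN n hn)
  have h3 : dist (((n + 1 : ℝ) : ℂ) • R n x) (((n + 1 : ℝ) : ℂ) • R n y) ≤ dist x y := by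
    rw [dist_eq_norm, dist_eq_norm, ← smul_sub, ← map_sub]
    exact hc n _
  have h4 := dist_triangle4 (((n + 1 : ℝ) : ℂ) • R n x) (((n + 1 : ℝ) : ℂ) • R n y) y x
  rw [dist_comm y x] at h4
  linarith

theorem tendsto_yosida (hR : ∀ n : ℕ, IsResolventAt A (n + 1 : ℝ) (R n))
    (hD : Dense (A.domain : Set H)) (U : A.domain) :
    Tendsto (fun n : ℕ => IsResolventAt.yosida (n + 1 : ℝ) (R n) U) atTop (𝓝 (A U)) := by
  simp only [fun n => (hR n).yosida_apply_domain U]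
  exact tendsto_smul_resolvent hR hD (A U)

/-- On the domain two of these exponentials differ by at most `t` times the difference of the Yosida
approximations, which converge to `A y`. Contractivity extends the property to all vectors by
density. -/
theorem cauchySeq_exp_yosida [CompleteSpace H] (hR : ∀ n : ℕ, IsResolventAt A (n + 1 : ℝ) (R n))
    (hD : Dense (A.domain : Set H)) {t : ℝ}
    (ht : 0 ≤ t) (x : H) :
    CauchySeq fun n : ℕ => NormedSpace.exp (t • IsResolventAt.yosida (n + 1 : ℝ) (R n)) x := by
  have hdiss := fun n : ℕ => (hR n).yosida_dissipative (by positivity)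
  refine cauchySeq_apply_of_dense (fun n x => norm_exp_smul_apply_le (hdiss n) ht x) hD ?_ x
  intro y hy
  rw [Metric.cauchySeq_iff]
  intro ε hε
  obtain ⟨N, hN⟩ := Metric.cauchySeq_iff.1 (tendsto_yosida hR hD ⟨y, hy⟩).cauchySeq (ε / (t + 1))
    (by positivity)
  refine ⟨N, fun m hm n hn => ?_⟩
  have h1 := hN m hm n hn
  rw [dist_eq_norm, lt_div_iff₀ (by positivity)] at h1
  rw [dist_eq_norm]
  refine (norm_exp_smul_apply_sub_le (hdiss m) (hdiss n) ((hR m).yosida_commute (hR n)) ht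
    y).trans_lt ?_
  nlinarith [norm_nonneg (IsResolventAt.yosida (m + 1 : ℝ) (R m) y
    - IsResolventAt.yosida (n + 1 : ℝ) (R n) y)]

/-- The Hille-Yosida theorem in a Hilbert space. -/
theorem IsMDissipative.exists_semigroup [CompleteSpace H] (hA : IsMDissipative A) :
    ∃ S : ℝ → H →L[ℂ] H, IsC0ContractionSemigroup S ∧ ∀ (U : A.domain) (t : ℝ), 0 ≤ t →
      (∃ h : S t U ∈ A.domain, A ⟨S t U, h⟩ = S t (A U)) ∧
        HasDerivWithinAt (fun s => S s U) (S t (A U)) (Ici 0) t := by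
  have hD := hA.dense_domain
  choose R hR using fun n : ℕ => hA.exists_resolvent (show (0 : ℝ) < n + 1 by positivity)
  set Y : ℕ → H →L[ℂ] H := fun n => IsResolventAt.yosida (n + 1 : ℝ) (R n) with hY
  have hdiss : ∀ n x, (inner ℂ (Y n x) x).re ≤ 0 := fun n =>
    (hR n).yosida_dissipative (by positivity)
  have hE : ∀ {t : ℝ}, 0 ≤ t → ∀ n x, ‖NormedSpace.exp (t • Y n) x‖ ≤ ‖x‖ := fun ht n x =>
    norm_exp_smul_apply_le (hdiss n) ht x
  -- The time is truncated at `0` because the exponentials are known to be contractions for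
  -- nonnegative times only.
  have hex : ∀ (t : ℝ) (x : H), ∃ z, Tendsto (fun n => NormedSpace.exp (max t 0 • Y n) x) atTop
      (𝓝 z) := fun t x =>
    cauchySeq_tendsto_of_complete (cauchySeq_exp_yosida hR hD (le_max_right t 0) x)
  choose S₀ hS₀ using hex
  let S : ℝ → H →L[ℂ] H := fun t => continuousLinearMapOfTendsto
    (fun n => NormedSpace.exp (max t 0 • Y n)) (tendsto_pi_nhds.2 (hS₀ t))
  have hS : ∀ {t : ℝ}, 0 ≤ t → ∀ x, Tendsto (fun n => NormedSpace.exp (t • Y n) x) atTop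
      (𝓝 (S t x)) := by
    intro t ht x
    have := hS₀ t x
    rwa [max_eq_left ht] at this
  have hSn : ∀ {t : ℝ}, 0 ≤ t → ∀ x, ‖S t x‖ ≤ ‖x‖ := fun ht x =>
    le_of_tendsto (hS ht x).norm (Eventually.of_forall fun n => hE ht n x)
  have hS0 : S 0 = ContinuousLinearMap.id ℂ H := by
    ext x
    refine tendsto_nhds_unique (hS le_rfl x) ?_
    simp
  have hadd : ∀ s t : ℝ, 0 ≤ s → 0 ≤ t → S (s + t) = (S s).comp (S t) := by
    intro s t hs ht
    ext x
    refine tendsto_nhds_unique (hS (add_nonneg hs ht) x) ?_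
    have h1 := tendsto_apply_of_contraction (hE hs) (hS hs (S t x)) (hS ht x)
    refine h1.congr fun n => ?_
    let := NormedAlgebra.restrictScalars ℚ ℂ (H →L[ℂ] H)
    rw [add_smul, NormedSpace.exp_add_of_commute
      (((Commute.refl (Y n)).smul_left s).smul_right t)]
    rfl
  -- The integrated equation holds for every Yosida approximation and passes to the limit by
  -- dominated convergence, with the bound `‖Y n U‖ ≤ ‖A U‖`. It serves twice: it makes the orbits
  -- in the domain Lipschitz and, once strong continuity is known, it gives their derivative.
  have hint : ∀ (U : A.domain) {t : ℝ}, 0 ≤ t →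
      S t U = (U : H) + ∫ s in (0 : ℝ)..t, S s (A U) := by
    intro U t ht
    have h1 : ∀ n, NormedSpace.exp (t • Y n) (U : H)
        = U + ∫ s in (0 : ℝ)..t, NormedSpace.exp (s • Y n) (Y n U) := by
      intro n
      rw [intervalIntegral.integral_eq_sub_of_hasDerivAt
        (fun s _ => hasDerivAt_exp_smul_apply (Y n) (U : H) s)]
      · simp
      · refine Continuous.intervalIntegrable ?_ _ _
        exact continuous_iff_continuousAt.2 fun s =>
          (hasDerivAt_exp_smul_apply (Y n) (Y n U) s).continuousAt
    have h2 := hS ht (U : H)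
    simp only [h1] at h2
    refine tendsto_nhds_unique h2 (Tendsto.const_add _ ?_)
    refine intervalIntegral.tendsto_integral_filter_of_dominated_convergence (fun _ => ‖A U‖) ?_ ?_
      intervalIntegrable_const ?_
    · refine Eventually.of_forall fun n => Continuous.aestronglyMeasurable ?_
      exact continuous_iff_continuousAt.2 fun s =>
          (hasDerivAt_exp_smul_apply (Y n) (Y n U) s).continuousAt
    · refine Eventually.of_forall fun n => Eventually.of_forall fun s hs => ?_
      rw [uIoc_of_le ht] at hs
      refine (hE hs.1.le n _).trans ?_
      rw [hY]
      simp only [(hR n).yosida_apply_domain U]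
      exact (hR n).norm_smul_apply_le (by positivity) _
    · refine Eventually.of_forall fun s hs => ?_
      rw [uIoc_of_le ht] at hs
      exact tendsto_apply_of_contraction (hE hs.1.le) (hS hs.1.le (A U)) (tendsto_yosida hR hD U)
  have hcont : ∀ x, ContinuousOn (fun t => S t x) (Ici 0) := by
    refine continuousOn_apply_of_dense (c := 1) (fun t ht x => by rw [one_mul]; exact hSn ht x) hD ?_
    intro x hx
    -- By the semigroup law and contractivity the increment is bounded by `‖S (t - s) x - x‖`, and
    -- the integrated equation bounds this by `(t - s) ‖A x‖`.
    have hlip : ∀ s t : ℝ, 0 ≤ s → s ≤ t → ‖S t x - S s x‖ ≤ ‖A ⟨x, hx⟩‖ * (t - s) := by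
      intro s t hs hst
      have e : S t x = S s (S (t - s) x) := by
        rw [← ContinuousLinearMap.comp_apply, ← hadd s (t - s) hs (by linarith)]
        congr 2
        ring
      rw [e, ← map_sub]
      refine (hSn hs _).trans ?_
      rw [hint ⟨x, hx⟩ (by linarith : 0 ≤ t - s), add_sub_cancel_left]
      have := intervalIntegral.norm_integral_le_of_norm_le_const (a := 0) (b := t - s)
        (f := fun s => S s (A ⟨x, hx⟩)) (C := ‖A ⟨x, hx⟩‖) ?_
      · rwa [sub_zero, abs_of_nonneg (by linarith)] at this
      · intro r hr
        rw [uIoc_of_le (by linarith)] at hr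
        exact hSn hr.1.le _
    have : LipschitzOnWith ‖A ⟨x, hx⟩‖₊ (fun t => S t x) (Ici 0) := by
      refine LipschitzOnWith.of_dist_le_mul fun t ht s hs => ?_
      rw [dist_eq_norm, coe_nnnorm, Real.dist_eq]
      rcases le_total s t with h | h
      · rw [abs_of_nonneg (by linarith)]
        exact hlip s t hs h
      · rw [abs_of_nonpos (by linarith), neg_sub, norm_sub_rev]
        exact hlip t s ht h
    exact this.continuousOn
  refine ⟨S, ⟨hS0, hadd, fun t ht => ContinuousLinearMap.opNorm_le_bound _ zero_le_one
    fun x => by rw [one_mul]; exact hSn ht x, hcont⟩, fun U t ht => ⟨?_, ?_⟩⟩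
  -- The operator `R 0` is `(1 - A)⁻¹`, and `S t` commutes with it as a limit of operators that do.
  -- Hence `S t U = R 0 (S t ((1 - A) U))` lies in the domain, and applying `1 - A` gives `A (S t U)
  -- = S t (A U)`.
  · have hcomm : ∀ x, R 0 (S t x) = S t (R 0 x) := by
      intro x
      refine tendsto_nhds_unique (((R 0).continuous.tendsto _).comp (hS ht x)) ?_
      refine (hS ht (R 0 x)).congr fun n => ?_
      exact exp_smul_apply_comm ((hR n).yosida_commute_self (hR 0)) t x
    have h1 : S t U = R 0 (S t (((0 : ℕ) + 1 : ℝ) • (U : H) - A U)) := by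
      rw [hcomm]
      congr 1
      exact ((hR 0).left_inv U).symm
    have h2 := (hR 0).right_inv (S t (((0 : ℕ) + 1 : ℝ) • (U : H) - A U))
    have h3 : S t U ∈ A.domain := h1 ▸ (hR 0).mem _
    refine ⟨h3, ?_⟩
    have h4 : (⟨R 0 (S t (((0 : ℕ) + 1 : ℝ) • (U : H) - A U)), (hR 0).mem _⟩ : A.domain)
        = ⟨S t U, h3⟩ := Subtype.ext h1.symm
    rw [h4, ← h1] at h2
    simp only [Nat.cast_zero, zero_add, Complex.ofReal_one, one_smul, map_sub] at h2
    exact sub_right_injective h2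
  · exact ((hasDerivWithinAt_integral_of_continuousOn (hcont (A U)) ht).const_add (U : H)).congr
      (fun s hs => hint U hs) (hint U ht)

end generation

end Transmission

namespace Transmission

variable {H : Type*} [NormedAddCommGroup H] [InnerProductSpace ℂ H]
variable {X : Type*} [NormedAddCommGroup X] [InnerProductSpace ℂ X]

/-! ### Graph spaces -/

/-- `H` is complete for the graph norm of `N`. -/
def IsGraphComplete (N : H →ₗ[ℂ] X) : Prop :=
  ∀ U : ℕ → H, CauchySeq U → CauchySeq (fun n => N (U n)) →
    ∃ V, Tendsto U atTop (𝓝 V) ∧ Tendsto (fun n => N (U n)) atTop (𝓝 (N V))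

/-- The graph of `N`, with the Hilbert norm of the product. -/
def graphSpace (N : H →ₗ[ℂ] X) : Submodule ℂ (WithLp 2 (H × X)) where
  carrier := {p | p.snd = N p.fst}
  add_mem' := by
    intro p q (hp : p.snd = N p.fst) (hq : q.snd = N q.fst)
    change (p + q).snd = N (p + q).fst
    rw [WithLp.add_snd, WithLp.add_fst, map_add, hp, hq]
  zero_mem' := by
    change (0 : WithLp 2 (H × X)).snd = N (0 : WithLp 2 (H × X)).fst
    rw [WithLp.zero_snd, WithLp.zero_fst, map_zero]
  smul_mem' := by
    intro c p (hp : p.snd = N p.fst)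
    change (c • p).snd = N (c • p).fst
    rw [WithLp.smul_snd, WithLp.smul_fst, map_smul, hp]

/-- The isomorphism of `H` with the graph of `N`. -/
def toGraph (N : H →ₗ[ℂ] X) : H →ₗ[ℂ] graphSpace N where
  toFun x := ⟨WithLp.toLp 2 (x, N x), rfl⟩
  map_add' x y := Subtype.ext (congrArg (fun n => WithLp.toLp 2 (x + y, n)) (map_add N x y))
  map_smul' c x := Subtype.ext (congrArg (fun n => WithLp.toLp 2 (c • x, n)) (map_smul N c x))

/-- The projection of the graph of `N` onto `H`. -/
def graphFst (N : H →ₗ[ℂ] X) : graphSpace N →L[ℂ] H :=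
  (WithLp.fstL 2 ℂ H X).comp (graphSpace N).subtypeL

variable {N : H →ₗ[ℂ] X}

@[simp] theorem graphFst_toGraph (x : H) : graphFst N (toGraph N x) = x := rfl

@[simp] theorem toGraph_graphFst (k : graphSpace N) : toGraph N (graphFst N k) = k := by
  apply Subtype.ext
  have h : (k : WithLp 2 (H × X)).snd = N (k : WithLp 2 (H × X)).fst := k.2
  change WithLp.toLp 2 ((k : WithLp 2 (H × X)).fst, N (k : WithLp 2 (H × X)).fst) = k
  rw [← h]
  rfl

theorem inner_toGraph (x y : H) :
    inner ℂ (toGraph N x) (toGraph N y) = inner ℂ x y + inner ℂ (N x) (N y) := rfl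

theorem IsGraphComplete.completeSpace (hN : IsGraphComplete N) : CompleteSpace (graphSpace N) := by
  refine Metric.complete_of_cauchySeq_tendsto fun u hu => ?_
  have h1 : CauchySeq fun n => graphFst N (u n) :=
    hu.map (graphFst N).uniformContinuous
  have h2 : CauchySeq fun n => N (graphFst N (u n)) := by
    have := hu.map ((WithLp.sndL 2 ℂ H X).comp (graphSpace N).subtypeL).uniformContinuous
    have e : ∀ n, N (graphFst N (u n)) = (u n : WithLp 2 (H × X)).snd := fun n => (u n).2.symm
    simp only [e]
    exact this
  obtain ⟨V, hV1, hV2⟩ := hN _ h1 h2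
  refine ⟨toGraph N V, ?_⟩
  rw [tendsto_subtype_rng]
  have h3 := ((WithLp.prod_continuous_toLp 2 H X).tendsto (V, N V)).comp (hV1.prodMk_nhds hV2)
  refine h3.congr fun n => ?_
  exact congrArg Subtype.val (toGraph_graphFst (u n))

/-- The Riesz representation theorem in the graph space of `C`. -/
theorem IsGraphComplete.exists_variational {C : H →ₗ[ℂ] X} (hC : IsGraphComplete C) (D : X) :
    ∃ U : H, ∀ Φ : H, inner ℂ Φ U + inner ℂ (C Φ) (C U) = inner ℂ (C Φ) D := by
  have := hC.completeSpace
  -- The solution is the first component of the orthogonal projection of `(0, D)` onto the graph: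
  -- the functional `Φ ↦ ⟨C Φ, D⟩` is the product of `(Φ, C Φ)` with this vector.
  let p : WithLp 2 (H × X) := WithLp.toLp 2 (0, D)
  have hmem : (graphSpace C).starProjection p ∈ graphSpace C :=
    Submodule.starProjection_apply_mem _ _
  refine ⟨graphFst C ⟨_, hmem⟩, fun Φ => ?_⟩
  have h := (graphSpace C).sub_starProjection_mem_orthogonal p
  have h1 := (Submodule.mem_orthogonal _ _).1 h _ (toGraph C Φ).2
  rw [inner_sub_right, sub_eq_zero] at h1
  have h2 : inner ℂ ((toGraph C Φ : graphSpace C) : WithLp 2 (H × X)) p = inner ℂ (C Φ) D := by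
    rw [WithLp.prod_inner_apply]
    change inner ℂ Φ 0 + inner ℂ (C Φ) D = _
    rw [inner_zero_right, zero_add]
  rw [← inner_toGraph, toGraph_graphFst, ← h2, h1]
  rfl

/-- If `H` is complete for the graph norm of `N`, it is so for that of `x ↦ (c N x, D x)` with
`c ≠ 0` and `D` bounded. -/
theorem IsGraphComplete.smul_prod {Y : Type*} [NormedAddCommGroup Y] [InnerProductSpace ℂ Y]
    (hN : IsGraphComplete N) {c : ℂ} (hc : c ≠ 0) (D : H →L[ℂ] Y) (C : H →ₗ[ℂ] WithLp 2 (X × Y))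
    (hC : ∀ x, C x = WithLp.toLp 2 (c • N x, D x)) : IsGraphComplete C := by
  intro U hU hCU
  have h1 : CauchySeq fun n => N (U n) := by
    have h3 := (hCU.map (c⁻¹ • WithLp.fstL 2 ℂ X Y).uniformContinuous)
    have e : ∀ n, N (U n) = (c⁻¹ • WithLp.fstL 2 ℂ X Y) (C (U n)) := by
      intro n
      simp [hC, smul_smul, hc]
    simp only [e]
    exact h3
  obtain ⟨V, hV1, hV2⟩ := hN U hU h1
  refine ⟨V, hV1, ?_⟩
  simp only [hC]
  exact ((WithLp.prod_continuous_toLp 2 X Y).tendsto (c • N V, D V)).comp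
    ((hV2.const_smul c).prodMk_nhds ((D.continuous.tendsto V).comp hV1))

/-! ### Contraction semigroups in a space that is complete only for a graph norm -/

variable {A : H →ₗ.[ℂ] H}

/-- The operator `A - 1/2` in the graph space of `N`. -/
noncomputable def graphOp (A : H →ₗ.[ℂ] H) (N : H →ₗ[ℂ] X) : graphSpace N →ₗ.[ℂ] graphSpace N where
  domain := A.domain.comap (graphFst N).toLinearMap
  toFun := (toGraph N).comp (A.toFun.comp
      (((graphFst N).toLinearMap.domRestrict _).codRestrict A.domain fun k => k.2))
    - (1 / 2 : ℂ) • Submodule.subtype _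

theorem graphOp_apply (k : (graphOp A N).domain) :
    graphOp A N k = toGraph N (A ⟨graphFst N k, k.2⟩) - (1 / 2 : ℂ) • (k : graphSpace N) := rfl

/-- The graph product adds the term `Re ⟨N A U, N U⟩ ≤ ‖U‖ ‖N U‖ ≤ (‖U‖² + ‖N U‖²) / 2`, which the
shift by `1/2` absorbs. Surjectivity is that of `(r + 1/2) - A` in `H`. -/
theorem isMDissipative_graphOp (hA : IsMDissipative A)
    (hN : ∀ U : A.domain, ‖N (A U)‖ ≤ ‖(U : H)‖) : IsMDissipative (graphOp A N) := by
  constructor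
  · intro k
    rw [graphOp_apply]
    obtain ⟨k, hk⟩ := k
    obtain ⟨x, rfl⟩ : ∃ x, k = toGraph N x := ⟨_, (toGraph_graphFst k).symm⟩
    have hx : x ∈ A.domain := hk
    change (inner ℂ (toGraph N (A ⟨x, hx⟩) - (1 / 2 : ℂ) • toGraph N x) (toGraph N x)).re ≤ 0
    rw [inner_sub_left, inner_smul_left (toGraph N x), inner_toGraph, inner_toGraph]
    have e : conj (1 / 2 : ℂ) = ((1 / 2 : ℝ) : ℂ) := by
      rw [show (1 / 2 : ℂ) = ((1 / 2 : ℝ) : ℂ) by norm_num, Complex.conj_ofReal]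
    rw [e, Complex.sub_re, Complex.re_ofReal_mul, Complex.add_re, Complex.add_re]
    have h1 := hA.1 ⟨x, hx⟩
    have h2 : (inner ℂ (N (A ⟨x, hx⟩)) (N x)).re ≤ ‖x‖ * ‖N x‖ :=
      (Complex.re_le_norm _).trans ((norm_inner_le_norm _ _).trans
        (mul_le_mul_of_nonneg_right (hN ⟨x, hx⟩) (norm_nonneg _)))
    have h3 : (inner ℂ x x).re = ‖x‖ ^ 2 := inner_self_eq_norm_sq (𝕜 := ℂ) x
    have h4 : (inner ℂ (N x) (N x)).re = ‖N x‖ ^ 2 := inner_self_eq_norm_sq (𝕜 := ℂ) (N x)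
    simp only at h1
    nlinarith [sq_nonneg (‖x‖ - ‖N x‖)]
  · intro r hr G
    obtain ⟨U, hU⟩ := hA.2 (r + 1 / 2) (by positivity) (graphFst N G)
    refine ⟨⟨toGraph N U, U.2⟩, ?_⟩
    rw [graphOp_apply]
    change (r : ℂ) • toGraph N U - (toGraph N (A U) - (1 / 2 : ℂ) • toGraph N U) = G
    rw [← toGraph_graphFst G, ← hU, map_sub, map_smul]
    push_cast
    module

/-- Generation of a contraction semigroup by an m-dissipative operator in a space that is complete
only for the graph norm of an operator `N` with `‖N A U‖ ≤ ‖U‖`. -/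
theorem IsMDissipative.exists_semigroup_of_graphComplete (hA : IsMDissipative A)
    (hc : IsGraphComplete N) (hN : ∀ U : A.domain, ‖N (A U)‖ ≤ ‖(U : H)‖) :
    Dense (A.domain : Set H) ∧
    ∃ T : ℝ → H →L[ℂ] H, IsC0ContractionSemigroup T ∧ ∀ (U : A.domain) (t : ℝ), 0 ≤ t →
      (∃ h : T t U ∈ A.domain, A ⟨T t U, h⟩ = T t (A U)) ∧
        HasDerivWithinAt (fun s => T s U) (T t (A U)) (Ici 0) t := by
  have := hc.completeSpace
  have hG := isMDissipative_graphOp hA hN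
  obtain ⟨S, hS, hSA⟩ := hG.exists_semigroup
  have hD := hG.dense_domain
  -- The factor `e^{t/2}` undoes the shift by `1/2` in `graphOp`.
  let c : ℝ → ℂ := fun t => ((Real.exp (t / 2) : ℝ) : ℂ)
  have hcd : ∀ t, HasDerivAt c ((1 / 2 : ℂ) * c t) t := by
    intro t
    have h1 : HasDerivAt (fun t : ℝ => Real.exp (t / 2)) (Real.exp (t / 2) * (1 / 2)) t :=
      ((hasDerivAt_id t).div_const 2).exp
    refine h1.ofReal_comp.congr_deriv ?_
    simp only [c]
    push_cast
    ring
  have hc0 : c 0 = 1 := by simp [c]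
  have hcadd : ∀ s t, c (s + t) = c s * c t := by
    intro s t
    simp only [c]
    rw [add_div, Real.exp_add, Complex.ofReal_mul]
  let T₀ : ℝ → H →ₗ[ℂ] H := fun t => c t • (graphFst N).toLinearMap.comp
    ((S t).toLinearMap.comp (toGraph N))
  have hT₀ : ∀ t x, T₀ t x = c t • graphFst N (S t (toGraph N x)) := fun t x => rfl
  have hdom : ∀ (U : A.domain) (t : ℝ), 0 ≤ t →
      (∃ h : T₀ t U ∈ A.domain, A ⟨T₀ t U, h⟩ = T₀ t (A U)) ∧
        HasDerivWithinAt (fun s => T₀ s U) (T₀ t (A U)) (Ici 0) t := by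
    intro U t ht
    obtain ⟨⟨h1, h2⟩, h3⟩ := hSA ⟨toGraph N U, U.2⟩ t ht
    simp only [graphOp_apply] at h1 h2 h3
    have e0 : (⟨graphFst N (toGraph N (U : H)), U.2⟩ : A.domain) = U := rfl
    simp only [graphFst_toGraph, Subtype.coe_eta] at h2 h3
    have h4 : graphFst N (S t (toGraph N U)) ∈ A.domain := h1
    have h5 : A ⟨graphFst N (S t (toGraph N U)), h4⟩ = graphFst N (S t (toGraph N (A U))) := by
      have := congrArg (graphFst N) h2
      simp only [map_sub, map_smul, graphFst_toGraph] at this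
      exact sub_left_injective this
    refine ⟨⟨A.domain.smul_mem _ h4, ?_⟩, ?_⟩
    · have := A.map_smul (c t) ⟨graphFst N (S t (toGraph N U)), h4⟩
      rw [h5] at this
      exact this
    · have h6 : HasDerivWithinAt (fun s => graphFst N (S s (toGraph N U)))
          (graphFst N (S t (toGraph N (A U) - (1 / 2 : ℂ) • toGraph N U))) (Ici 0) t :=
        ((graphFst N).restrictScalars ℝ).hasFDerivAt.comp_hasDerivWithinAt t h3
      have h7 := (hcd t).hasDerivWithinAt.smul h6
      refine h7.congr_deriv ?_
      rw [hT₀]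
      simp only [map_sub, map_smul]
      module
  -- For `k` in the domain the orbit solves the equation of `A`, which is dissipative for the norm
  -- of `H`, so this norm does not increase. Both sides are continuous for the graph norm, for which
  -- the domain is dense.
  have hdiss : ∀ (k : graphSpace N) (t : ℝ), 0 ≤ t → ‖c t • graphFst N (S t k)‖ ≤ ‖graphFst N k‖ := by
    intro k t ht
    refine hD.induction (P := fun k => ‖c t • graphFst N (S t k)‖ ≤ ‖graphFst N k‖) ?_ ?_ k
    · intro k hk
      have hU : graphFst N k ∈ A.domain := hk
      have h1 := fun s hs => hdom ⟨graphFst N k, hU⟩ s hs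
      have h2 := norm_le_of_dissipative_flow (g := fun s => T₀ s (graphFst N k))
        (fun s hs => (h1 s hs).2) (fun s hs => by
          obtain ⟨⟨h3, h4⟩, -⟩ := h1 s hs
          rw [← h4]
          exact hA.1 ⟨_, h3⟩) ht
      simp only [hT₀, toGraph_graphFst, hc0, one_smul, hS.zero] at h2
      exact h2
    · exact isClosed_le (by fun_prop) (by fun_prop)
  have hT : ∀ t, ∃ T : H →L[ℂ] H, 0 ≤ t → ∀ x, T x = T₀ t x := by
    intro t
    by_cases ht : 0 ≤ t
    · exact ⟨(T₀ t).mkContinuous 1 (fun x => by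
        rw [one_mul]
        exact hdiss (toGraph N x) t ht), fun _ x => rfl⟩
    · exact ⟨0, fun h => absurd h ht⟩
  choose T hT using hT
  refine ⟨?_, T, ⟨?_, ?_, ?_, ?_⟩, ?_⟩
  · have h1 : DenseRange (graphFst N) :=
      Function.Surjective.denseRange fun x => ⟨toGraph N x, graphFst_toGraph x⟩
    refine (h1.dense_image (graphFst N).continuous hD).mono ?_
    rintro _ ⟨k, hk, rfl⟩
    exact hk
  · ext x
    rw [hT 0 le_rfl, hT₀, hc0, hS.zero]
    simp
  · intro s t hs ht
    ext x
    rw [ContinuousLinearMap.comp_apply, hT _ (add_nonneg hs ht), hT s hs, hT t ht, hT₀, hT₀, hT₀,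
      hS.add s t hs ht, map_smul, toGraph_graphFst, hcadd, mul_comm, mul_smul, map_smul, map_smul,
      smul_comm]
    rfl
  · intro t ht
    refine ContinuousLinearMap.opNorm_le_bound _ zero_le_one fun x => ?_
    rw [hT t ht, one_mul]
    exact hdiss (toGraph N x) t ht
  · intro x
    have h1 : ContinuousOn (fun t => T₀ t x) (Ici 0) := by
      simp only [hT₀]
      refine ContinuousOn.smul (fun t _ => (hcd t).continuousAt.continuousWithinAt) ?_
      exact (graphFst N).continuous.comp_continuousOn (hS.continuous _)
    exact h1.congr fun t ht => hT t ht x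
  · intro U t ht
    obtain ⟨⟨h1, h2⟩, h3⟩ := hdom U t ht
    have e := hT t ht U
    refine ⟨?_, ?_⟩
    · have h4 : T t U ∈ A.domain := by rw [e]; exact h1
      refine ⟨h4, ?_⟩
      rw [hT t ht (A U), ← h2]
      congr 1
      exact Subtype.ext e
    · rw [hT t ht (A U)]
      exact h3.congr (fun s hs => hT s hs U) e

/-! ### Generator, weak solutions, strong solutions -/

section solutions

variable {T : ℝ → H →L[ℂ] H}

theorem IsC0ContractionSemigroup.norm_apply_le (hT : IsC0ContractionSemigroup T) {t : ℝ}
    (ht : 0 ≤ t) (x : H) : ‖T t x‖ ≤ ‖x‖ :=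
  ((T t).le_of_opNorm_le (hT.contraction t ht) x).trans_eq (one_mul _)

/-- The generator of a contraction semigroup is dissipative, and here it extends `A`. Since `1 - A`
is already onto, the extension cannot be proper. -/
theorem isGenerator_of_domain (hA : IsMDissipative A) (hT : IsC0ContractionSemigroup T)
    (hTA : ∀ U : A.domain, HasDerivWithinAt (fun s => T s U) (A U) (Ici 0) 0) :
    IsGenerator A T := by
  have hlim : ∀ U : A.domain, Tendsto (fun t : ℝ => t⁻¹ • (T t U - (U : H))) (𝓝[>] 0) (𝓝 (A U)) := by
    intro U
    have h1 := (hTA U).mono Ioi_subset_Ici_self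
    rw [hasDerivWithinAt_iff_tendsto_slope' (by simp)] at h1
    refine h1.congr fun t => ?_
    simp [slope, hT.zero]
  intro U F
  refine ⟨fun ⟨h, e⟩ => e ▸ hlim ⟨U, h⟩, fun hF => ?_⟩
  -- With this `Y` the difference quotients at `U - Y` tend to `F - A Y = U - Y`. Contractivity
  -- makes the real part of their product with `U - Y` nonpositive, so `‖U - Y‖² ≤ 0`.
  obtain ⟨Y, hY⟩ := hA.2 1 one_pos (U - F)
  rw [Complex.ofReal_one, one_smul] at hY
  have h1 : Tendsto (fun t : ℝ => t⁻¹ • (T t (U - Y) - (U - Y))) (𝓝[>] 0) (𝓝 (U - Y)) := by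
    have h2 := hF.sub (hlim Y)
    have e : F - A Y = U - Y := by
      rw [sub_eq_iff_eq_add] at hY
      rw [hY]
      abel_nf
    rw [e] at h2
    refine h2.congr fun t => ?_
    rw [map_sub, ← smul_sub]
    congr 1
    abel
  have h3 : (inner ℂ (U - Y : H) (U - Y : H)).re ≤ 0 := by
    refine le_of_tendsto ((Complex.continuous_re.tendsto _).comp (h1.inner tendsto_const_nhds)) ?_
    filter_upwards [self_mem_nhdsWithin] with t ht
    rw [mem_Ioi] at ht
    rw [Function.comp_apply, ← Complex.coe_smul, inner_smul_left, Complex.conj_ofReal,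
      Complex.re_ofReal_mul, inner_sub_left, Complex.sub_re]
    have h4 : (inner ℂ (T t (U - Y : H)) (U - Y : H)).re ≤ ‖(U - Y : H)‖ * ‖(U - Y : H)‖ :=
      (Complex.re_le_norm _).trans ((norm_inner_le_norm _ _).trans
        (mul_le_mul_of_nonneg_right (hT.norm_apply_le ht.le _) (norm_nonneg _)))
    have h5 : (inner ℂ (U - Y : H) (U - Y : H)).re = ‖(U - Y : H)‖ ^ 2 :=
      inner_self_eq_norm_sq (𝕜 := ℂ) _
    have : 0 ≤ t⁻¹ := inv_nonneg.2 ht.le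
    nlinarith
  have h5 : (inner ℂ (U - Y : H) (U - Y : H)).re = ‖(U - Y : H)‖ ^ 2 :=
    inner_self_eq_norm_sq (𝕜 := ℂ) _
  have h6 : U - (Y : H) = 0 := by
    rw [← norm_eq_zero]
    nlinarith [norm_nonneg (U - (Y : H))]
  rw [sub_eq_zero] at h6
  subst h6
  refine ⟨Y.2, ?_⟩
  exact sub_right_injective hY

theorem IsStrongSolution.eqOn (hA : ∀ U : A.domain, (inner ℂ (A U) (U : H)).re ≤ 0) {U₀ : H}
    {U W : ℝ → H} (hU : IsStrongSolution A U₀ U) (hW : IsStrongSolution A U₀ W) :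
    EqOn U W (Ici 0) := by
  obtain ⟨u0, u', -, hu⟩ := hU
  obtain ⟨w0, w', -, hw⟩ := hW
  intro t ht
  have h := norm_le_of_dissipative_flow (g := fun s => U s - W s) (g' := fun s => u' s - w' s)
    (fun s hs => (hu s hs).1.sub (hw s hs).1) (fun s hs => by
      obtain ⟨-, a1, a2⟩ := hu s hs
      obtain ⟨-, b1, b2⟩ := hw s hs
      rw [← a2, ← b2, ← A.map_sub]
      exact hA _) ht
  simp only [u0, w0, sub_self, norm_zero, norm_le_zero_iff] at h
  exact sub_eq_zero.1 h

theorem isStrongSolution_of_domain (hT : IsC0ContractionSemigroup T)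
    (hTA : ∀ (U : A.domain) (t : ℝ), 0 ≤ t →
      (∃ h : T t U ∈ A.domain, A ⟨T t U, h⟩ = T t (A U)) ∧
        HasDerivWithinAt (fun s => T s U) (T t (A U)) (Ici 0) t) (U : A.domain) :
    IsStrongSolution A (U : H) (fun t => T t U) :=
  ⟨by simp [hT.zero], fun t => T t (A U), hT.continuous _,
    fun t ht => ⟨(hTA U t ht).2, (hTA U t ht).1⟩⟩

/-- On the domain the derivative of `⟨W, T t x⟩` is `⟨W, A (T t x)⟩ = ⟨W', T t x⟩`. It is the
integrated form of this identity that extends to all `x` by density, and it is then differentiated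
again, the integrand being continuous. -/
theorem isWeakSolution_of_domain (hD : Dense (A.domain : Set H)) (hT : IsC0ContractionSemigroup T)
    (hTA : ∀ (U : A.domain) (t : ℝ), 0 ≤ t →
      (∃ h : T t U ∈ A.domain, A ⟨T t U, h⟩ = T t (A U)) ∧
        HasDerivWithinAt (fun s => T s U) (T t (A U)) (Ici 0) t) (U₀ : H) :
    IsWeakSolution A U₀ (fun t => T t U₀) := by
  refine ⟨hT.continuous _, by simp [hT.zero], fun W W' hW t ht => ?_⟩
  have hcont : ∀ (V x : H), ContinuousOn (fun s => inner ℂ V (T s x)) (Ici 0) := fun V x =>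
    continuousOn_const.inner (hT.continuous x)
  have key : ∀ t : ℝ, 0 ≤ t → ∀ x : H,
      inner ℂ W (T t x) = inner ℂ W x + ∫ s in (0 : ℝ)..t, inner ℂ W' (T s x) := by
    intro t ht x
    refine hD.induction (P := fun x =>
      inner ℂ W (T t x) = inner ℂ W x + ∫ s in (0 : ℝ)..t, inner ℂ W' (T s x)) ?_ ?_ x
    · intro x hx
      have h1 : ∀ s : ℝ, 0 ≤ s →
          HasDerivWithinAt (fun s => inner ℂ W (T s x)) (inner ℂ W' (T s x)) (Ici 0) s := by
        intro s hs
        obtain ⟨⟨a1, a2⟩, a3⟩ := hTA ⟨x, hx⟩ s hs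
        have := (hasDerivWithinAt_const s (Ici 0) W).inner ℂ a3
        refine this.congr_deriv ?_
        rw [inner_zero_left, add_zero, ← a2, hW ⟨_, a1⟩]
      have h2 := intervalIntegral.integral_eq_sub_of_hasDerivAt_of_le ht
        (f := fun s => inner ℂ W (T s x)) (f' := fun s => inner ℂ W' (T s x))
        ((hcont W x).mono Icc_subset_Ici_self)
        (fun s hs => (h1 s hs.1.le).hasDerivAt (Ici_mem_nhds hs.1))
        (((hcont W' x).mono (by rw [uIcc_of_le ht]; exact Icc_subset_Ici_self)).intervalIntegrable)
      rw [h2, hT.zero]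
      simp
    · refine isClosed_eq (by fun_prop) (Continuous.add (by fun_prop) ?_)
      have hi : ∀ x, IntervalIntegrable (fun s => inner ℂ W' (T s x)) volume 0 t := fun x =>
        ((hcont W' x).mono (by rw [uIcc_of_le ht]; exact Icc_subset_Ici_self)).intervalIntegrable
      refine (LipschitzWith.of_dist_le_mul (K := ‖W'‖₊ * t.toNNReal) fun x y => ?_).continuous
      rw [dist_eq_norm, ← intervalIntegral.integral_sub (hi x) (hi y)]
      have := intervalIntegral.norm_integral_le_of_norm_le_const (a := 0) (b := t)
        (f := fun s => inner ℂ W' (T s x) - inner ℂ W' (T s y)) (C := ‖W'‖ * ‖x - y‖) ?_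
      · rw [sub_zero, abs_of_nonneg ht] at this
        rw [NNReal.coe_mul, coe_nnnorm, Real.coe_toNNReal t ht, dist_eq_norm]
        linarith
      · intro s hs
        rw [uIoc_of_le ht] at hs
        rw [← inner_sub_right, ← map_sub]
        exact (norm_inner_le_norm _ _).trans (mul_le_mul_of_nonneg_left
          (hT.norm_apply_le hs.1.le _) (norm_nonneg _))
  have h1 := (hasDerivWithinAt_integral_of_continuousOn (hcont W' U₀) ht).const_add
    (inner ℂ W U₀)
  exact h1.congr (fun s hs => key s hs U₀) (key t ht U₀)

/-- A weakly continuously differentiable trajectory, with continuous weak derivative, is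
differentiable. -/
theorem hasDerivWithinAt_of_forall_inner {g g' : ℝ → H} (hg' : ContinuousOn g' (Ici 0))
    (h : ∀ F : H, ∀ t, 0 ≤ t →
      HasDerivWithinAt (fun s => inner ℂ F (g s)) (inner ℂ F (g' t)) (Ici 0) t) {t : ℝ}
    (ht : 0 ≤ t) : HasDerivWithinAt g (g' t) (Ici 0) t := by
  rw [hasDerivWithinAt_iff_isLittleO, Asymptotics.isLittleO_iff]
  intro ε hε
  obtain ⟨δ, hδ, hcont⟩ := Metric.continuousWithinAt_iff.1 (hg' t ht) ε hε
  filter_upwards [self_mem_nhdsWithin, mem_nhdsWithin_of_mem_nhds (Metric.ball_mem_nhds t hδ)]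
    with s hs hsδ
  -- As `H` may be incomplete, `g` is not represented as an integral of `g'`. Instead the remainder
  -- at the fixed time `s` is itself the test vector: the mean value inequality for `⟨F, g r⟩ - r
  -- ⟨F, g' t⟩` yields `‖F‖² ≤ ‖F‖ ε |s - t|`.
  set F := g s - g t - (s - t) • g' t with hF
  have h1 : ∀ r ∈ Ici (0 : ℝ) ∩ Metric.ball t δ,
      HasDerivWithinAt (fun r => inner ℂ F (g r) - r • inner ℂ F (g' t))
        (inner ℂ F (g' r) - inner ℂ F (g' t)) (Ici 0 ∩ Metric.ball t δ) r := by
    intro r hr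
    have h2 := ((h F r hr.1).sub ((hasDerivWithinAt_id r (Ici 0)).smul_const (inner ℂ F (g' t))))
    simp only [one_smul] at h2
    exact h2.mono inter_subset_left
  have h3 := Convex.norm_image_sub_le_of_norm_hasDerivWithin_le (C := ‖F‖ * ε) h1 (fun r hr => by
      rw [← inner_sub_right]
      refine (norm_inner_le_norm _ _).trans (mul_le_mul_of_nonneg_left ?_ (norm_nonneg _))
      rw [← dist_eq_norm]
      exact (hcont hr.1 hr.2).le)
    ((convex_Ici 0).inter (convex_ball t δ)) (x := t) (y := s) ⟨ht, Metric.mem_ball_self hδ⟩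
    ⟨hs, hsδ⟩
  have h4 : inner ℂ F (g s) - s • inner ℂ F (g' t) - (inner ℂ F (g t) - t • inner ℂ F (g' t))
      = inner ℂ F F := by
    rw [hF, inner_sub_right _ _ ((s - t) • g' t), inner_sub_right, ← Complex.coe_smul (s - t) (g' t),
      inner_smul_right, Complex.real_smul, Complex.real_smul]
    push_cast
    ring
  have h5 : ‖(inner ℂ F F : ℂ)‖ = ‖F‖ * ‖F‖ := by
    rw [inner_self_eq_norm_sq_to_K, norm_pow, ← sq]
    simp
  rw [h4, h5, mul_assoc] at h3
  rcases eq_or_lt_of_le (norm_nonneg F) with h0 | h0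
  · rw [← h0]
    positivity
  · exact le_of_mul_le_mul_left h3 h0

/-- Let `V` be the difference and `R = (1 - A)⁻¹`. Since every vector has the form `W - W'` with an
adjoint pair, `R V` is weakly differentiable against every vector, with the continuous derivative `A
R V = R V - V`. So it is differentiable, and dissipativity forces `R V = 0`, whence `V = 0`. -/
theorem IsWeakSolution.eqOn (hA : IsMDissipative A)
    (hadj : ∀ F : H, ∃ W W' : H, IsAdjointPair A W W' ∧ W - W' = F) {U₀ : H}
    {U W : ℝ → H} (hU : IsWeakSolution A U₀ U) (hW : IsWeakSolution A U₀ W) :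
    EqOn U W (Ici 0) := by
  obtain ⟨R, hR⟩ := hA.exists_resolvent one_pos
  let V : ℝ → H := fun t => U t - W t
  have hV : ContinuousOn V (Ici 0) := hU.1.sub hW.1
  have hAR : ∀ x, A ⟨R x, hR.mem x⟩ = R x - x := by
    intro x
    have := hR.right_inv x
    rw [Complex.ofReal_one, one_smul, sub_eq_iff_eq_add] at this
    nth_rewrite 2 [this]
    abel
  have hd : ∀ t, 0 ≤ t → HasDerivWithinAt (fun s => R (V s)) (R (V t) - V t) (Ici 0) t := by
    intro t ht
    refine hasDerivWithinAt_of_forall_inner (g' := fun t => R (V t) - V t)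
      ((R.continuous.comp_continuousOn hV).sub hV) ?_ ht
    intro F t ht
    obtain ⟨Y, Y', hY, rfl⟩ := hadj F
    -- The adjoint relation moves `1 - A` onto `R x`, where it cancels the resolvent.
    have e : ∀ x, inner ℂ (Y - Y') (R x) = inner ℂ Y x := by
      intro x
      have h1 := hY ⟨R x, hR.mem x⟩
      rw [hAR, inner_sub_right] at h1
      rw [inner_sub_left, ← h1]
      ring
    have h1 := (hU.2.2 Y Y' hY t ht).sub (hW.2.2 Y Y' hY t ht)
    refine (h1.congr_deriv ?_).congr ?_ ?_
    · rw [← inner_sub_right, inner_sub_right (Y - Y'), e, inner_sub_left]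
      simp only [V]
      ring
    · intro s _
      rw [e, inner_sub_right]
      rfl
    · rw [e, inner_sub_right]
      rfl
  intro t ht
  have h := norm_le_of_dissipative_flow hd (fun s hs => by
    rw [← hAR]
    exact hA.1 ⟨R (V s), hR.mem _⟩) ht
  have h0 : V 0 = 0 := by simp only [V, hU.2.1, hW.2.1, sub_self]
  rw [h0, map_zero, norm_zero, norm_le_zero_iff] at h
  have h1 := hAR (V t)
  have h2 : (⟨R (V t), hR.mem _⟩ : A.domain) = 0 := Subtype.ext h
  rw [h2, A.map_zero, h, zero_sub, eq_comm, neg_eq_zero] at h1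
  exact sub_eq_zero.1 h1

end solutions

end Transmission

namespace Transmission

/-! ### Products of primitives -/

theorem absolutelyContinuousOnInterval_of_dist_le {X Y : Type*} [PseudoMetricSpace X]
    [PseudoMetricSpace Y] {f : ℝ → X} {h : ℝ → Y} {p q : ℝ}
    (hh : AbsolutelyContinuousOnInterval h p q)
    (hf : ∀ x ∈ uIcc p q, ∀ y ∈ uIcc p q, dist (f x) (f y) ≤ dist (h x) (h y)) :
    AbsolutelyContinuousOnInterval f p q := by
  rw [absolutelyContinuousOnInterval_iff] at hh ⊢
  intro ε hε
  obtain ⟨δ, hδ, H⟩ := hh ε hε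
  refine ⟨δ, hδ, fun E hE hEδ => (Finset.sum_le_sum fun i hi => ?_).trans_lt (H E hE hEδ)⟩
  exact hf _ (hE.1 i hi).1 _ (hE.1 i hi).2

/-- The increments are dominated by those of the real primitive of `‖f‖`. -/
theorem absolutelyContinuousOnInterval_primitive {f : ℝ → ℂ} {p q : ℝ}
    (hf : IntervalIntegrable f volume p q) :
    AbsolutelyContinuousOnInterval (fun x => ∫ t in p..x, f t) p q := by
  refine absolutelyContinuousOnInterval_of_dist_le
    (hf.norm.absolutelyContinuousOnInterval_intervalIntegral left_mem_uIcc) fun x hx y hy => ?_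
  have hi : ∀ z ∈ uIcc p q, IntervalIntegrable f volume p z := fun z hz =>
    hf.mono_set (uIcc_subset_uIcc_left hz)
  rw [dist_eq_norm, dist_eq_norm, intervalIntegral.integral_interval_sub_left (hi x hx) (hi y hy),
    intervalIntegral.integral_interval_sub_left (hi x hx).norm (hi y hy).norm, Real.norm_eq_abs]
  exact intervalIntegral.norm_integral_le_abs_integral_norm

/-- The product minus the primitive of its expected derivative is absolutely continuous with zero
derivative almost everywhere, hence constant. Integrability of `f` and `g` suffices, which is what
fluxes with merely integrable derivatives require. -/
theorem integral_deriv_mul_add_mul_deriv {F G f g : ℝ → ℂ} {p q : ℝ} (hpq : p ≤ q)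
    (hf : IntervalIntegrable f volume p q) (hg : IntervalIntegrable g volume p q)
    (hF : ∀ x ∈ Icc p q, F x - F p = ∫ t in p..x, f t)
    (hG : ∀ x ∈ Icc p q, G x - G p = ∫ t in p..x, g t) :
    F q * G q - F p * G p = ∫ t in p..q, (f t * G t + F t * g t) := by
  -- The functions `F` and `G` are controlled on `[p, q]` only; they are replaced by primitives
  -- defined on the whole line that agree with them there.
  let F₁ : ℝ → ℂ := fun x => F p + ∫ t in p..x, f t
  let G₁ : ℝ → ℂ := fun x => G p + ∫ t in p..x, g t
  have hF₁ : ∀ x ∈ Icc p q, F₁ x = F x := fun x hx => by simp only [F₁, ← hF x hx]; ring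
  have hG₁ : ∀ x ∈ Icc p q, G₁ x = G x := fun x hx => by simp only [G₁, ← hG x hx]; ring
  have acF : AbsolutelyContinuousOnInterval F₁ p q :=
    absolutelyContinuousOnInterval_of_dist_le (absolutelyContinuousOnInterval_primitive hf)
      fun x _ y _ => by simp [F₁]
  have acG : AbsolutelyContinuousOnInterval G₁ p q :=
    absolutelyContinuousOnInterval_of_dist_le (absolutelyContinuousOnInterval_primitive hg)
      fun x _ y _ => by simp [G₁]
  have hi : IntervalIntegrable (fun t => f t * G₁ t + F₁ t * g t) volume p q :=
    (hf.mul_continuousOn acG.continuousOn).add (hg.continuousOn_mul acF.continuousOn)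
  have acP := (acF.smul acG).sub (absolutelyContinuousOnInterval_primitive hi)
  obtain ⟨C, hC⟩ := acP.const_of_ae_hasDerivAt_zero (by
    filter_upwards [hf.ae_hasDerivAt_integral, hg.ae_hasDerivAt_integral,
      hi.ae_hasDerivAt_integral] with x h1 h2 h3 hx
    have k1 := (h1 hx p left_mem_uIcc).const_add (F p)
    have k2 := (h2 hx p left_mem_uIcc).const_add (G p)
    exact ((k1.mul k2).sub (h3 hx p left_mem_uIcc)).congr_deriv (sub_self _))
  have e1 := hC p left_mem_uIcc
  have e2 := hC q right_mem_uIcc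
  simp only [Pi.sub_apply, smul_eq_mul, Pi.mul_apply, intervalIntegral.integral_same,
    sub_zero] at e1 e2
  rw [hF₁ q ⟨hpq, le_rfl⟩, hG₁ q ⟨hpq, le_rfl⟩] at e2
  rw [hF₁ p ⟨le_rfl, hpq⟩, hG₁ p ⟨le_rfl, hpq⟩] at e1
  have e3 : ∫ t in p..q, (f t * G₁ t + F₁ t * g t) = ∫ t in p..q, (f t * G t + F t * g t) := by
    refine intervalIntegral.integral_congr fun t ht => ?_
    rw [uIcc_of_le hpq] at ht
    simp only [hF₁ t ht, hG₁ t ht]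
  rw [e3] at e2
  rw [e1, ← e2]
  ring

/-! ### Primitives and weak derivatives -/

/-- `F` is a primitive of the locally integrable function `g` on `(α, β)`. -/
structure IsPrimitive (α β : ℝ) (F g : ℝ → ℂ) : Prop where
  locInt : LocallyIntegrableOn g (Ioo α β)
  sub_eq : ∀ x ∈ Ioo α β, ∀ y ∈ Ioo α β, F y - F x = ∫ t in x..y, g t

theorem intervalIntegrable_of_locallyIntegrableOn {α β : ℝ} {g : ℝ → ℂ}
    (hg : LocallyIntegrableOn g (Ioo α β)) {x y : ℝ} (hx : x ∈ Ioo α β) (hy : y ∈ Ioo α β) :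
    IntervalIntegrable g volume x y := by
  have h : uIcc x y ⊆ Ioo α β := ordConnected_Ioo.uIcc_subset hx hy
  exact (hg.integrableOn_compact_subset h isCompact_uIcc).intervalIntegrable

namespace IsPrimitive

variable {α β : ℝ} {F G f g : ℝ → ℂ}

theorem intervalIntegrable (h : IsPrimitive α β F g) {x y : ℝ} (hx : x ∈ Ioo α β)
    (hy : y ∈ Ioo α β) : IntervalIntegrable g volume x y :=
  intervalIntegrable_of_locallyIntegrableOn h.locInt hx hy

theorem continuousOn (h : IsPrimitive α β F g) : ContinuousOn F (Ioo α β) := by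
  intro x hx
  obtain ⟨p, hp1, hp2⟩ := exists_between hx.1
  obtain ⟨q, hq1, hq2⟩ := exists_between hx.2
  have hp : p ∈ Ioo α β := ⟨hp1, hp2.trans hx.2⟩
  have hq : q ∈ Ioo α β := ⟨hx.1.trans hq1, hq2⟩
  have hpq : p ≤ q := (hp2.trans hq1).le
  have h1 := (absolutelyContinuousOnInterval_primitive (h.intervalIntegrable hp hq)).continuousOn
  rw [uIcc_of_le hpq] at h1
  have h2 : ContinuousOn F (Icc p q) := by
    refine (continuousOn_const (c := F p)).add h1 |>.congr fun y hy => ?_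
    have := h.sub_eq p hp y ⟨hp1.trans_le hy.1, hy.2.trans_lt hq2⟩
    simp only [Pi.add_apply, ← this]
    ring
  exact (h2.continuousAt (Icc_mem_nhds hp2 hq1)).continuousWithinAt

theorem mul (hF : IsPrimitive α β F f) (hG : IsPrimitive α β G g) :
    IsPrimitive α β (F * G) (f * G + F * g) := by
  have hle : ∀ x ∈ Ioo α β, ∀ y ∈ Ioo α β, x ≤ y →
      (F * G) y - (F * G) x = ∫ t in x..y, (f * G + F * g) t := by
    intro x hx y hy hxy
    have hsub : Icc x y ⊆ Ioo α β := fun z hz => ⟨hx.1.trans_le hz.1, hz.2.trans_lt hy.2⟩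
    exact integral_deriv_mul_add_mul_deriv hxy (hF.intervalIntegrable hx hy)
      (hG.intervalIntegrable hx hy) (fun z hz => hF.sub_eq x hx z (hsub hz))
      (fun z hz => hG.sub_eq x hx z (hsub hz))
  refine ⟨?_, fun x hx y hy => ?_⟩
  · exact (hF.locInt.mul_continuousOn hG.continuousOn isOpen_Ioo.isLocallyClosed).add
      (hG.locInt.continuousOn_mul hF.continuousOn isOpen_Ioo.isLocallyClosed)
  · rcases le_total x y with h | h
    · exact hle x hx y hy h
    · rw [intervalIntegral.integral_symm, ← hle y hy x hx h, neg_sub]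

theorem map_conj (h : IsPrimitive α β F g) :
    IsPrimitive α β (fun x => conj (F x)) (fun x => conj (g x)) := by
  refine ⟨?_, fun x hx y hy => ?_⟩
  · rw [locallyIntegrableOn_iff isOpen_Ioo.isLocallyClosed]
    intro k hk hkc
    exact (Complex.conjCLE : ℂ →L[ℝ] ℂ).integrable_comp (h.locInt.integrableOn_compact_subset hk hkc)
  · rw [← map_sub, h.sub_eq x hx y hy]
    exact ((Complex.conjCLE : ℂ →L[ℝ] ℂ).intervalIntegral_comp_comm
      (h.intervalIntegrable hx hy)).symm

theorem of_contDiff {φ : ℝ → ℝ} (hφ : ContDiff ℝ 1 φ) :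
    IsPrimitive α β (fun x => (φ x : ℂ)) (fun x => ((deriv φ x : ℝ) : ℂ)) := by
  have hc : Continuous fun x => ((deriv φ x : ℝ) : ℂ) :=
    Complex.continuous_ofReal.comp (hφ.continuous_deriv le_rfl)
  refine ⟨hc.locallyIntegrable.locallyIntegrableOn _, fun x _ y _ => ?_⟩
  rw [intervalIntegral.integral_eq_sub_of_hasDerivAt (f := fun x => (φ x : ℂ))]
  · intro t _
    exact (hφ.differentiable one_ne_zero t).hasDerivAt.ofReal_comp
  · exact hc.intervalIntegrable _ _

/-- A primitive of a function integrable up to the right end point has a limit there. -/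
theorem tendsto_right (h : IsPrimitive α β F g) {c : ℝ} (hc : c ∈ Ioo α β)
    (hg : IntegrableOn g (Ioo c β)) :
    Tendsto F (𝓝[Ioo α β] β) (𝓝 (F c + ∫ t in Ioo c β, g t)) := by
  have hi : IntervalIntegrable g volume c β :=
    (intervalIntegrable_iff_integrableOn_Ioo_of_le hc.2.le).2 hg
  have h1 := intervalIntegral.continuousOn_primitive_interval' hi left_mem_uIcc
  rw [uIcc_of_le hc.2.le] at h1
  have h2 := (h1 β ⟨hc.2.le, le_rfl⟩).tendsto.const_add (F c)
  rw [intervalIntegral.integral_of_le hc.2.le, integral_Ioc_eq_integral_Ioo] at h2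
  have h3 : 𝓝[Ioo α β] β ≤ 𝓝[Icc c β] β := by
    refine nhdsWithin_le_of_mem ?_
    have : Ioo α β ∩ Ioi c ⊆ Icc c β := fun x hx => ⟨hx.2.le, hx.1.2.le⟩
    exact mem_of_superset (inter_mem self_mem_nhdsWithin
      (mem_nhdsWithin_of_mem_nhds (Ioi_mem_nhds hc.2))) this
  refine (h2.mono_left h3).congr' ?_
  filter_upwards [self_mem_nhdsWithin] with x hx
  rw [← h.sub_eq c hc x hx]
  ring

/-- A primitive of a function integrable up to the left end point has a limit there. -/
theorem tendsto_left (h : IsPrimitive α β F g) {c : ℝ} (hc : c ∈ Ioo α β)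
    (hg : IntegrableOn g (Ioo α c)) :
    Tendsto F (𝓝[Ioo α β] α) (𝓝 (F c - ∫ t in Ioo α c, g t)) := by
  have hi : IntervalIntegrable g volume c α :=
    ((intervalIntegrable_iff_integrableOn_Ioo_of_le hc.1.le).2 hg).symm
  have h1 := intervalIntegral.continuousOn_primitive_interval' hi left_mem_uIcc
  rw [uIcc_of_ge hc.1.le] at h1
  have h2 := (h1 α ⟨le_rfl, hc.1.le⟩).tendsto.const_add (F c)
  rw [intervalIntegral.integral_symm, intervalIntegral.integral_of_le hc.1.le,
    integral_Ioc_eq_integral_Ioo, ← sub_eq_add_neg] at h2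
  have h3 : 𝓝[Ioo α β] α ≤ 𝓝[Icc α c] α := by
    refine nhdsWithin_le_of_mem ?_
    have : Ioo α β ∩ Iio c ⊆ Icc α c := fun x hx => ⟨hx.1.1.le, hx.2.le⟩
    exact mem_of_superset (inter_mem self_mem_nhdsWithin
      (mem_nhdsWithin_of_mem_nhds (Iio_mem_nhds hc.1))) this
  refine (h2.mono_left h3).congr' ?_
  filter_upwards [self_mem_nhdsWithin] with x hx
  rw [← h.sub_eq c hc x hx]
  ring

theorem integral_eq (h : IsPrimitive α β F g) (hαβ : α < β) (hg : IntegrableOn g (Ioo α β))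
    {A B : ℂ} (hA : Tendsto F (𝓝[Ioo α β] α) (𝓝 A)) (hB : Tendsto F (𝓝[Ioo α β] β) (𝓝 B)) :
    ∫ t in Ioo α β, g t = B - A := by
  obtain ⟨c, hc⟩ := exists_between hαβ
  have n1 : (𝓝[Ioo α β] α).NeBot := by
    rw [← mem_closure_iff_nhdsWithin_neBot, closure_Ioo hαβ.ne]
    exact left_mem_Icc.2 hαβ.le
  have n2 : (𝓝[Ioo α β] β).NeBot := by
    rw [← mem_closure_iff_nhdsWithin_neBot, closure_Ioo hαβ.ne]
    exact right_mem_Icc.2 hαβ.le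
  have i1 := hg.mono_set (Ioo_subset_Ioo_right hc.2.le)
  have i2 := hg.mono_set (Ioo_subset_Ioo_left hc.1.le)
  rw [tendsto_nhds_unique hA (h.tendsto_left hc i1), tendsto_nhds_unique hB (h.tendsto_right hc i2)]
  have e := intervalIntegral.integral_add_adjacent_intervals
    ((intervalIntegrable_iff_integrableOn_Ioo_of_le hc.1.le).2 i1)
    ((intervalIntegrable_iff_integrableOn_Ioo_of_le hc.2.le).2 i2)
  rw [intervalIntegral.integral_of_le hc.1.le, intervalIntegral.integral_of_le hc.2.le,
    intervalIntegral.integral_of_le hαβ.le, integral_Ioc_eq_integral_Ioo,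
    integral_Ioc_eq_integral_Ioo, integral_Ioc_eq_integral_Ioo] at e
  rw [← e]
  ring

/-- Integrate the derivative of `φ F`, which vanishes near both end points. -/
theorem hasWeakDeriv (h : IsPrimitive α β F g) : HasWeakDeriv α β F g := by
  refine ⟨h.continuousOn.locallyIntegrableOn measurableSet_Ioo, h.locInt, ?_⟩
  intro φ a1 a2 a3
  rcases le_or_gt β α with hαβ | hαβ
  · simp [Ioo_eq_empty_of_le hαβ]
  have hP := (of_contDiff (α := α) (β := β) (a1.of_le (by simp))).mul h
  have z : ∀ c, c ∉ Ioo α β → Tendsto ((fun x => (φ x : ℂ)) * F) (𝓝[Ioo α β] c) (𝓝 0) := by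
    intro c hc
    refine tendsto_const_nhds.congr' ?_
    have : (tsupport φ)ᶜ ∈ 𝓝 c := (isClosed_tsupport φ).isOpen_compl.mem_nhds fun h => hc (a3 h)
    filter_upwards [mem_nhdsWithin_of_mem_nhds this] with x hx
    have : φ x = 0 := by
      by_contra h0
      exact hx (subset_tsupport _ h0)
    simp [this]
  have i1 := integrable_test_deriv (h.continuousOn.locallyIntegrableOn measurableSet_Ioo) a1 a2 a3
  have i2 := integrable_test h.locInt a1.continuous a2 a3
  have e := hP.integral_eq hαβ (by exact i1.add i2) (z α (by simp)) (z β (by simp))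
  have e2 : ∫ x in Ioo α β, (deriv φ x • F x + φ x • g x) = 0 := by
    rw [sub_zero] at e
    exact e
  rw [integral_add i1 i2] at e2
  exact eq_neg_of_add_eq_zero_left e2

end IsPrimitive

section representatives

variable {α β : ℝ} {f g : ℝ → ℂ}

theorem isPrimitive_integral (hg : LocallyIntegrableOn g (Ioo α β)) {c : ℝ} (hc : c ∈ Ioo α β) :
    IsPrimitive α β (fun x => ∫ t in c..x, g t) g :=
  ⟨hg, fun _ hx _ hy => intervalIntegral.integral_interval_sub_left
    (intervalIntegrable_of_locallyIntegrableOn hg hc hy)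
    (intervalIntegrable_of_locallyIntegrableOn hg hc hx)⟩

/-- A function with a weak derivative is almost everywhere equal to a primitive of it. -/
theorem HasWeakDeriv.exists_isPrimitive (hαβ : α < β) (h : HasWeakDeriv α β f g) :
    ∃ F, IsPrimitive α β F g ∧ f =ᵐ[volume.restrict (Ioo α β)] F := by
  obtain ⟨c, hc⟩ := exists_between hαβ
  have hP := isPrimitive_integral h.2.1 hc
  have h1 := h.add (hP.hasWeakDeriv.smul (-1))
  have e : g + (-1 : ℂ) • g = 0 := by ext x; simp
  rw [e] at h1
  obtain ⟨k, hk⟩ := h1.ae_const hαβ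
  refine ⟨fun x => k + ∫ t in c..x, g t, ⟨hP.locInt, fun x hx y hy => ?_⟩, ?_⟩
  · rw [← hP.sub_eq x hx y hy]
    ring
  · filter_upwards [hk] with x hx
    simp only [Pi.add_apply, Pi.smul_apply, smul_eq_mul] at hx
    linear_combination hx

theorem HasBoundaryValue.tendsto {c : ℝ} {v : ℂ} {F : ℝ → ℂ} (h : HasBoundaryValue α β f c v)
    (hF : ContinuousOn F (Ioo α β)) (e : f =ᵐ[volume.restrict (Ioo α β)] F) :
    Tendsto F (𝓝[Ioo α β] c) (𝓝 v) := by
  obtain ⟨G, a1, a2, a3⟩ := h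
  have e : EqOn G F (Ioo α β) := Measure.eqOn_open_of_ae_eq (a2.symm.trans e) isOpen_Ioo a1 hF
  refine a3.congr' ?_
  filter_upwards [self_mem_nhdsWithin] with x hx
  exact e hx

end representatives

end Transmission

noncomputable section

namespace Transmission

/-! ### Multiplication and integration operators in `L²(α, β)` -/

section operators

variable {α β : ℝ}

theorem integrableOn_L2 (p : L2 α β) : IntegrableOn p (Ioo α β) :=
  (Lp.memLp p).integrable one_le_two

theorem intervalIntegrable_L2 (p : L2 α β) {x y : ℝ} (hx : x ∈ Icc α β) (hy : y ∈ Icc α β) :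
    IntervalIntegrable p volume x y := by
  have h1 : IntegrableOn p (Icc α β) :=
    (integrableOn_Icc_iff_integrableOn_Ioo).2 (integrableOn_L2 p)
  exact (h1.mono_set (ordConnected_Icc.uIcc_subset hx hy)).intervalIntegrable

/-- Cauchy-Schwarz against the indicator function of `s`. -/
theorem norm_setIntegral_L2_le (p : L2 α β) {s : Set ℝ} (hs : MeasurableSet s)
    (hsub : s ⊆ Ioo α β) : ‖∫ x in s, p x‖ ≤ √(volume.real s) * ‖p‖ := by
  have hμ : (volume.restrict (Ioo α β)) s ≠ ⊤ := measure_ne_top _ _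
  have h1 := L2.inner_indicatorConstLp_one (𝕜 := ℂ) hs hμ p
  have e : (volume.restrict (Ioo α β)).restrict s = volume.restrict s := by
    rw [Measure.restrict_restrict hs, inter_eq_left.2 hsub]
  have e2 : (volume.restrict (Ioo α β)).real s = volume.real s := by
    rw [measureReal_restrict_apply hs, inter_eq_left.2 hsub]
  rw [e] at h1
  rw [← h1]
  refine (norm_inner_le_norm _ _).trans_eq ?_
  rw [norm_indicatorConstLp (by simp) (by simp), e2, norm_one, one_mul, Real.sqrt_eq_rpow]
  norm_num

/-- This square root bound controls a primitive at the left end point. It removes the boundary term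
at `0` in `green_degenerate` and the one at `ε` in `hardy`. -/
theorem norm_integral_L2_le (p : L2 α β) {x : ℝ} (hx : x ∈ Icc α β) :
    ‖∫ t in α..x, p t‖ ≤ √(x - α) * ‖p‖ := by
  rw [intervalIntegral.integral_of_le hx.1, integral_Ioc_eq_integral_Ioo]
  refine (norm_setIntegral_L2_le p measurableSet_Ioo (Ioo_subset_Ioo_right hx.2)).trans_eq ?_
  rw [Real.volume_real_Ioo_of_le hx.1]

theorem isPrimitive_L2 (p : L2 α β) (c : ℂ) :
    IsPrimitive α β (fun x => c + ∫ t in α..x, p t) p := by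
  refine ⟨(integrableOn_L2 p).locallyIntegrableOn, fun x hx y hy => ?_⟩
  have hα : α ∈ Icc α β := left_mem_Icc.2 (hx.1.trans hx.2).le
  rw [add_sub_add_left_eq_sub]
  exact intervalIntegral.integral_interval_sub_left
    (intervalIntegrable_L2 p hα (Ioo_subset_Icc_self hy))
    (intervalIntegrable_L2 p hα (Ioo_subset_Icc_self hx))

theorem tendsto_primitive_left (p : L2 α β) (c : ℂ) :
    Tendsto (fun x => c + ∫ t in α..x, p t) (𝓝[Ioo α β] α) (𝓝 c) := by
  rcases le_or_gt β α with h | h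
  · simp [Ioo_eq_empty_of_le h]
  obtain ⟨m, hm⟩ := exists_between h
  have := (isPrimitive_L2 p c).tendsto_left hm ((integrableOn_L2 p).mono_set
    (Ioo_subset_Ioo_right hm.2.le))
  rwa [intervalIntegral.integral_of_le hm.1.le, integral_Ioc_eq_integral_Ioo, add_sub_cancel_right]
    at this

theorem tendsto_primitive_right (p : L2 α β) (c : ℂ) :
    Tendsto (fun x => c + ∫ t in α..x, p t) (𝓝[Ioo α β] β) (𝓝 (c + ∫ t in Ioo α β, p t)) := by
  rcases le_or_gt β α with h | h
  · simp [Ioo_eq_empty_of_le h]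
  obtain ⟨m, hm⟩ := exists_between h
  have i := (integrableOn_L2 p).mono_set (Ioo_subset_Ioo_left hm.1.le)
  have := (isPrimitive_L2 p c).tendsto_right hm i
  have e := intervalIntegral.integral_add_adjacent_intervals
    (intervalIntegrable_L2 p (left_mem_Icc.2 h.le) (Ioo_subset_Icc_self hm))
    (intervalIntegrable_L2 p (Ioo_subset_Icc_self hm) (right_mem_Icc.2 h.le))
  rw [intervalIntegral.integral_of_le hm.2.le, intervalIntegral.integral_of_le h.le,
    integral_Ioc_eq_integral_Ioo, integral_Ioc_eq_integral_Ioo] at e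
  rwa [add_assoc, e] at this

theorem memLp_primitive (p : L2 α β) :
    MemLp (fun x => ∫ t in α..x, p t) 2 (volume.restrict (Ioo α β)) := by
  have hc : ContinuousOn (fun x => ∫ t in α..x, p t) (Ioo α β) := by
    simpa using (isPrimitive_L2 p 0).continuousOn
  refine MemLp.of_bound (hc.aestronglyMeasurable measurableSet_Ioo) (√(β - α) * ‖p‖) ?_
  filter_upwards [ae_restrict_mem measurableSet_Ioo] with x hx
  refine (norm_integral_L2_le p (Ioo_subset_Icc_self hx)).trans ?_
  gcongr
  exact hx.2.le

/-- The operator `p ↦ ∫_α^x p` in `L²(α, β)`. -/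
def primitiveL (α β : ℝ) : L2 α β →L[ℂ] L2 α β :=
  LinearMap.mkContinuous
    { toFun := fun p => MemLp.toLp _ (memLp_primitive p)
      map_add' := fun p q => by
        rw [← MemLp.toLp_add]
        refine MemLp.toLp_congr _ _ ?_
        filter_upwards [ae_restrict_mem measurableSet_Ioo] with x hx
        have hα : α ∈ Icc α β := left_mem_Icc.2 (hx.1.trans hx.2).le
        have hx' := Ioo_subset_Icc_self hx
        rw [Pi.add_apply, ← intervalIntegral.integral_add (intervalIntegrable_L2 p hα hx')
          (intervalIntegrable_L2 q hα hx')]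
        refine intervalIntegral.integral_congr_ae ?_
        have := Lp.coeFn_add p q
        rw [EventuallyEq, ae_restrict_iff' measurableSet_Ioo] at this
        filter_upwards [this] with t ht hxt
        rw [uIoc_of_le hx.1.le] at hxt
        exact ht ⟨hxt.1, hxt.2.trans_lt hx.2⟩
      map_smul' := fun c p => by
        rw [RingHom.id_apply, ← MemLp.toLp_const_smul]
        refine MemLp.toLp_congr _ _ ?_
        filter_upwards [ae_restrict_mem measurableSet_Ioo] with x hx
        rw [Pi.smul_apply, ← intervalIntegral.integral_smul]
        refine intervalIntegral.integral_congr_ae ?_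
        have := Lp.coeFn_smul c p
        rw [EventuallyEq, ae_restrict_iff' measurableSet_Ioo] at this
        filter_upwards [this] with t ht hxt
        rw [uIoc_of_le hx.1.le] at hxt
        exact ht ⟨hxt.1, hxt.2.trans_lt hx.2⟩ }
    (measureUnivNNReal (volume.restrict (Ioo α β)) ^ (2 : ENNReal).toReal⁻¹ * √(β - α)) (by
      intro p
      rw [mul_assoc]
      refine Lp.norm_le_of_ae_bound (by positivity) ?_
      filter_upwards [MemLp.coeFn_toLp (memLp_primitive p), ae_restrict_mem measurableSet_Ioo]
        with x hx hx'
      change ‖MemLp.toLp _ (memLp_primitive p) x‖ ≤ _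
      rw [hx]
      refine (norm_integral_L2_le p (Ioo_subset_Icc_self hx')).trans ?_
      gcongr
      exact hx'.2.le)

theorem coeFn_primitiveL (p : L2 α β) :
    primitiveL α β p =ᵐ[volume.restrict (Ioo α β)] fun x => ∫ t in α..x, p t :=
  MemLp.coeFn_toLp (memLp_primitive p)

/-- The constant functions in `L²(α, β)`. -/
def constL2 (α β : ℝ) : ℂ →L[ℂ] L2 α β := Lp.constL 2 (volume.restrict (Ioo α β)) ℂ

theorem coeFn_constL2 (c : ℂ) :
    constL2 α β c =ᵐ[volume.restrict (Ioo α β)] fun _ => c :=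
  Lp.coeFn_const 2 _ c

/-- The integral over `(α, β)` as a functional on `L²(α, β)`. -/
def integralL (α β : ℝ) : L2 α β →L[ℂ] ℂ := innerSL ℂ (constL2 α β 1)

theorem integralL_apply (p : L2 α β) : integralL α β p = ∫ x in Ioo α β, p x := by
  rw [integralL, innerSL_apply_apply, L2.inner_def]
  refine integral_congr_ae ?_
  filter_upwards [coeFn_constL2 (α := α) (β := β) 1] with x hx
  simp [hx]

theorem coeFn_const_add_primitive (c : ℂ) (p : L2 α β) :
    (constL2 α β c + primitiveL α β p : L2 α β) =ᵐ[volume.restrict (Ioo α β)]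
      fun x => c + ∫ t in α..x, p t := by
  filter_upwards [Lp.coeFn_add (constL2 α β c) (primitiveL α β p), coeFn_constL2 (α := α) (β := β) c,
    coeFn_primitiveL p] with x h1 h2 h3
  rw [h1, Pi.add_apply, h2, h3]

theorem hasWeakDeriv_const_add_primitive (c : ℂ) (p : L2 α β) :
    HasWeakDeriv α β (constL2 α β c + primitiveL α β p : L2 α β) p :=
  (isPrimitive_L2 p c).hasWeakDeriv.congr (coeFn_const_add_primitive c p).symm EventuallyEq.rfl

theorem const_add_primitive_mem_H1 (c : ℂ) (p : L2 α β) :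
    constL2 α β c + primitiveL α β p ∈ H1 α β :=
  ⟨p, hasWeakDeriv_const_add_primitive c p⟩

theorem dx_const_add_primitive (c : ℂ) (p : L2 α β) :
    dx (constL2 α β c + primitiveL α β p) = p :=
  dx_eq (hasWeakDeriv_const_add_primitive c p)

theorem hasBoundaryValue_left (c : ℂ) (p : L2 α β) :
    HasBoundaryValue α β (constL2 α β c + primitiveL α β p : L2 α β) α c :=
  ⟨_, (isPrimitive_L2 p c).continuousOn, coeFn_const_add_primitive c p,
    tendsto_primitive_left p c⟩

theorem hasBoundaryValue_right (c : ℂ) (p : L2 α β) :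
    HasBoundaryValue α β (constL2 α β c + primitiveL α β p : L2 α β) β (c + integralL α β p) :=
  ⟨_, (isPrimitive_L2 p c).continuousOn, coeFn_const_add_primitive c p, by
    rw [integralL_apply]
    exact tendsto_primitive_right p c⟩

/-- A function in `H¹(α, β)` is the primitive of its derivative. -/
theorem eq_const_add_primitive (hαβ : α < β) {f : L2 α β} (hf : f ∈ H1 α β) {c : ℂ}
    (hc : HasBoundaryValue α β f α c) : f = constL2 α β c + primitiveL α β (dx f) := by
  obtain ⟨F, hF, e⟩ := (hasWeakDeriv_dx hf).exists_isPrimitive hαβ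
  obtain ⟨m, hm⟩ := exists_between hαβ
  have h1 := hF.tendsto_left hm ((integrableOn_L2 (dx f)).mono_set (Ioo_subset_Ioo_right hm.2.le))
  have h2 := hc.tendsto hF.continuousOn e
  have n1 : (𝓝[Ioo α β] α).NeBot := by
    rw [← mem_closure_iff_nhdsWithin_neBot, closure_Ioo hαβ.ne]
    exact left_mem_Icc.2 hαβ.le
  have h3 := tendsto_nhds_unique h1 h2
  apply Lp.ext
  refine e.trans (EventuallyEq.trans ?_ (coeFn_const_add_primitive c (dx f)).symm)
  filter_upwards [ae_restrict_mem measurableSet_Ioo] with x hx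
  have h4 := hF.sub_eq m hm x hx
  have h5 := intervalIntegral.integral_add_adjacent_intervals
    (intervalIntegrable_L2 (dx f) (left_mem_Icc.2 hαβ.le) (Ioo_subset_Icc_self hm))
    (intervalIntegrable_L2 (dx f) (Ioo_subset_Icc_self hm) (Ioo_subset_Icc_self hx))
  rw [← integral_Ioc_eq_integral_Ioo, ← intervalIntegral.integral_of_le hm.1.le] at h3
  linear_combination h4 + h5 + h3

theorem exists_hasBoundaryValue_left (hαβ : α < β) {f : L2 α β} (hf : f ∈ H1 α β) :
    ∃ c, HasBoundaryValue α β f α c := by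
  obtain ⟨F, hF, e⟩ := (hasWeakDeriv_dx hf).exists_isPrimitive hαβ
  obtain ⟨m, hm⟩ := exists_between hαβ
  exact ⟨_, F, hF.continuousOn, e, hF.tendsto_left hm
    ((integrableOn_L2 (dx f)).mono_set (Ioo_subset_Ioo_right hm.2.le))⟩

theorem exists_hasBoundaryValue_right (hαβ : α < β) {f : L2 α β} (hf : f ∈ H1 α β) :
    ∃ c, HasBoundaryValue α β f β c := by
  obtain ⟨F, hF, e⟩ := (hasWeakDeriv_dx hf).exists_isPrimitive hαβ
  obtain ⟨m, hm⟩ := exists_between hαβ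
  exact ⟨_, F, hF.continuousOn, e, hF.tendsto_right hm
    ((integrableOn_L2 (dx f)).mono_set (Ioo_subset_Ioo_left hm.1.le))⟩

variable {m : ℝ → ℝ}

theorem memLp_mul (hm : ContinuousOn m (Icc α β)) (f : L2 α β) :
    MemLp (fun x => (m x : ℂ) * f x) 2 (volume.restrict (Ioo α β)) := by
  obtain ⟨C, hC⟩ := isCompact_Icc.exists_bound_of_continuousOn hm
  refine (Lp.memLp f).of_le_mul (c := C) ?_ ?_
  · refine AEStronglyMeasurable.mul ?_ (Lp.aestronglyMeasurable f)
    exact Complex.continuous_ofReal.comp_aestronglyMeasurable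
      ((hm.mono Ioo_subset_Icc_self).aestronglyMeasurable measurableSet_Ioo)
  · filter_upwards [ae_restrict_mem measurableSet_Ioo] with x hx
    rw [norm_mul, Complex.norm_real]
    exact mul_le_mul_of_nonneg_right (hC x (Ioo_subset_Icc_self hx)) (norm_nonneg _)

/-- Multiplication by a continuous function in `L²(α, β)`. -/
def mulL (hm : ContinuousOn m (Icc α β)) : L2 α β →L[ℂ] L2 α β :=
  LinearMap.mkContinuous
    { toFun := fun f => MemLp.toLp _ (memLp_mul hm f)
      map_add' := fun f g => by
        rw [← MemLp.toLp_add]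
        refine MemLp.toLp_congr _ _ ?_
        filter_upwards [Lp.coeFn_add f g] with x hx
        simp only [hx, Pi.add_apply, mul_add]
      map_smul' := fun c f => by
        rw [RingHom.id_apply, ← MemLp.toLp_const_smul]
        refine MemLp.toLp_congr _ _ ?_
        filter_upwards [Lp.coeFn_smul c f] with x hx
        simp only [hx, Pi.smul_apply, smul_eq_mul]
        ring }
    (isCompact_Icc.exists_bound_of_continuousOn hm).choose (by
      intro f
      refine Lp.norm_le_mul_norm_of_ae_le_mul ?_
      filter_upwards [MemLp.coeFn_toLp (memLp_mul hm f), ae_restrict_mem measurableSet_Ioo]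
        with x hx hx'
      change ‖MemLp.toLp _ (memLp_mul hm f) x‖ ≤ _
      rw [hx, norm_mul, Complex.norm_real]
      exact mul_le_mul_of_nonneg_right ((isCompact_Icc.exists_bound_of_continuousOn hm).choose_spec
        x (Ioo_subset_Icc_self hx')) (norm_nonneg _))

theorem coeFn_mulL (hm : ContinuousOn m (Icc α β)) (f : L2 α β) :
    mulL hm f =ᵐ[volume.restrict (Ioo α β)] fun x => (m x : ℂ) * f x :=
  MemLp.coeFn_toLp (memLp_mul hm f)

theorem inner_L2 (f g : L2 α β) : inner ℂ f g = ∫ x in Ioo α β, conj (f x) * g x := by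
  rw [L2.inner_def]
  simp only [RCLike.inner_apply, mul_comm]

end operators

end Transmission

namespace TransmissionData

open Transmission

variable (P : TransmissionData)

/-! ### Components of the elements of the energy space -/

theorem continuousOn_sqrt_sigma : ContinuousOn (fun x => √(P.sigma x)) (Icc 0 1) :=
  P.continuousOn_sigma.sqrt

theorem continuousOn_sqrt_eta : ContinuousOn (fun x => √(P.eta x)) (Icc 0 1) :=
  P.continuousOn_eta.sqrt

theorem continuousOn_inv_sqrt_eta : ContinuousOn (fun x => (√(P.eta x))⁻¹) (Icc 0 1) :=
  P.continuousOn_sqrt_eta.inv₀ fun x _ => (Real.sqrt_pos.2 (P.eta_pos x)).ne'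

theorem memLp_div_sqrt_sigma (v : P.L2w) :
    MemLp (fun x => (v : L2 0 1) x / (√(P.sigma x) : ℂ)) 2 (volume.restrict (Ioo (0 : ℝ) 1)) := by
  have hm : AEStronglyMeasurable (fun x => (v : L2 0 1) x / (√(P.sigma x) : ℂ))
      (volume.restrict (Ioo (0 : ℝ) 1)) :=
    (Lp.aestronglyMeasurable (v : L2 0 1)).div₀ (Complex.continuous_ofReal.comp_aestronglyMeasurable
      ((P.continuousOn_sqrt_sigma.mono Ioo_subset_Icc_self).aestronglyMeasurable measurableSet_Ioo))
  rw [memLp_two_iff_integrable_sq_norm hm]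
  have h : IntegrableOn (fun x => ‖(v : L2 0 1) x‖ ^ 2 / P.sigma x) (Ioo 0 1) := v.2
  refine h.congr ?_
  filter_upwards [ae_restrict_mem measurableSet_Ioo] with x hx
  rw [norm_div, Complex.norm_real, div_pow, Real.norm_eq_abs, sq_abs,
    Real.sq_sqrt (P.sigma_pos hx).le]

/-- The isometry `v ↦ v / √σ` of `L²_{1/σ}(0, 1)` with `L²(0, 1)`. -/
def weightL : P.L2w →ₗ[ℂ] L2 0 1 where
  toFun v := MemLp.toLp _ (P.memLp_div_sqrt_sigma v)
  map_add' v w := by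
    rw [← MemLp.toLp_add]
    refine MemLp.toLp_congr _ _ ?_
    filter_upwards [Lp.coeFn_add (v : L2 0 1) w] with x hx
    simp only [Submodule.coe_add, hx, Pi.add_apply, add_div]
  map_smul' c v := by
    rw [RingHom.id_apply, ← MemLp.toLp_const_smul]
    refine MemLp.toLp_congr _ _ ?_
    filter_upwards [Lp.coeFn_smul c (v : L2 0 1)] with x hx
    simp only [Submodule.coe_smul, hx, Pi.smul_apply, smul_eq_mul, mul_div_assoc]

theorem coeFn_weightL (v : P.L2w) : P.weightL v =ᵐ[volume.restrict (Ioo (0 : ℝ) 1)]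
    fun x => (v : L2 0 1) x / (√(P.sigma x) : ℂ) :=
  MemLp.coeFn_toLp (P.memLp_div_sqrt_sigma v)

theorem inner_weightL (v w : P.L2w) : inner ℂ (P.weightL v) (P.weightL w)
    = ∫ x in Ioo (0 : ℝ) 1, (1 / (P.sigma x : ℂ)) * (conj ((v : L2 0 1) x) * (w : L2 0 1) x) := by
  rw [inner_L2]
  refine integral_congr_ae ?_
  filter_upwards [P.coeFn_weightL v, P.coeFn_weightL w, ae_restrict_mem measurableSet_Ioo]
    with x h1 h2 hx
  have hs : (P.sigma x : ℂ) = (√(P.sigma x) : ℂ) * (√(P.sigma x) : ℂ) := by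
    rw [← Complex.ofReal_mul, Real.mul_self_sqrt (P.sigma_pos hx).le]
  have hne : (√(P.sigma x) : ℂ) ≠ 0 := by
    exact_mod_cast (Real.sqrt_pos.2 (P.sigma_pos hx)).ne'
  simp only [h1, h2, map_div₀, Complex.conj_ofReal]
  rw [hs]
  field_simp

theorem mulL_weightL (v : P.L2w) : mulL P.continuousOn_sqrt_sigma (P.weightL v) = v := by
  apply Lp.ext
  filter_upwards [coeFn_mulL P.continuousOn_sqrt_sigma (P.weightL v), P.coeFn_weightL v,
    ae_restrict_mem measurableSet_Ioo] with x h1 h2 hx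
  have hne : (√(P.sigma x) : ℂ) ≠ 0 := by
    exact_mod_cast (Real.sqrt_pos.2 (P.sigma_pos hx)).ne'
  rw [h1, h2]
  field_simp

theorem mulL_mem_L2w (f : L2 0 1) : mulL P.continuousOn_sqrt_sigma f ∈ P.L2w := by
  have h := (memLp_two_iff_integrable_sq_norm (Lp.aestronglyMeasurable f)).1 (Lp.memLp f)
  refine h.congr ?_
  filter_upwards [coeFn_mulL P.continuousOn_sqrt_sigma f, ae_restrict_mem measurableSet_Ioo]
    with x h1 hx
  have hs := P.sigma_pos hx
  rw [h1, norm_mul, Complex.norm_real, mul_pow, Real.norm_eq_abs, sq_abs, Real.sq_sqrt hs.le,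
    mul_div_cancel_left₀ _ hs.ne']

theorem weightL_mulL (f : L2 0 1) :
    P.weightL ⟨mulL P.continuousOn_sqrt_sigma f, P.mulL_mem_L2w f⟩ = f := by
  apply Lp.ext
  filter_upwards [coeFn_mulL P.continuousOn_sqrt_sigma f, P.coeFn_weightL ⟨_, P.mulL_mem_L2w f⟩,
    ae_restrict_mem measurableSet_Ioo] with x h1 h2 hx
  have hne : (√(P.sigma x) : ℂ) ≠ 0 := by
    exact_mod_cast (Real.sqrt_pos.2 (P.sigma_pos hx)).ne'
  rw [h2, h1]
  field_simp

theorem inner_mulL_sqrt_eta (f g : L2 0 1) :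
    inner ℂ (mulL P.continuousOn_sqrt_eta f) (mulL P.continuousOn_sqrt_eta g)
      = ∫ x in Ioo (0 : ℝ) 1, (P.eta x : ℂ) * (conj (f x) * g x) := by
  rw [inner_L2]
  refine integral_congr_ae ?_
  filter_upwards [coeFn_mulL P.continuousOn_sqrt_eta f, coeFn_mulL P.continuousOn_sqrt_eta g]
    with x h1 h2
  have hs : (P.eta x : ℂ) = (√(P.eta x) : ℂ) * (√(P.eta x) : ℂ) := by
    rw [← Complex.ofReal_mul, Real.mul_self_sqrt (P.eta_pos x).le]
  simp only [h1, h2, map_mul, Complex.conj_ofReal, hs]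
  ring

theorem mulL_inv_sqrt_eta (f : L2 0 1) :
    mulL P.continuousOn_inv_sqrt_eta (mulL P.continuousOn_sqrt_eta f) = f := by
  apply Lp.ext
  filter_upwards [coeFn_mulL P.continuousOn_inv_sqrt_eta (mulL P.continuousOn_sqrt_eta f),
    coeFn_mulL P.continuousOn_sqrt_eta f] with x h1 h2
  have hne : (√(P.eta x) : ℂ) ≠ 0 := by
    exact_mod_cast (Real.sqrt_pos.2 (P.eta_pos x)).ne'
  rw [h1, h2]
  push_cast
  field_simp

variable {P}

/-- The component `v / √σ`. -/
def EnergySpace.vw (U : P.EnergySpace) : L2 0 1 := P.weightL ⟨U.v, U.hv⟩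

/-- The component `√η u_x`. -/
def EnergySpace.ue (U : P.EnergySpace) : L2 0 1 := mulL P.continuousOn_sqrt_eta (dx U.u)

/-- In the variables `√η u_x`, `v / √σ`, `y_x`, `z` the energy product is a plain `L²` product, so
bounds and limits reduce to unweighted spaces. -/
theorem energy_inner_eq (U W : P.EnergySpace) :
    inner ℂ U W = inner ℂ U.ue W.ue + inner ℂ U.vw W.vw
      + (inner ℂ (dx U.y) (dx W.y) + inner ℂ U.z W.z) := by
  change energyInner U W = _
  rw [energyInner, integral_add (integrable_eta _ _) (integrable_sigma U.hv W.hv),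
    integral_add (integrable_conj_mul _ _) (integrable_conj_mul _ _), EnergySpace.ue,
    EnergySpace.ue, inner_mulL_sqrt_eta, EnergySpace.vw, EnergySpace.vw, inner_weightL, inner_L2,
    inner_L2]

theorem energy_norm_sq (U : P.EnergySpace) :
    ‖U‖ ^ 2 = ‖U.ue‖ ^ 2 + ‖U.vw‖ ^ 2 + (‖dx U.y‖ ^ 2 + ‖U.z‖ ^ 2) := by
  have h := energy_inner_eq U U
  simp only [inner_self_eq_norm_sq_to_K] at h
  exact_mod_cast h

theorem norm_ue_le (U : P.EnergySpace) : ‖U.ue‖ ≤ ‖U‖ := by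
  refine (sq_le_sq₀ (norm_nonneg _) (norm_nonneg _)).1 ?_
  rw [energy_norm_sq U]
  nlinarith [sq_nonneg ‖U.vw‖, sq_nonneg ‖dx U.y‖, sq_nonneg ‖U.z‖]

theorem norm_vw_le (U : P.EnergySpace) : ‖U.vw‖ ≤ ‖U‖ := by
  refine (sq_le_sq₀ (norm_nonneg _) (norm_nonneg _)).1 ?_
  rw [energy_norm_sq U]
  nlinarith [sq_nonneg ‖U.ue‖, sq_nonneg ‖dx U.y‖, sq_nonneg ‖U.z‖]

theorem norm_dx_y_le (U : P.EnergySpace) : ‖dx U.y‖ ≤ ‖U‖ := by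
  refine (sq_le_sq₀ (norm_nonneg _) (norm_nonneg _)).1 ?_
  rw [energy_norm_sq U]
  nlinarith [sq_nonneg ‖U.ue‖, sq_nonneg ‖U.vw‖, sq_nonneg ‖U.z‖]

theorem norm_z_le (U : P.EnergySpace) : ‖U.z‖ ≤ ‖U‖ := by
  refine (sq_le_sq₀ (norm_nonneg _) (norm_nonneg _)).1 ?_
  rw [energy_norm_sq U]
  nlinarith [sq_nonneg ‖U.ue‖, sq_nonneg ‖U.vw‖, sq_nonneg ‖dx U.y‖]

variable (P)

/-- `U ↦ √η u_x`. -/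
def ueL : P.EnergySpace →L[ℂ] L2 0 1 :=
  LinearMap.mkContinuous
    { toFun := EnergySpace.ue
      map_add' := fun U W => by
        simp only [EnergySpace.ue, EnergySpace.u_add, dx_add U.hu.2.1 W.hu.2.1, map_add]
      map_smul' := fun c U => by
        simp only [EnergySpace.ue, EnergySpace.u_smul, dx_smul c U.hu.2.1, map_smul,
          RingHom.id_apply] }
    1 (fun U => by rw [one_mul]; exact norm_ue_le U)

/-- `U ↦ v / √σ`. -/
def vwL : P.EnergySpace →L[ℂ] L2 0 1 :=
  LinearMap.mkContinuous
    { toFun := EnergySpace.vw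
      map_add' := fun U W => by
        have e : (⟨(U + W).v, (U + W).hv⟩ : P.L2w) = ⟨U.v, U.hv⟩ + ⟨W.v, W.hv⟩ :=
          Subtype.ext (EnergySpace.v_add U W)
        rw [EnergySpace.vw, e, map_add]
        rfl
      map_smul' := fun c U => by
        have e : (⟨(c • U).v, (c • U).hv⟩ : P.L2w) = c • ⟨U.v, U.hv⟩ :=
          Subtype.ext (EnergySpace.v_smul c U)
        rw [EnergySpace.vw, e, map_smul]
        rfl }
    1 (fun U => by rw [one_mul]; exact norm_vw_le U)

/-- `U ↦ y_x`. -/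
def yxL : P.EnergySpace →L[ℂ] L2 1 P.L :=
  LinearMap.mkContinuous
    { toFun := fun U => dx U.y
      map_add' := fun U W => by simp only [EnergySpace.y_add, dx_add U.hy W.hy]
      map_smul' := fun c U => by
        simp only [EnergySpace.y_smul, dx_smul c U.hy, RingHom.id_apply] }
    1 (fun U => by rw [one_mul]; exact norm_dx_y_le U)

/-- `U ↦ z`. -/
def zL : P.EnergySpace →L[ℂ] L2 1 P.L :=
  LinearMap.mkContinuous
    { toFun := EnergySpace.z
      map_add' := fun _ _ => rfl
      map_smul' := fun _ _ => rfl }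
    1 (fun U => by rw [one_mul]; exact norm_z_le U)

/-- `U ↦ u_x`. -/
def uxL : P.EnergySpace →L[ℂ] L2 0 1 := (mulL P.continuousOn_inv_sqrt_eta).comp P.ueL

/-- `U ↦ u / √σ`, an unbounded operator in general. -/
def weightU : P.EnergySpace →ₗ[ℂ] L2 0 1 where
  toFun U := P.weightL ⟨U.u, U.hu.1⟩
  map_add' U W := by
    have e : (⟨(U + W).u, (U + W).hu.1⟩ : P.L2w) = ⟨U.u, U.hu.1⟩ + ⟨W.u, W.hu.1⟩ :=
      Subtype.ext (EnergySpace.u_add U W)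
    rw [e, map_add]
  map_smul' c U := by
    have e : (⟨(c • U).u, (c • U).hu.1⟩ : P.L2w) = c • ⟨U.u, U.hu.1⟩ :=
      Subtype.ext (EnergySpace.u_smul c U)
    rw [e, map_smul, RingHom.id_apply]

variable {P}

@[simp] theorem vwL_apply (U : P.EnergySpace) : P.vwL U = U.vw := rfl
@[simp] theorem yxL_apply (U : P.EnergySpace) : P.yxL U = dx U.y := rfl
@[simp] theorem zL_apply (U : P.EnergySpace) : P.zL U = U.z := rfl
@[simp] theorem uxL_apply (U : P.EnergySpace) : P.uxL U = dx U.u := P.mulL_inv_sqrt_eta _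

theorem u_eq (U : P.EnergySpace) : U.u = primitiveL 0 1 (dx U.u) := by
  have := eq_const_add_primitive zero_lt_one U.hu.2.1 U.hu.2.2
  rwa [map_zero, zero_add] at this

theorem hasBoundaryValue_u (U : P.EnergySpace) :
    HasBoundaryValue 0 1 U.u 1 (integralL 0 1 (dx U.u)) := by
  have := hasBoundaryValue_right 0 (dx U.u)
  rwa [map_zero, zero_add, zero_add, ← u_eq] at this

theorem hasBoundaryValue_y_one (U : P.EnergySpace) :
    HasBoundaryValue 1 P.L U.y 1 (integralL 0 1 (dx U.u)) := by
  obtain ⟨c, h1, h2⟩ := U.huy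
  rwa [← h1.unique zero_lt_one (by norm_num) (hasBoundaryValue_u U)]

/-- The energy contains neither `u` nor `y` themselves. The condition `u(0) = 0` recovers `u` and
`u(1)` from `u_x`, and the matching at `1` then recovers `y` and `y(L)`, so that `yL` and `traceL`
are bounded for the energy norm. -/
theorem y_eq (U : P.EnergySpace) :
    U.y = constL2 1 P.L (integralL 0 1 (dx U.u)) + primitiveL 1 P.L (dx U.y) :=
  eq_const_add_primitive P.one_lt_L U.hy (hasBoundaryValue_y_one U)

variable (P)

/-- `U ↦ y`. -/
def yL : P.EnergySpace →L[ℂ] L2 1 P.L :=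
  (constL2 1 P.L).comp ((integralL 0 1).comp P.uxL) + (primitiveL 1 P.L).comp P.yxL

/-- The trace `U ↦ y(L)`. -/
def traceL : P.EnergySpace →L[ℂ] ℂ :=
  (integralL 0 1).comp P.uxL + (integralL 1 P.L).comp P.yxL

variable {P}

@[simp] theorem yL_apply (U : P.EnergySpace) : P.yL U = U.y := by
  rw [y_eq U]
  simp [yL]

theorem hasBoundaryValue_y_right (U : P.EnergySpace) :
    HasBoundaryValue 1 P.L U.y P.L (P.traceL U) := by
  have h := hasBoundaryValue_right (integralL 0 1 (dx U.u)) (dx U.y)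
  rw [← y_eq U] at h
  simpa [traceL] using h

/-- The element of the energy space with given `u_x`, `v / √σ`, `y_x` and `z`. -/
theorem exists_energySpace {p w : L2 0 1}
    (h : primitiveL 0 1 p = mulL P.continuousOn_sqrt_sigma w) (f : L2 0 1) (q r : L2 1 P.L) :
    ∃ U : P.EnergySpace, dx U.u = p ∧ U.vw = f ∧ dx U.y = q ∧ U.z = r ∧ P.weightU U = w := by
  have e : primitiveL 0 1 p = constL2 0 1 0 + primitiveL 0 1 p := by rw [map_zero, zero_add]
  have hu : primitiveL 0 1 p ∈ P.H1w := by
    refine ⟨?_, ?_, ?_⟩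
    · rw [h]
      exact P.mulL_mem_L2w w
    · rw [e]
      exact const_add_primitive_mem_H1 0 p
    · rw [e]
      exact hasBoundaryValue_left 0 p
  have hm : P.Matches (primitiveL 0 1 p)
      (constL2 1 P.L (integralL 0 1 p) + primitiveL 1 P.L q : L2 1 P.L) := by
    refine ⟨integralL 0 1 p, ?_, hasBoundaryValue_left _ _⟩
    have := hasBoundaryValue_right 0 p
    rwa [zero_add, ← e] at this
  refine ⟨EnergySpace.mk (primitiveL 0 1 p) (mulL P.continuousOn_sqrt_sigma f)
    (constL2 1 P.L (integralL 0 1 p) + primitiveL 1 P.L q) r hu (P.mulL_mem_L2w f)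
    (const_add_primitive_mem_H1 _ _) hm, ?_, ?_, ?_, ?_, ?_⟩
  · rw [EnergySpace.mk_u, e, dx_const_add_primitive]
  · exact P.weightL_mulL f
  · rw [EnergySpace.mk_y, dx_const_add_primitive]
  · rw [EnergySpace.mk_z]
  · refine Eq.trans ?_ (P.weightL_mulL w)
    change P.weightL _ = P.weightL _
    congr 1
    exact Subtype.ext h

variable (P)

/-- The energy space is complete for the graph norm of `U ↦ u / √σ`. -/
theorem isGraphComplete_weightU : IsGraphComplete P.weightU := by
  intro U hU hN
  obtain ⟨p, hp⟩ := cauchySeq_tendsto_of_complete (u := fun n => P.uxL (U n))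
    (hU.map P.uxL.uniformContinuous)
  obtain ⟨f, hf⟩ := cauchySeq_tendsto_of_complete (u := fun n => P.vwL (U n))
    (hU.map P.vwL.uniformContinuous)
  obtain ⟨q, hq⟩ := cauchySeq_tendsto_of_complete (u := fun n => P.yxL (U n))
    (hU.map P.yxL.uniformContinuous)
  obtain ⟨r, hr⟩ := cauchySeq_tendsto_of_complete (u := fun n => P.zL (U n))
    (hU.map P.zL.uniformContinuous)
  obtain ⟨w, hw⟩ := cauchySeq_tendsto_of_complete hN
  -- Both sides express `u`, through `u_x` and through `u / √σ`, by bounded operators, so the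
  -- identity passes to the limit. It puts the limit of `u` into `L²_{1/σ}`, and here the
  -- convergence of `u / √σ` is indispensable.
  have hpw : primitiveL 0 1 p = mulL P.continuousOn_sqrt_sigma w := by
    refine tendsto_nhds_unique (((primitiveL 0 1).continuous.tendsto p).comp hp) ?_
    refine (((mulL P.continuousOn_sqrt_sigma).continuous.tendsto w).comp hw).congr fun n => ?_
    rw [Function.comp_apply, Function.comp_apply, uxL_apply, ← u_eq]
    exact P.mulL_weightL ⟨(U n).u, (U n).hu.1⟩
  obtain ⟨V, h1, h2, h3, h4, h5⟩ := exists_energySpace hpw f q r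
  refine ⟨V, ?_, by rwa [h5]⟩
  rw [tendsto_iff_norm_sub_tendsto_zero]
  have e : ∀ n, ‖U n - V‖ = √(‖mulL P.continuousOn_sqrt_eta (P.uxL (U n) - p)‖ ^ 2
      + ‖P.vwL (U n) - f‖ ^ 2 + (‖P.yxL (U n) - q‖ ^ 2 + ‖P.zL (U n) - r‖ ^ 2)) := by
    intro n
    rw [← h1, ← h2, ← h3, ← h4, ← uxL_apply V, ← vwL_apply, ← yxL_apply, ← zL_apply, ← map_sub,
      ← map_sub, ← map_sub, ← map_sub, uxL_apply]
    rw [← Real.sqrt_sq (norm_nonneg (U n - V)), energy_norm_sq]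
    rfl
  simp only [e]
  have t1 := (((mulL P.continuousOn_sqrt_eta).continuous.tendsto _).comp (hp.sub_const p)).norm.pow 2
  have t2 := (hf.sub_const f).norm.pow 2
  have t3 := (hq.sub_const q).norm.pow 2
  have t4 := (hr.sub_const r).norm.pow 2
  have t5 := ((t1.add t2).add (t3.add t4)).sqrt
  simpa using t5

end TransmissionData

namespace Transmission

/-! ### Green's formulas -/

theorem green_of_mem_H1 {α β : ℝ} (hαβ : α < β) {f ψ : L2 α β} (hf : f ∈ H1 α β)
    (hψ : ψ ∈ H1 α β) {c₁ c₂ d₁ d₂ : ℂ} (fl : HasBoundaryValue α β f α c₁)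
    (fr : HasBoundaryValue α β f β c₂) (ψl : HasBoundaryValue α β ψ α d₁)
    (ψr : HasBoundaryValue α β ψ β d₂) :
    inner ℂ (dx ψ) f + inner ℂ ψ (dx f) = conj d₂ * c₂ - conj d₁ * c₁ := by
  obtain ⟨F, hF, eF⟩ := (hasWeakDeriv_dx hf).exists_isPrimitive hαβ
  obtain ⟨G, hG, eG⟩ := (hasWeakDeriv_dx hψ).exists_isPrimitive hαβ
  rw [inner_L2, inner_L2, ← integral_add (TransmissionData.integrable_conj_mul _ _)
    (TransmissionData.integrable_conj_mul _ _)]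
  have e : (fun x => conj (dx ψ x) * f x + conj (ψ x) * dx f x) =ᵐ[volume.restrict (Ioo α β)]
      (fun x => conj (dx ψ x)) * F + (fun x => conj (G x)) * dx f := by
    filter_upwards [eF, eG] with x h1 h2
    simp only [Pi.add_apply, Pi.mul_apply, h1, h2]
  have hi := ((TransmissionData.integrable_conj_mul (dx ψ) f).add
    (TransmissionData.integrable_conj_mul ψ (dx f))).congr e
  rw [integral_congr_ae e]
  refine (hG.map_conj.mul hF).integral_eq hαβ hi ?_ ?_
  · exact ((Complex.continuous_conj.tendsto _).comp (ψl.tendsto hG.continuousOn eG)).mul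
      (fl.tendsto hF.continuousOn eF)
  · exact ((Complex.continuous_conj.tendsto _).comp (ψr.tendsto hG.continuousOn eG)).mul
      (fr.tendsto hF.continuousOn eF)

/-- If `|F(x)| ≤ K √x` and `G` is square integrable, the limit of `F G` at `0` can only vanish. -/
theorem limit_eq_zero_of_sqrt_bound {F G : ℝ → ℂ} {K : ℝ}
    (hF : ∀ x ∈ Ioo (0 : ℝ) 1, ‖F x‖ ≤ √x * K)
    (hG : IntegrableOn (fun x => ‖G x‖ ^ 2) (Ioo 0 1)) {l : ℂ}
    (hl : Tendsto (F * G) (𝓝[Ioo (0 : ℝ) 1] 0) (𝓝 l)) : l = 0 := by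
  by_contra h0
  have hpos : 0 < ‖l‖ := norm_pos_iff.2 h0
  have h1 := hl.norm.eventually (lt_mem_nhds (half_lt_self hpos))
  rw [eventually_nhdsWithin_iff, Metric.eventually_nhds_iff] at h1
  obtain ⟨ε, hε, h1⟩ := h1
  set δ := min (ε / 2) (1 / 2) with hδ
  have hδ0 : 0 < δ := by positivity
  have hδ1 : δ < 1 := (min_le_right _ _).trans_lt (by norm_num)
  have hδε : δ < ε := (min_le_left _ _).trans_lt (by linarith)
  -- If `l ≠ 0`, then `‖F G‖ > ‖l‖ / 2` near `0`. With the bound on `F` this gives `1/x ≤ (2K /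
  -- ‖l‖)² ‖G‖²`, so `1/x` would be integrable at `0`.
  have h2 : IntegrableOn (fun x : ℝ => x⁻¹) (Ioo 0 δ) := by
    refine Integrable.mono' (g := fun x => (2 * K / ‖l‖) ^ 2 * ‖G x‖ ^ 2)
      (((hG.mono_set (Ioo_subset_Ioo_right hδ1.le))).const_mul _)
      measurable_inv.aestronglyMeasurable ?_
    filter_upwards [ae_restrict_mem measurableSet_Ioo] with x hx
    have hx1 : x ∈ Ioo (0 : ℝ) 1 := ⟨hx.1, hx.2.trans hδ1⟩
    have h3 := h1 (y := x) (by
      rw [dist_eq_norm, sub_zero, Real.norm_of_nonneg hx.1.le]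
      exact hx.2.trans hδε) hx1
    rw [Pi.mul_apply, norm_mul] at h3
    have h4 : ‖l‖ / 2 ≤ √x * K * ‖G x‖ :=
      h3.le.trans (mul_le_mul_of_nonneg_right (hF x hx1) (norm_nonneg _))
    have h5 : (‖l‖ / 2) ^ 2 ≤ (√x * K * ‖G x‖) ^ 2 := by gcongr
    rw [mul_pow, mul_pow, Real.sq_sqrt hx.1.le] at h5
    rw [Real.norm_of_nonneg (inv_nonneg.2 hx.1.le), div_pow, div_mul_eq_mul_div,
      le_div_iff₀ (by positivity), inv_mul_le_iff₀ hx.1]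
    nlinarith
  have h3 : IntervalIntegrable (fun x : ℝ => x⁻¹) volume 0 δ :=
    (intervalIntegrable_iff_integrableOn_Ioo_of_le hδ0.le).2 h2
  rw [intervalIntegrable_inv_iff] at h3
  rcases h3 with h3 | h3
  · exact hδ0.ne h3
  · exact h3 left_mem_uIcc

end Transmission

namespace TransmissionData

open Transmission

variable {P : TransmissionData}

/-- The flux `η u_x` is not known to have a limit at `0`, since its derivative `w / σ` is only
locally integrable there. But the product of the conjugate of `φ` with the flux has an integrable
derivative, hence a limit. That limit is zero because `|φ| ≤ √x ‖φ_x‖` while the flux is square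
integrable. -/
theorem green_degenerate {u φ : L2 0 1} {w : P.L2w} (hB : P.IsB u w) (hφ : φ ∈ P.H1w) {c d : ℂ}
    (hc : HasBoundaryValue 0 1 (fun x => (P.eta x : ℂ) * dx u x) 1 c)
    (hd : HasBoundaryValue 0 1 φ 1 d) :
    inner ℂ (mulL P.continuousOn_sqrt_eta (dx φ)) (mulL P.continuousOn_sqrt_eta (dx u))
      + inner ℂ (P.weightL ⟨φ, hφ.1⟩) (P.weightL w) = conj d * c := by
  obtain ⟨G, hG, eG⟩ := HasWeakDeriv.exists_isPrimitive zero_lt_one hB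
  let F : ℝ → ℂ := fun x => 0 + ∫ t in (0 : ℝ)..x, dx φ t
  have hF : IsPrimitive 0 1 F (dx φ) := isPrimitive_L2 (dx φ) 0
  have eF : φ =ᵐ[volume.restrict (Ioo (0 : ℝ) 1)] F := by
    have := eq_const_add_primitive zero_lt_one hφ.2.1 hφ.2.2
    conv_lhs => rw [this]
    exact coeFn_const_add_primitive 0 (dx φ)
  rw [inner_mulL_sqrt_eta, inner_weightL,
    ← integral_add (integrable_eta _ _) (integrable_sigma hφ.1 w.2)]
  have e : (fun x => (P.eta x : ℂ) * (conj (dx φ x) * dx u x)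
      + 1 / (P.sigma x : ℂ) * (conj (φ x) * (w : L2 0 1) x)) =ᵐ[volume.restrict (Ioo (0 : ℝ) 1)]
      (fun x => conj (dx φ x)) * G
        + (fun x => conj (F x)) * fun x => (w : L2 0 1) x / (P.sigma x : ℂ) := by
    filter_upwards [eF, eG] with x h1 h2
    simp only [Pi.add_apply, Pi.mul_apply, ← h1, ← h2]
    ring
  have hi := ((integrable_eta (dx φ) (dx u)).add (integrable_sigma hφ.1 w.2)).congr e
  rw [integral_congr_ae e]
  have hP := hF.map_conj.mul hG
  have hl := hP.tendsto_left (c := 1 / 2) (by norm_num)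
    (IntegrableOn.mono_set hi (Ioo_subset_Ioo_right (by norm_num)))
  have hGi : IntegrableOn (fun x => ‖G x‖ ^ 2) (Ioo 0 1) := by
    have h := (memLp_two_iff_integrable_sq_norm
      (Lp.aestronglyMeasurable (mulL P.continuousOn_eta (dx u)))).1 (Lp.memLp _)
    refine h.congr ?_
    filter_upwards [eG, coeFn_mulL P.continuousOn_eta (dx u)] with x h1 h2
    rw [h2, h1]
  have h0 := limit_eq_zero_of_sqrt_bound (K := ‖dx φ‖) (fun x hx => by
    have := norm_integral_L2_le (dx φ) (Ioo_subset_Icc_self hx)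
    simpa [F] using this) hGi hl
  rw [h0] at hl
  rw [hP.integral_eq zero_lt_one hi hl (((Complex.continuous_conj.tendsto _).comp
    (hd.tendsto hF.continuousOn eF)).mul (hc.tendsto hG.continuousOn eG)), sub_zero]

theorem IsB_B {u : L2 0 1} (h : u ∈ P.H2w) : P.IsB u (P.B u) := by
  obtain ⟨-, w, -, hw⟩ := h
  rwa [hw.eq]

/-- The operator `(φ, ψ) ↦ (σ (η u_x)_x, y_xx)` in weak form. -/
theorem inner_B_add_inner_dx_dx {X : P.EnergySpace} (hX : X ∈ P.domA1) {φ : L2 0 1}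
    {ψ : L2 1 P.L} (hφ : φ ∈ P.H1w) (hψ : ψ ∈ H1 1 P.L) (hm : P.Matches φ ψ) {c d : ℂ}
    (hc : HasBoundaryValue 1 P.L X.z P.L c) (hd : HasBoundaryValue 1 P.L ψ P.L d) :
    inner ℂ (P.weightL ⟨φ, hφ.1⟩) (P.weightL ⟨P.B X.u, B_mem hX.2.2.2.1⟩)
        + inner ℂ ψ (dx (dx X.y))
      = -(inner ℂ (mulL P.continuousOn_sqrt_eta (dx φ)) X.ue + inner ℂ (dx ψ) (dx X.y))
        - conj d * c := by
  obtain ⟨-, -, -, hu, hy, ⟨c₁, h1, h2⟩, e, h3, h4⟩ := hX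
  obtain ⟨d₁, k1, k2⟩ := hm
  have hec : e = c := h4.unique P.one_lt_L (right_mem_Icc.2 P.one_lt_L.le) hc
  subst hec
  have g1 := green_degenerate (w := ⟨P.B X.u, B_mem hu⟩) (IsB_B hu) hφ h1 k1
  have g2 := green_of_mem_H1 P.one_lt_L hy.2 hψ h2 h3 k2 hd
  rw [EnergySpace.ue]
  linear_combination g1 + g2

/-! ### Dissipativity of `A_1` and its adjoint. -/

theorem A1val_ue {X : P.EnergySpace} (hX : X ∈ P.domA1) :
    (P.A1val X hX).ue = mulL P.continuousOn_sqrt_eta (dx X.v) := by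
  rw [EnergySpace.ue, A1val_u]

theorem A1val_vw {X : P.EnergySpace} (hX : X ∈ P.domA1) :
    (P.A1val X hX).vw = P.weightL ⟨P.B X.u, B_mem hX.2.2.2.1⟩ :=
  congrArg P.weightL (Subtype.ext (P.A1val_v X hX))

theorem inner_A1val (Y : P.EnergySpace) {X : P.EnergySpace} (hX : X ∈ P.domA1) :
    inner ℂ Y (P.A1val X hX)
      = inner ℂ Y.ue (mulL P.continuousOn_sqrt_eta (dx X.v)) + inner ℂ (dx Y.y) (dx X.z)
        + (inner ℂ Y.vw (P.weightL ⟨P.B X.u, B_mem hX.2.2.2.1⟩)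
          + inner ℂ Y.z (dx (dx X.y))) := by
  rw [energy_inner_eq, A1val_ue, A1val_vw, A1val_y, A1val_z]
  abel

theorem weightL_v (U : P.EnergySpace) (h : U.v ∈ P.L2w) : P.weightL ⟨U.v, h⟩ = U.vw := rfl

theorem exists_boundaryValue_z {X : P.EnergySpace} (hX : X ∈ P.domA1) :
    ∃ c, HasBoundaryValue 1 P.L X.z P.L c := by
  obtain ⟨-, -, -, -, -, -, c, -, h⟩ := hX
  exact ⟨c, h⟩

/-- After Green's formula the products of `u_x` with `v_x` and of `y_x` with `z_x` occur together
with the negatives of their conjugates. The real part that remains is `-|z(L)|²`. -/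
theorem re_inner_A1val_nonpos {X : P.EnergySpace} (hX : X ∈ P.domA1) :
    (inner ℂ (P.A1val X hX) X).re ≤ 0 := by
  obtain ⟨c, hc⟩ := exists_boundaryValue_z hX
  have h1 := inner_A1val X hX
  have h2 := inner_B_add_inner_dx_dx hX hX.1 hX.2.1 hX.2.2.1 hc hc
  rw [weightL_v] at h2
  rw [h2, ← inner_conj_symm X.ue, ← inner_conj_symm (dx X.y)] at h1
  rw [← inner_conj_symm, h1, Complex.conj_re]
  have h3 : (conj c * c).re = ‖c‖ ^ 2 := by
    rw [Complex.conj_mul', ← Complex.ofReal_pow, Complex.ofReal_re]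
  simp only [Complex.add_re, Complex.sub_re, Complex.neg_re, Complex.conj_re, h3]
  nlinarith [sq_nonneg ‖c‖]

/-- The time reversal `(u, v, y, z) ↦ (u, -v, y, -z)`. -/
def timeReversal (U : P.EnergySpace) : P.EnergySpace :=
  EnergySpace.mk U.u (-U.v) U.y (-U.z) U.hu (neg_mem U.hv) U.hy U.huy

theorem timeReversal_involutive (U : P.EnergySpace) : timeReversal (timeReversal U) = U :=
  EnergySpace.ext rfl (neg_neg _) rfl (neg_neg _)

theorem timeReversal_sub (U W : P.EnergySpace) :
    timeReversal (U - W) = timeReversal U - timeReversal W :=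
  EnergySpace.ext rfl (neg_sub' U.v W.v) rfl (neg_sub' U.z W.z)

theorem timeReversal_u (U : P.EnergySpace) : (timeReversal U).u = U.u := rfl
theorem timeReversal_v (U : P.EnergySpace) : (timeReversal U).v = -U.v := rfl
theorem timeReversal_y (U : P.EnergySpace) : (timeReversal U).y = U.y := rfl
theorem timeReversal_z (U : P.EnergySpace) : (timeReversal U).z = -U.z := rfl

theorem ue_timeReversal (U : P.EnergySpace) : (timeReversal U).ue = U.ue := by
  rw [EnergySpace.ue, EnergySpace.ue, timeReversal_u]

theorem vw_timeReversal (U : P.EnergySpace) : (timeReversal U).vw = -U.vw := by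
  rw [EnergySpace.vw, EnergySpace.vw, ← map_neg]
  exact congrArg P.weightL (Subtype.ext (timeReversal_v U))

theorem inner_timeReversal_right (U W : P.EnergySpace) :
    inner ℂ U (timeReversal W) = inner ℂ U.ue W.ue + inner ℂ (dx U.y) (dx W.y)
      - (inner ℂ U.vw W.vw + inner ℂ U.z W.z) := by
  rw [energy_inner_eq, ue_timeReversal, vw_timeReversal, timeReversal_y, timeReversal_z,
    inner_neg_right, inner_neg_right]
  abel

/-- Time reversal changes the sign of the products on which Green's formula is used. Both sides then
become the sum of the products of `u_x` with `v_x`, of `y_x` with `z_x` and of the values of `z` at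
`L`, an expression that is Hermitian in `X` and `Y`. -/
theorem inner_timeReversal_A1val {X Y : P.EnergySpace} (hX : X ∈ P.domA1) (hY : Y ∈ P.domA1) :
    inner ℂ (timeReversal Y) (P.A1val X hX) = inner ℂ (timeReversal (P.A1val Y hY)) X := by
  obtain ⟨c, hc⟩ := exists_boundaryValue_z hX
  obtain ⟨d, hd⟩ := exists_boundaryValue_z hY
  have h1 := inner_timeReversal_right (P.A1val X hX) Y
  have h2 := inner_B_add_inner_dx_dx hX hY.1 hY.2.1 hY.2.2.1 hc hd
  have h3 := inner_B_add_inner_dx_dx hY hX.1 hX.2.1 hX.2.2.1 hd hc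
  have h4 := inner_timeReversal_right X (P.A1val Y hY)
  rw [A1val_ue, A1val_vw, A1val_y, A1val_z] at h1 h4
  rw [weightL_v] at h2 h3
  rw [h3] at h4
  rw [← inner_conj_symm _ Y.vw, ← inner_conj_symm _ Y.z, ← map_add, h2] at h1
  rw [← inner_conj_symm (timeReversal Y), h1, ← inner_conj_symm (timeReversal (P.A1val Y hY)), h4]
  rw [← inner_conj_symm X.ue, ← inner_conj_symm (dx X.y)]
  simp only [map_add, map_sub, map_neg, map_mul, Complex.conj_conj, inner_conj_symm]
  rw [mul_comm c]
  abel

/-- The adjoint of `A_1` is its conjugate by time reversal. -/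
theorem isAdjointPair_timeReversal {Y : P.EnergySpace} (hY : Y ∈ P.domA1) :
    IsAdjointPair P.A1 (timeReversal Y) (timeReversal (P.A1val Y hY)) := by
  rintro ⟨X, hX⟩
  exact inner_timeReversal_A1val hX hY

end TransmissionData

namespace Transmission

/-! ### Smooth functions as elements of `H¹(α, β)` -/

theorem dx_zero {α β : ℝ} : dx (0 : L2 α β) = 0 :=
  dx_eq (HasWeakDeriv.zero.congr (Lp.coeFn_zero _ _ _).symm (Lp.coeFn_zero _ _ _).symm)

theorem hasBoundaryValue_zero_L2 {α β c : ℝ} : HasBoundaryValue α β (0 : L2 α β) c 0 :=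
  HasBoundaryValue.zero.congr (Lp.coeFn_zero _ _ _).symm

theorem memLp_of_continuous (α β : ℝ) {φ : ℝ → ℝ} (hφ : Continuous φ) :
    MemLp (fun x => (φ x : ℂ)) 2 (volume.restrict (Ioo α β)) := by
  obtain ⟨C, hC⟩ := isCompact_Icc.exists_bound_of_continuousOn (hφ.continuousOn (s := Icc α β))
  refine MemLp.of_bound (Complex.continuous_ofReal.comp hφ).aestronglyMeasurable C ?_
  filter_upwards [ae_restrict_mem measurableSet_Ioo] with x hx
  rw [Complex.norm_real]
  exact hC x (Ioo_subset_Icc_self hx)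

theorem exists_mem_H1_of_contDiff (α β : ℝ) {φ : ℝ → ℝ} (hφ : ContDiff ℝ 1 φ) :
    ∃ f ∈ H1 α β, (f =ᵐ[volume.restrict (Ioo α β)] fun x => (φ x : ℂ)) ∧
      (dx f =ᵐ[volume.restrict (Ioo α β)] fun x => ((deriv φ x : ℝ) : ℂ)) ∧
      ∀ c, HasBoundaryValue α β f c (φ c) := by
  have hd := hφ.continuous_deriv le_rfl
  have e1 := MemLp.coeFn_toLp (memLp_of_continuous α β hφ.continuous)
  have e2 := MemLp.coeFn_toLp (memLp_of_continuous α β hd)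
  have hw := (IsPrimitive.of_contDiff (α := α) (β := β) hφ).hasWeakDeriv.congr e1.symm e2.symm
  refine ⟨_, ⟨_, hw⟩, e1, ?_, fun c => ⟨_, ?_, e1, ?_⟩⟩
  · rw [dx_eq hw]
    exact e2
  · exact (Complex.continuous_ofReal.comp hφ.continuous).continuousOn
  · exact ((Complex.continuous_ofReal.comp hφ.continuous).tendsto c).mono_left nhdsWithin_le_nhds

theorem eq_zero_of_notMem_tsupport {φ : ℝ → ℝ} {α β c : ℝ} (hs : tsupport φ ⊆ Ioo α β)
    (hc : c ∉ Ioo α β) : φ c = 0 := by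
  by_contra h
  exact hc (hs (subset_tsupport _ h))

theorem hasWeakDeriv_of_inner {α β : ℝ} {p r : L2 α β}
    (h : ∀ ψ ∈ H1 α β, HasBoundaryValue α β ψ α 0 → HasBoundaryValue α β ψ β 0 →
      inner ℂ (dx ψ) p = -inner ℂ ψ r) : HasWeakDeriv α β p r := by
  refine ⟨(integrableOn_L2 p).locallyIntegrableOn, (integrableOn_L2 r).locallyIntegrableOn, ?_⟩
  intro φ h1 h2 h3
  obtain ⟨f, hf, e1, e2, hb⟩ := exists_mem_H1_of_contDiff α β (h1.of_le (by simp))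
  have hl := hb α
  have hr := hb β
  rw [eq_zero_of_notMem_tsupport h3 (by simp), Complex.ofReal_zero] at hl hr
  have h4 := h f hf hl hr
  rw [inner_L2, inner_L2] at h4
  have k1 : ∫ x in Ioo α β, deriv φ x • p x = ∫ x in Ioo α β, conj (dx f x) * p x := by
    refine integral_congr_ae ?_
    filter_upwards [e2] with x hx
    rw [hx, Complex.conj_ofReal, Complex.real_smul]
  have k2 : ∫ x in Ioo α β, φ x • r x = ∫ x in Ioo α β, conj (f x) * r x := by
    refine integral_congr_ae ?_
    filter_upwards [e1] with x hx
    rw [hx, Complex.conj_ofReal, Complex.real_smul]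
  rw [k1, k2, h4]

end Transmission

namespace TransmissionData

open Transmission

variable {P : TransmissionData}

/-! ### The weak form of the stationary problem -/

theorem continuousOn_inv_sigma {δ : ℝ} (hδ : 0 < δ) :
    ContinuousOn (fun x => (P.sigma x)⁻¹) (Icc δ 1) :=
  (P.continuousOn_sigma.mono (Icc_subset_Icc_left hδ.le)).inv₀ fun x hx =>
    (div_pos (P.a_pos x ⟨hδ.trans_le hx.1, hx.2⟩) (P.eta_pos x)).ne'

theorem integrableOn_div_sigma (w : L2 0 1) {δ : ℝ} (hδ : 0 < δ) :
    IntegrableOn (fun x => w x / (P.sigma x : ℂ)) (Ioo δ 1) := by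
  have h1 : IntegrableOn w (Icc δ 1) := (integrableOn_Icc_iff_integrableOn_Ioo).2
    ((integrableOn_L2 w).mono_set (Ioo_subset_Ioo_left hδ.le))
  have h2 := h1.mul_continuousOn (Complex.continuous_ofReal.comp_continuousOn
    (continuousOn_inv_sigma (P := P) hδ)) isCompact_Icc
  refine (h2.mono_set Ioo_subset_Icc_self).congr_fun (fun x _ => ?_) measurableSet_Ioo
  simp [div_eq_mul_inv]

/-- The weight `1/σ` is singular only at `0`, and there the function vanishes. This makes test
functions admissible in the weak problem. -/
theorem mem_L2w_of_eventually_eq_zero {φ : ℝ → ℝ} (hφ : Continuous φ) (h0 : φ =ᶠ[𝓝 0] 0)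
    {f : L2 0 1} (hf : f =ᵐ[volume.restrict (Ioo (0 : ℝ) 1)] fun x => (φ x : ℂ)) :
    f ∈ P.L2w := by
  obtain ⟨ε, hε, h1⟩ := Metric.eventually_nhds_iff.1 h0
  have i1 : IntegrableOn (fun x => φ x ^ 2 * (P.sigma x)⁻¹) (Icc (ε / 2) 1) :=
    ((hφ.pow 2).continuousOn.mul (continuousOn_inv_sigma (half_pos hε))).integrableOn_compact
      isCompact_Icc
  have i2 : IntegrableOn (fun x => φ x ^ 2 * (P.sigma x)⁻¹) (Ioo 0 ε) := by
    refine (integrableOn_zero : IntegrableOn (fun _ : ℝ => (0 : ℝ)) (Ioo 0 ε)).congr_fun (fun x hx => ?_) measurableSet_Ioo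
    have : φ x = 0 := h1 (by rw [dist_eq_norm, sub_zero, Real.norm_of_nonneg hx.1.le]; exact hx.2)
    simp [this]
  have i3 : IntegrableOn (fun x => φ x ^ 2 * (P.sigma x)⁻¹) (Ioo 0 1) := by
    refine (i2.union i1).mono_set fun x hx => ?_
    rcases lt_or_ge x ε with h | h
    · exact Or.inl ⟨hx.1, h⟩
    · exact Or.inr ⟨(half_le_self hε.le).trans h, hx.2.le⟩
  refine i3.congr ?_
  filter_upwards [hf] with x hx
  rw [hx, Complex.norm_real, Real.norm_eq_abs, sq_abs, div_eq_mul_inv]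

theorem isB_of_inner {u : L2 0 1} {w : P.L2w}
    (h : ∀ φ (hφ : φ ∈ P.H1w), HasBoundaryValue 0 1 φ 1 0 →
      inner ℂ (mulL P.continuousOn_sqrt_eta (dx φ)) (mulL P.continuousOn_sqrt_eta (dx u))
        = -inner ℂ (P.weightL ⟨φ, hφ.1⟩) (P.weightL w)) : P.IsB u w := by
  refine ⟨?_, ?_, ?_⟩
  · exact locallyIntegrableOn_congr (coeFn_mulL P.continuousOn_eta (dx u))
      (integrableOn_L2 _).locallyIntegrableOn
  · rw [locallyIntegrableOn_iff isOpen_Ioo.isLocallyClosed]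
    intro k hk hkc
    rcases k.eq_empty_or_nonempty with rfl | hne
    · exact integrableOn_empty
    · obtain ⟨δ, hδ⟩ := hkc.exists_isLeast hne
      have hpos := (hk hδ.1).1
      refine (integrableOn_div_sigma (w : L2 0 1) (half_pos hpos)).mono_set fun x hx => ?_
      exact ⟨(half_lt_self hpos).trans_le (hδ.2 hx), (hk hx).2⟩
  intro φ h1 h2 h3
  obtain ⟨f, hf, e1, e2, hb⟩ := exists_mem_H1_of_contDiff 0 1 (h1.of_le (by simp))
  have hl := hb 0
  have hr := hb 1
  rw [eq_zero_of_notMem_tsupport h3 (by simp), Complex.ofReal_zero] at hl hr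
  have h0 : φ =ᶠ[𝓝 0] 0 := notMem_tsupport_iff_eventuallyEq.1 fun h => (h3 h).1.false
  have hf' : f ∈ P.H1w := ⟨mem_L2w_of_eventually_eq_zero h1.continuous h0 e1, hf, hl⟩
  have h4 := h f hf' hr
  rw [inner_mulL_sqrt_eta, inner_weightL] at h4
  have k1 : ∫ x in Ioo (0 : ℝ) 1, deriv φ x • ((P.eta x : ℂ) * dx u x)
      = ∫ x in Ioo (0 : ℝ) 1, (P.eta x : ℂ) * (conj (dx f x) * dx u x) := by
    refine integral_congr_ae ?_
    filter_upwards [e2] with x hx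
    rw [hx, Complex.conj_ofReal, Complex.real_smul]
    ring
  have k2 : ∫ x in Ioo (0 : ℝ) 1, φ x • ((w : L2 0 1) x / (P.sigma x : ℂ))
      = ∫ x in Ioo (0 : ℝ) 1, 1 / (P.sigma x : ℂ) * (conj (f x) * (w : L2 0 1) x) := by
    refine integral_congr_ae ?_
    filter_upwards [e1] with x hx
    rw [hx, Complex.conj_ofReal, Complex.real_smul]
    ring
  rw [k1, k2, h4]

/-- Nothing degenerates at `1`: the weight `1/σ` is bounded on `[1/2, 1]`, so `w / σ` is integrable
up to `1`. -/
theorem IsB.exists_hasBoundaryValue {u w : L2 0 1} (h : P.IsB u w) :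
    ∃ c, HasBoundaryValue 0 1 (fun x => (P.eta x : ℂ) * dx u x) 1 c := by
  obtain ⟨F, hF, e⟩ := HasWeakDeriv.exists_isPrimitive zero_lt_one h
  exact ⟨_, F, hF.continuousOn, e, hF.tendsto_right (c := 1 / 2) (by norm_num)
    (integrableOn_div_sigma w (by norm_num))⟩

variable (P) in
theorem exists_mem_H1w_eq_one : ∃ φ ∈ P.H1w, HasBoundaryValue 0 1 φ 1 1 := by
  have hs : ContDiff ℝ 1 fun x : ℝ => Real.smoothTransition (2 * x - 1) :=
    Real.smoothTransition.contDiff.comp ((contDiff_const.mul contDiff_id).sub contDiff_const)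
  obtain ⟨f, hf, e1, -, hb⟩ := exists_mem_H1_of_contDiff 0 1 hs
  have h0 : (fun x : ℝ => Real.smoothTransition (2 * x - 1)) =ᶠ[𝓝 0] 0 := by
    filter_upwards [Iio_mem_nhds (show (0 : ℝ) < 1 / 2 by norm_num)] with x hx
    exact Real.smoothTransition.zero_of_nonpos (by linarith [mem_Iio.1 hx])
  have hl := hb 0
  have hr := hb 1
  rw [Real.smoothTransition.zero_of_nonpos (by norm_num), Complex.ofReal_zero] at hl
  rw [Real.smoothTransition.one_of_one_le (by norm_num), Complex.ofReal_one] at hr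
  exact ⟨f, ⟨mem_L2w_of_eventually_eq_zero hs.continuous h0 e1, hf, hl⟩, hr⟩

theorem exists_mem_H1_affine {α β : ℝ} (hαβ : α < β) (p q : ℝ) :
    ∃ ψ ∈ H1 α β, HasBoundaryValue α β ψ α p ∧ HasBoundaryValue α β ψ β q := by
  have hs : ContDiff ℝ 1 fun x : ℝ => p + (q - p) / (β - α) * (x - α) :=
    contDiff_const.add (contDiff_const.mul (contDiff_id.sub contDiff_const))
  obtain ⟨f, hf, -, -, hb⟩ := exists_mem_H1_of_contDiff α β hs
  have hl := hb α
  have hr := hb β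
  rw [sub_self, mul_zero, add_zero] at hl
  rw [div_mul_cancel₀ _ (sub_pos.2 hαβ).ne', add_sub_cancel] at hr
  exact ⟨f, hf, hl, hr⟩

/-- Test pairs with zero values at `1` and `L` give the two differential equations. Green's formulas
then cancel all interior terms, and the remaining boundary values are separated by pairs
concentrated at `1` or at `L`. -/
theorem strong_of_weak {u : L2 0 1} {w : P.L2w} {y r : L2 1 P.L} {ζ : ℂ}
    (h : ∀ φ (hφ : φ ∈ P.H1w), ∀ ψ ∈ H1 1 P.L, P.Matches φ ψ → ∀ d,
      HasBoundaryValue 1 P.L ψ P.L d →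
      inner ℂ (mulL P.continuousOn_sqrt_eta (dx φ)) (mulL P.continuousOn_sqrt_eta (dx u))
        + inner ℂ (dx ψ) (dx y)
        = -(inner ℂ (P.weightL ⟨φ, hφ.1⟩) (P.weightL w) + inner ℂ ψ r) - conj d * ζ) :
    P.IsB u w ∧ HasWeakDeriv 1 P.L (dx y) r ∧
      P.Matches (fun x => (P.eta x : ℂ) * dx u x) (dx y) ∧
      HasBoundaryValue 1 P.L (dx y) P.L (-ζ) := by
  have hB : P.IsB u w := isB_of_inner fun φ hφ h1 => by
    have := h φ hφ 0 (zero_mem _) ⟨0, h1, hasBoundaryValue_zero_L2⟩ 0 hasBoundaryValue_zero_L2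
    simpa only [dx_zero, inner_zero_left, add_zero, map_zero, zero_mul, sub_zero] using this
  have z1 : P.weightL ⟨0, (zero_mem P.H1w : (0 : L2 0 1) ∈ P.H1w).1⟩ = 0 := map_zero P.weightL
  have hy : HasWeakDeriv 1 P.L (dx y) r := hasWeakDeriv_of_inner fun ψ hψ h1 h2 => by
    have := h 0 (zero_mem _) ψ hψ ⟨0, hasBoundaryValue_zero_L2, h1⟩ 0 h2
    simpa only [dx_zero, z1, inner_zero_left, zero_add, map_zero, zero_mul, sub_zero] using this
  have hy' : dx y ∈ H1 1 P.L := ⟨r, hy⟩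
  obtain ⟨c, hc⟩ := hB.exists_hasBoundaryValue
  obtain ⟨e₁, h1⟩ := exists_hasBoundaryValue_left P.one_lt_L hy'
  obtain ⟨e₂, h2⟩ := exists_hasBoundaryValue_right P.one_lt_L hy'
  -- The pair `(φ, ψ)` has value `1` at the interface and `0` at `L`, which isolates the jump of the
  -- flux; `(0, χ)` has value `0` at the interface and `1` at `L`, which isolates the damping
  -- condition.
  obtain ⟨φ, hφ, k1⟩ := P.exists_mem_H1w_eq_one
  obtain ⟨ψ, hψ, k2, k3⟩ := exists_mem_H1_affine P.one_lt_L 1 0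
  obtain ⟨χ, hχ, k4, k5⟩ := exists_mem_H1_affine P.one_lt_L 0 1
  rw [Complex.ofReal_one] at k2 k5
  rw [Complex.ofReal_zero] at k3 k4
  have g1 := green_degenerate hB hφ hc k1
  have g2 := green_of_mem_H1 P.one_lt_L hy' hψ h1 h2 k2 k3
  have g3 := green_of_mem_H1 P.one_lt_L hy' hχ h1 h2 k4 k5
  have g4 := h φ hφ ψ hψ ⟨1, k1, k2⟩ 0 k3
  have g5 := h 0 (zero_mem _) χ hχ ⟨0, hasBoundaryValue_zero_L2, k4⟩ 1 k5
  rw [dx_eq hy] at g2 g3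
  simp only [dx_zero, z1, map_zero, map_one, inner_zero_left, zero_add, zero_mul, one_mul,
    zero_sub, sub_zero] at g1 g2 g3 g4 g5
  have hce : c = e₁ := by linear_combination g4 - g1 - g2
  have he : e₂ = -ζ := by linear_combination g5 - g3
  exact ⟨hB, hy, ⟨c, hc, hce ▸ h1⟩, he ▸ h2⟩

end TransmissionData

namespace TransmissionData

open Transmission

variable {P : TransmissionData}

/-! ### The operator is m-dissipative -/

variable (P) in
/-- The terms of order zero in the stationary problem. -/
def lowerOrder (l : ℝ) : P.EnergySpace →ₗ[ℂ] WithLp 2 (L2 0 1 × WithLp 2 (L2 1 P.L × ℂ)) :=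
  (WithLp.linearEquiv 2 ℂ _).symm.toLinearMap ∘ₗ (((l : ℂ) • P.weightU).prod
    ((WithLp.linearEquiv 2 ℂ _).symm.toLinearMap ∘ₗ
      (((l : ℂ) • P.yL).toLinearMap.prod ((√l : ℂ) • P.traceL).toLinearMap)))

theorem lowerOrder_apply (l : ℝ) (U : P.EnergySpace) : P.lowerOrder l U
    = WithLp.toLp 2 ((l : ℂ) • P.weightU U,
      WithLp.toLp 2 ((l : ℂ) • U.y, (√l : ℂ) * P.traceL U)) := by
  rw [← yL_apply]
  rfl

/-- Only the component `u / √σ` is unbounded; `y` and `y(L)` are bounded for the energy norm and do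
not affect completeness. -/
theorem isGraphComplete_lowerOrder {l : ℝ} (hl : 0 < l) : IsGraphComplete (P.lowerOrder l) := by
  refine P.isGraphComplete_weightU.smul_prod (c := l) (by exact_mod_cast hl.ne')
    ((WithLp.prodContinuousLinearEquiv 2 ℂ (L2 1 P.L) ℂ).symm.toContinuousLinearMap.comp
      (((l : ℂ) • P.yL).prod ((√l : ℂ) • P.traceL))) _ fun U => ?_
  rw [lowerOrder_apply, ← yL_apply]
  rfl

/-- The weak form of the stationary problem `(l - A_1) X = F` for `X = (u, l u - f, y, l y - h)`,
where `f` and `h` are the first and the third component of `F`. -/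
theorem exists_weak_solution {l : ℝ} (hl : 0 < l) (F : P.EnergySpace) :
    ∃ U : P.EnergySpace, ∀ Φ : P.EnergySpace,
      inner ℂ Φ U = -(inner ℂ (P.weightU Φ) ((l : ℂ) • P.weightU ((l : ℂ) • U - F) - F.vw)
          + inner ℂ Φ.y ((l : ℂ) • ((l : ℂ) • U - F).y - F.z))
        - conj (P.traceL Φ) * P.traceL ((l : ℂ) • U - F) := by
  have hne : (l : ℂ) ≠ 0 := by exact_mod_cast hl.ne'
  have hs : (√l : ℂ) * (√l : ℂ) = l := by
    rw [← Complex.ofReal_mul, Real.mul_self_sqrt hl.le]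
  have hsne : (√l : ℂ) ≠ 0 := by exact_mod_cast (Real.sqrt_pos.2 hl).ne'
  -- Write `F = (f, g, h, k)`. The factors `l`, `l`, `√l` produce the terms `l² u`, `l² y` and `l
  -- y(L)` of the form; the inverse factors in the datum cancel those of the test vector and leave
  -- `g + l f`, `k + l h` and `h(L)`. The components `v` and `z` also enter the product, but only
  -- test vectors in which they vanish are used later.
  obtain ⟨U, hU⟩ := (isGraphComplete_lowerOrder (P := P) hl).exists_variational
    (WithLp.toLp 2 ((l : ℂ)⁻¹ • (F.vw + (l : ℂ) • P.weightU F),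
      WithLp.toLp 2 ((l : ℂ)⁻¹ • (F.z + (l : ℂ) • F.y), (√l : ℂ)⁻¹ * P.traceL F)))
  refine ⟨U, fun Φ => ?_⟩
  have h := hU Φ
  have hy : ((l : ℂ) • U - F).y = (l : ℂ) • U.y - F.y := by
    rw [← yL_apply, map_sub, map_smul, yL_apply, yL_apply]
  rw [hy, map_sub, map_smul, map_sub, map_smul]
  simp only [lowerOrder_apply, WithLp.prod_inner_apply, inner_smul_left, inner_smul_right,
    inner_add_right, inner_sub_right, Complex.conj_ofReal, RCLike.inner_apply, map_mul,
    smul_eq_mul, ← Complex.ofReal_inv] at h ⊢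
  push_cast at h
  generalize inner ℂ (P.weightU Φ) (P.weightU U) = a₁ at *
  generalize inner ℂ (P.weightU Φ) F.vw = a₂ at *
  generalize inner ℂ (P.weightU Φ) (P.weightU F) = a₃ at *
  generalize inner ℂ Φ.y U.y = a₄ at *
  generalize inner ℂ Φ.y F.z = a₅ at *
  generalize inner ℂ Φ.y F.y = a₆ at *
  generalize conj (P.traceL Φ) = a₇ at *
  generalize P.traceL U = a₈ at *
  generalize P.traceL F = a₉ at *
  field_simp at h
  linear_combination h - hs * a₇ * a₈

end TransmissionData

/-! ### Solution of the resolvent equation and the range of `1 - A_1*`. -/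

namespace TransmissionData

open Transmission

variable {P : TransmissionData}

theorem mem_domA1_iff (U : P.EnergySpace) : U ∈ P.domA1 ↔
    U.v ∈ P.H1w ∧ U.z ∈ H1 1 P.L ∧ P.Matches U.v U.z ∧ U.u ∈ P.H2w ∧ U.y ∈ P.H2 ∧
      P.Matches (fun x => (P.eta x : ℂ) * dx U.u x) (dx U.y) ∧
      ∃ c : ℂ, HasBoundaryValue 1 P.L (dx U.y) P.L (-c) ∧ HasBoundaryValue 1 P.L U.z P.L c :=
  Iff.rfl

theorem exists_mem_domA1 {U V : P.EnergySpace} {w : P.L2w} {r : L2 1 P.L} (hB : P.IsB U.u w)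
    (hyy : HasWeakDeriv 1 P.L (dx U.y) r)
    (hm : P.Matches (fun x => (P.eta x : ℂ) * dx U.u x) (dx U.y))
    (hb : HasBoundaryValue 1 P.L (dx U.y) P.L (-(P.traceL V))) :
    ∃ X ∈ P.domA1, X.u = U.u ∧ X.v = V.u ∧ X.y = U.y ∧ X.z = V.y := by
  obtain ⟨X, x1, x2, x3, x4⟩ : ∃ X : P.EnergySpace, X.u = U.u ∧ X.v = V.u ∧ X.y = U.y ∧ X.z = V.y :=
    ⟨EnergySpace.mk U.u V.u U.y V.y U.hu V.hu.1 U.hy U.huy, EnergySpace.mk_u ..,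
      EnergySpace.mk_v .., EnergySpace.mk_y .., EnergySpace.mk_z ..⟩
  refine ⟨X, ?_, x1, x2, x3, x4⟩
  rw [mem_domA1_iff, x1, x2, x3, x4]
  exact ⟨V.hu, V.hy, V.huy, ⟨U.hu, w, w.2, hB⟩, ⟨U.hy, _, hyy⟩, hm, P.traceL V, hb,
    hasBoundaryValue_y_right V⟩

theorem weightL_smul_sub (c : ℂ) (V F : P.EnergySpace) (w : P.L2w)
    (hw : (w : L2 0 1) = c • V.u - F.v) : P.weightL w = c • P.weightU V - F.vw := by
  have e : w = c • ⟨V.u, V.hu.1⟩ - ⟨F.v, F.hv⟩ := Subtype.ext hw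
  rw [e, map_sub, map_smul]
  rfl

theorem inner_eq_of_v_z_eq_zero {Φ : P.EnergySpace} (hv : Φ.v = 0) (hz : Φ.z = 0)
    (U : P.EnergySpace) : inner ℂ Φ U = inner ℂ Φ.ue U.ue + inner ℂ (dx Φ.y) (dx U.y) := by
  have h : Φ.vw = 0 := by
    rw [EnergySpace.vw, show (⟨Φ.v, Φ.hv⟩ : P.L2w) = 0 from Subtype.ext hv, map_zero]
  rw [energy_inner_eq, h, hz, inner_zero_left, inner_zero_left, add_zero, add_zero]

/-- With `V = l U - F` the solution is `(U.u, V.u, U.y, V.y)`. The first and third equations are the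
definition of `V`, whose membership in the energy space provides `v(1) = z(1)`; the second and
fourth come from `strong_of_weak`. -/
theorem exists_sub_A1val_eq {l : ℝ} (hl : 0 < l) (F : P.EnergySpace) :
    ∃ (X : P.EnergySpace) (hX : X ∈ P.domA1), (l : ℂ) • X - P.A1val X hX = F := by
  obtain ⟨U, hU⟩ := exists_weak_solution hl F
  obtain ⟨V, hV⟩ : ∃ V, V = (l : ℂ) • U - F := ⟨_, rfl⟩
  rw [← hV] at hU
  have hV' : (l : ℂ) • U = V + F := by rw [hV, sub_add_cancel]
  have hw : (l : ℂ) • V.u - F.v ∈ P.L2w := sub_mem (Submodule.smul_mem _ _ V.hu.1) F.hv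
  obtain ⟨w, hw⟩ : ∃ w : P.L2w, (w : L2 0 1) = (l : ℂ) • V.u - F.v := ⟨⟨_, hw⟩, rfl⟩
  rw [← weightL_smul_sub (l : ℂ) V F w hw] at hU
  obtain ⟨hB, hyy, hm, hb⟩ := strong_of_weak (u := U.u) (w := w) (y := U.y)
    (r := (l : ℂ) • V.y - F.z) (ζ := P.traceL V) (by
      intro φ hφ ψ hψ hmφ d hd
      obtain ⟨Φ, h1, h2, h3, h4⟩ : ∃ Φ : P.EnergySpace, Φ.u = φ ∧ Φ.v = 0 ∧ Φ.y = ψ ∧ Φ.z = 0 :=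
        ⟨EnergySpace.mk φ 0 ψ 0 hφ (zero_mem _) hψ hmφ, EnergySpace.mk_u .., EnergySpace.mk_v ..,
          EnergySpace.mk_y .., EnergySpace.mk_z ..⟩
      subst h1 h3
      have h5 : P.traceL Φ = d := (hasBoundaryValue_y_right Φ).unique P.one_lt_L
        (right_mem_Icc.2 P.one_lt_L.le) hd
      have h6 := hU Φ
      rw [inner_eq_of_v_z_eq_zero h2 h4, h5] at h6
      exact h6)
  obtain ⟨X, hX, x1, x2, x3, x4⟩ := exists_mem_domA1 hB hyy hm hb
  refine ⟨X, hX, ?_⟩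
  rw [sub_eq_iff_eq_add']
  apply EnergySpace.ext
  · rw [EnergySpace.u_add, A1val_u, EnergySpace.u_smul, x1, x2, ← EnergySpace.u_smul,
      ← EnergySpace.u_add, hV']
  · rw [EnergySpace.v_add, A1val_v, EnergySpace.v_smul, x1, x2, hB.eq, hw, sub_add_cancel]
  · rw [EnergySpace.y_add, A1val_y, EnergySpace.y_smul, x3, x4, ← EnergySpace.y_smul,
      ← EnergySpace.y_add, hV']
  · rw [EnergySpace.z_add, A1val_z, EnergySpace.z_smul, x3, x4, dx_eq hyy, sub_add_cancel]

variable (P)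

theorem isMDissipative_A1 : IsMDissipative P.A1 := by
  refine ⟨fun U => re_inner_A1val_nonpos U.2, fun r hr G => ?_⟩
  obtain ⟨X, hX, h⟩ := exists_sub_A1val_eq hr G
  exact ⟨⟨X, hX⟩, h⟩

theorem weightU_A1val (U : P.EnergySpace) (hU : U ∈ P.domA1) :
    P.weightU (P.A1val U hU) = U.vw :=
  congrArg P.weightL (Subtype.ext (P.A1val_u U hU))

/-- The first component of `A_1 U` is `v`, and `v / √σ` is part of the energy. This is what allows
the passage to the graph norm. -/
theorem norm_weightU_A1_le (U : P.A1.domain) :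
    ‖P.weightU (P.A1 U)‖ ≤ ‖(U : P.EnergySpace)‖ :=
  (congrArg norm (P.weightU_A1val U.1 U.2)).trans_le (norm_vw_le U.1)

/-- Solve `(1 - A_1) Y` equal to the time reversal of `F` and reverse time. The explicit adjoint
pair avoids any duality argument that would need completeness. -/
theorem exists_isAdjointPair_sub_eq (F : P.EnergySpace) :
    ∃ W W', IsAdjointPair P.A1 W W' ∧ W - W' = F := by
  obtain ⟨Y, hY, h⟩ := exists_sub_A1val_eq zero_lt_one (timeReversal F)
  refine ⟨timeReversal Y, timeReversal (P.A1val Y hY), isAdjointPair_timeReversal hY, ?_⟩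
  rw [Complex.ofReal_one, one_smul] at h
  rw [← timeReversal_sub, h, timeReversal_involutive]

end TransmissionData

namespace Transmission

/-! ### Hardy's inequality -/

theorem norm_sq_L2 {α β : ℝ} (f : L2 α β) : ‖f‖ ^ 2 = ∫ x in Ioo α β, ‖f x‖ ^ 2 := by
  have h := inner_L2 f f
  rw [inner_self_eq_norm_sq_to_K] at h
  have e : ∀ x, conj (f x) * f x = ((‖f x‖ ^ 2 : ℝ) : ℂ) := fun x => by
    rw [Complex.conj_mul', Complex.ofReal_pow]
  simp only [e] at h
  rw [integral_complex_ofReal] at h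
  exact Complex.ofReal_injective ((Complex.ofReal_pow _ _).trans h)

theorem integrableOn_norm_sq_L2 {α β : ℝ} (f : L2 α β) :
    IntegrableOn (fun x => ‖f x‖ ^ 2) (Ioo α β) :=
  (memLp_two_iff_integrable_sq_norm (Lp.aestronglyMeasurable f)).1 (Lp.memLp f)

theorem isPrimitive_inv (β : ℝ) :
    IsPrimitive 0 β (fun x => ((x⁻¹ : ℝ) : ℂ)) (fun x => ((-(x ^ 2)⁻¹ : ℝ) : ℂ)) := by
  have hc : ContinuousOn (fun x : ℝ => -(x ^ 2)⁻¹) (Ioo 0 β) :=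
    ((continuousOn_pow 2).inv₀ fun x hx => (pow_pos hx.1 2).ne').neg
  refine ⟨(Complex.continuous_ofReal.comp_continuousOn hc).locallyIntegrableOn measurableSet_Ioo,
    fun x hx y hy => ?_⟩
  have hsub : uIcc x y ⊆ Ioo 0 β := ordConnected_Ioo.uIcc_subset hx hy
  rw [intervalIntegral.integral_ofReal, ← Complex.ofReal_sub,
    intervalIntegral.integral_eq_sub_of_hasDerivAt (f := fun x : ℝ => x⁻¹)]
  · exact fun t ht => hasDerivAt_inv (hsub ht).1.ne'
  · exact (hc.mono hsub).intervalIntegrable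

/-- Integrating the derivative of `|F|² / x` over `[ε, q]` expresses the integral `I` on the left as
that of `2 Re(p F̄) / x` plus `|F(ε)|² / ε` minus `|F(q)|² / q`. The first is at most `I / 2 + 2
‖p‖²`, the second at most `‖p‖²`, and the last has the right sign; so `I ≤ 6 ‖p‖²`. The constant is
not optimal, but it is independent of `ε` and `q`. -/
theorem hardy (p : L2 0 1) {ε q : ℝ} (hε : 0 < ε) (hεq : ε ≤ q) (hq : q < 1) :
    ∫ x in ε..q, ‖∫ t in (0 : ℝ)..x, p t‖ ^ 2 / x ^ 2 ≤ 6 * ‖p‖ ^ 2 := by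
  have hF := isPrimitive_L2 p 0
  simp only [zero_add] at hF
  set F : ℝ → ℂ := fun x => ∫ t in (0 : ℝ)..x, p t with hFd
  have hε' : ε ∈ Ioo (0 : ℝ) 1 := ⟨hε, hεq.trans_lt hq⟩
  have hq' : q ∈ Ioo (0 : ℝ) 1 := ⟨hε.trans_le hεq, hq⟩
  have hsub : Icc ε q ⊆ Ioo 0 1 := fun x hx => ⟨hε.trans_le hx.1, hx.2.trans_lt hq⟩
  have hFF := hF.mul hF.map_conj
  have h1 := (hFF.mul (isPrimitive_inv 1)).sub_eq ε hε' q hq'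
  have hcF : ContinuousOn F (uIcc ε q) := by
    rw [uIcc_of_le hεq]
    exact hF.continuousOn.mono hsub
  have hci : ContinuousOn (fun x : ℝ => (x ^ 2)⁻¹) (uIcc ε q) := by
    rw [uIcc_of_le hεq]
    exact (continuousOn_pow 2).inv₀ fun x hx => (pow_pos (hsub hx).1 2).ne'
  have i1 : IntervalIntegrable (fun x => ‖F x‖ ^ 2 / x ^ 2) volume ε q :=
    ((hcF.norm.pow 2).mul hci).intervalIntegrable
  have hci' : ContinuousOn (fun x : ℝ => ((x⁻¹ : ℝ) : ℂ)) (uIcc ε q) := by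
    rw [uIcc_of_le hεq]
    exact (isPrimitive_inv 1).continuousOn.mono hsub
  have i2 := (hFF.intervalIntegrable hε' hq').mul_continuousOn hci'
  have i3 : IntervalIntegrable (fun x => ‖p x‖ ^ 2) volume ε q := by
    rw [intervalIntegrable_iff_integrableOn_Icc_of_le hεq]
    exact (integrableOn_norm_sq_L2 p).mono_set hsub
  have i4 : IntervalIntegrable (fun x => ((‖F x‖ ^ 2 / x ^ 2 : ℝ) : ℂ)) volume ε q :=
    ⟨Integrable.ofReal i1.1, Integrable.ofReal i1.2⟩
  have b3 : ∫ x in ε..q, ‖p x‖ ^ 2 ≤ ‖p‖ ^ 2 := by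
    rw [norm_sq_L2, intervalIntegral.integral_of_le hεq]
    refine setIntegral_mono_set (integrableOn_norm_sq_L2 p)
      (Eventually.of_forall fun x => by positivity) ?_
    exact (Ioc_subset_Icc_self.trans hsub).eventuallyLE
  -- The weights in Young's inequality are chosen so that half of the integral of `|F|² / x²` can be
  -- absorbed on the left.
  have b2 : ‖∫ x in ε..q, (p * (fun x => conj (F x)) + F * fun x => conj (p x)) x
      * ((x⁻¹ : ℝ) : ℂ)‖ ≤ ∫ x in ε..q, (1 / 2 * (‖F x‖ ^ 2 / x ^ 2) + 2 * ‖p x‖ ^ 2) := by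
    refine intervalIntegral.norm_integral_le_of_norm_le hεq (Eventually.of_forall fun x hx => ?_)
      ((i1.const_mul _).add (i3.const_mul _))
    have hx0 : 0 < x := hε.trans hx.1
    rw [norm_mul, Complex.norm_real, Real.norm_of_nonneg (inv_nonneg.2 hx0.le), ← div_pow]
    have h2 : ‖(p * (fun x => conj (F x)) + F * fun x => conj (p x)) x‖
        ≤ 2 * (‖F x‖ * ‖p x‖) := by
      refine (norm_add_le _ _).trans_eq ?_
      simp only [Pi.mul_apply, norm_mul, RCLike.norm_conj]
      ring
    calc _ ≤ 2 * (‖F x‖ * ‖p x‖) * x⁻¹ := mul_le_mul_of_nonneg_right h2 (inv_nonneg.2 hx0.le)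
      _ = 2 * (‖F x‖ / x) * ‖p x‖ := by ring
      _ ≤ _ := by nlinarith [sq_nonneg (‖F x‖ / x - 2 * ‖p x‖)]
  rw [intervalIntegral.integral_add (i1.const_mul _) (i3.const_mul _),
    intervalIntegral.integral_const_mul, intervalIntegral.integral_const_mul] at b2
  have h3 : ∫ x in ε..q, ((p * (fun x => conj (F x)) + F * fun x => conj (p x))
        * (fun x : ℝ => ((x⁻¹ : ℝ) : ℂ))
        + (F * fun x => conj (F x)) * fun x : ℝ => ((-(x ^ 2)⁻¹ : ℝ) : ℂ)) x
      = (∫ x in ε..q, (p * (fun x => conj (F x)) + F * fun x => conj (p x)) x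
          * ((x⁻¹ : ℝ) : ℂ)) - ((∫ x in ε..q, ‖F x‖ ^ 2 / x ^ 2 : ℝ) : ℂ) := by
    rw [← intervalIntegral.integral_ofReal, ← intervalIntegral.integral_sub i2 i4]
    refine intervalIntegral.integral_congr fun x _ => ?_
    simp only [Pi.add_apply, Pi.mul_apply, Complex.mul_conj', Complex.ofReal_neg]
    push_cast
    ring
  rw [h3] at h1
  have h4 : ∀ x, ((F * fun x => conj (F x)) * fun x : ℝ => ((x⁻¹ : ℝ) : ℂ)) x
      = ((‖F x‖ ^ 2 * x⁻¹ : ℝ) : ℂ) := by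
    intro x
    simp only [Pi.mul_apply, Complex.mul_conj']
    push_cast
    ring
  rw [h4, h4] at h1
  have h5 := congrArg Complex.re h1
  simp only [Complex.sub_re, Complex.ofReal_re] at h5
  have h6 := (Complex.re_le_norm _).trans b2
  have h7 : ‖F ε‖ ^ 2 * ε⁻¹ ≤ ‖p‖ ^ 2 := by
    have h8 := norm_integral_L2_le p (Ioo_subset_Icc_self hε')
    rw [sub_zero] at h8
    have h9 : ‖F ε‖ ^ 2 ≤ (√ε * ‖p‖) ^ 2 := pow_le_pow_left₀ (norm_nonneg _) h8 2
    rw [mul_pow, Real.sq_sqrt hε.le] at h9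
    rw [← div_eq_mul_inv, div_le_iff₀ hε]
    linarith
  have h8 : 0 ≤ ‖F q‖ ^ 2 * q⁻¹ := mul_nonneg (sq_nonneg _) (inv_nonneg.2 hq'.1.le)
  linarith

end Transmission

/-! ### Completeness under the growth condition on `a`. -/

namespace TransmissionData

open Transmission

variable {P : TransmissionData}

/-- One has `x² / σ = η x² / a`. On `(0, c]` the bound `x² ≤ x^α`, valid as `α ≤ 2` and `x < 1`, and
monotonicity give `x² / a ≤ c^α / a(c)`, while `η` is bounded. Beyond `c` the function `1/σ` is
bounded. -/
theorem exists_sq_div_sigma_le {α δ : ℝ} (hα : α ≤ 2) (hδ : 0 < δ)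
    (hm : MonotoneOn (fun x : ℝ => x ^ α / P.a x) (Ioo 0 δ)) :
    ∃ K, 0 ≤ K ∧ ∀ x ∈ Ioo (0 : ℝ) 1, x ^ 2 / P.sigma x ≤ K := by
  set c := min δ 1 / 2 with hc
  have hm1 : 0 < min δ 1 := lt_min hδ one_pos
  have hc0 : 0 < c := half_pos hm1
  have hcδ : c < δ := (half_lt_self hm1).trans_le (min_le_left _ _)
  have hc1 : c < 1 := (half_lt_self hm1).trans_le (min_le_right _ _)
  obtain ⟨E, hE⟩ := isCompact_Icc.exists_bound_of_continuousOn P.continuousOn_eta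
  obtain ⟨S, hS⟩ := isCompact_Icc.exists_bound_of_continuousOn
    (continuousOn_inv_sigma (P := P) hc0)
  have hE0 : 0 ≤ E := (norm_nonneg _).trans (hE 0 (by simp))
  have hS0 : 0 ≤ S := (norm_nonneg _).trans (hS 1 ⟨hc1.le, le_rfl⟩)
  have hM0 : 0 ≤ c ^ α / P.a c :=
    div_nonneg (Real.rpow_nonneg hc0.le _) (P.a_pos c ⟨hc0, hc1.le⟩).le
  refine ⟨c ^ α / P.a c * E + S, by positivity, fun x hx => ?_⟩
  rcases le_or_gt x c with h | h
  · have hax := P.a_pos x ⟨hx.1, hx.2.le⟩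
    have h1 : x ^ α / P.a x ≤ c ^ α / P.a c := hm ⟨hx.1, h.trans_lt hcδ⟩ ⟨hc0, hcδ⟩ h
    have h2 : x ^ 2 ≤ x ^ α := by
      rw [← Real.rpow_natCast]
      exact Real.rpow_le_rpow_of_exponent_ge hx.1 hx.2.le (by exact_mod_cast hα)
    have h3 : x ^ 2 / P.a x ≤ c ^ α / P.a c := (div_le_div_of_nonneg_right h2 hax.le).trans h1
    have h4 : P.eta x ≤ E := (le_abs_self _).trans (hE x (Ioo_subset_Icc_self hx))
    rw [sigma, div_div_eq_mul_div, mul_div_right_comm]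
    have := mul_le_mul h3 h4 (P.eta_pos x).le hM0
    linarith
  · have h1 : (P.sigma x)⁻¹ ≤ S := (le_abs_self _).trans (hS x ⟨h.le, hx.2.le⟩)
    have h2 : x ^ 2 ≤ 1 := pow_le_one₀ hx.1.le hx.2.le
    have h3 := mul_le_mul h2 h1 (inv_nonneg.2 (P.sigma_pos hx).le) zero_le_one
    rw [div_eq_mul_inv]
    nlinarith [mul_nonneg hM0 hE0]

/-- Pointwise `|u|² / σ ≤ K |u|² / x²`, to which Hardy's inequality applies. -/
theorem norm_weightU_sq_le {K : ℝ} (hK0 : 0 ≤ K)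
    (hK : ∀ x ∈ Ioo (0 : ℝ) 1, x ^ 2 / P.sigma x ≤ K) (U : P.EnergySpace) :
    ‖P.weightU U‖ ^ 2 ≤ K * (6 * ‖P.uxL U‖ ^ 2) := by
  rw [uxL_apply, norm_sq_L2]
  have hu : ∀ᵐ x ∂volume.restrict (Ioo (0 : ℝ) 1), ‖P.weightU U x‖ ^ 2
      ≤ K * (‖∫ t in (0 : ℝ)..x, dx U.u t‖ ^ 2 / x ^ 2) := by
    have h1 : U.u =ᵐ[volume.restrict (Ioo (0 : ℝ) 1)] fun x => ∫ t in (0 : ℝ)..x, dx U.u t := by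
      conv_lhs => rw [u_eq U]
      exact coeFn_primitiveL _
    filter_upwards [P.coeFn_weightL ⟨U.u, U.hu.1⟩, h1, ae_restrict_mem measurableSet_Ioo]
      with x h2 h3 hx
    have h4 : P.weightU U x = U.u x / (√(P.sigma x) : ℂ) := h2
    have hx2 : 0 < x ^ 2 := pow_pos hx.1 2
    rw [h4, norm_div, Complex.norm_real, div_pow, Real.norm_eq_abs, sq_abs,
      Real.sq_sqrt (P.sigma_pos hx).le, h3]
    have h5 := mul_le_mul_of_nonneg_right (hK x hx)
      (show 0 ≤ ‖∫ t in (0 : ℝ)..x, dx U.u t‖ ^ 2 / x ^ 2 by positivity)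
    have hx0 := hx.1.ne'
    refine le_of_eq_of_le ?_ h5
    field_simp
  -- Hardy's inequality is available on compact subintervals; the intervals from `ε` to `1 - ε` with
  -- `ε = 1 / (2 (n + 1))` exhaust `(0, 1)`.
  have ha : Tendsto (fun n : ℕ => 1 / ((n : ℝ) + 1) / 2) atTop (𝓝 0) := by
    simpa using tendsto_one_div_add_atTop_nhds_zero_nat.div_const (2 : ℝ)
  have hb : Tendsto (fun n : ℕ => 1 - 1 / ((n : ℝ) + 1) / 2) atTop (𝓝 1) := by
    simpa using ha.const_sub 1
  have hlim := (aecover_Ioo_of_Ioc (μ := volume) ha hb).integral_tendsto_of_countably_generated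
    (integrableOn_norm_sq_L2 (P.weightU U))
  refine le_of_tendsto' hlim fun n => ?_
  set ε := 1 / ((n : ℝ) + 1) / 2
  have hε : 0 < ε := by positivity
  have hε2 : ε ≤ 1 / 2 := by
    refine div_le_div_of_nonneg_right ?_ zero_le_two
    rw [div_le_one (by positivity)]
    linarith [(Nat.cast_nonneg n : (0 : ℝ) ≤ n)]
  have hsub : Ioc ε (1 - ε) ⊆ Ioo 0 1 := fun x hx => ⟨hε.trans hx.1, hx.2.trans_lt (by linarith)⟩
  rw [Measure.restrict_restrict measurableSet_Ioc, inter_eq_left.2 hsub]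
  have h1 := hardy (dx U.u) hε (q := 1 - ε) (by linarith) (by linarith)
  refine le_trans ?_ (mul_le_mul_of_nonneg_left h1 hK0)
  rw [intervalIntegral.integral_of_le (by linarith), ← integral_const_mul]
  refine integral_mono_ae ((integrableOn_norm_sq_L2 _).mono_set hsub) ?_
    (ae_mono (Measure.restrict_mono hsub le_rfl) hu)
  have hF := isPrimitive_L2 (dx U.u) 0
  simp only [zero_add] at hF
  have hsub' : Icc ε (1 - ε) ⊆ Ioo 0 1 :=
    fun x hx => ⟨hε.trans_le hx.1, hx.2.trans_lt (by linarith)⟩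
  have hc : ContinuousOn (fun x => K * (‖∫ t in (0 : ℝ)..x, dx U.u t‖ ^ 2 / x ^ 2))
      (Icc ε (1 - ε)) :=
    continuousOn_const.mul (((hF.continuousOn.mono hsub').norm.pow 2).div (continuousOn_pow 2)
      fun x hx => (pow_pos (hsub' hx).1 2).ne')
  exact (hc.integrableOn_compact isCompact_Icc).mono_set Ioc_subset_Icc_self

/-- The operator `weightU` is now bounded, so Cauchy sequences for the energy norm are Cauchy for
the graph norm. -/
theorem completeSpace_of_sq_div_sigma_le {K : ℝ} (hK0 : 0 ≤ K)
    (hK : ∀ x ∈ Ioo (0 : ℝ) 1, x ^ 2 / P.sigma x ≤ K) : CompleteSpace P.EnergySpace := by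
  let N : P.EnergySpace →L[ℂ] L2 0 1 := P.weightU.mkContinuous (√(K * 6) * ‖P.uxL‖) fun U => by
    refine le_trans ?_ ((mul_le_mul_of_nonneg_left (P.uxL.le_opNorm U)
      (Real.sqrt_nonneg _)).trans_eq (mul_assoc _ _ _).symm)
    refine (sq_le_sq₀ (norm_nonneg _) (by positivity)).1 ?_
    rw [mul_pow, Real.sq_sqrt (by positivity), mul_assoc]
    exact norm_weightU_sq_le hK0 hK U
  refine Metric.complete_of_cauchySeq_tendsto fun U hU => ?_
  obtain ⟨V, hV, -⟩ := P.isGraphComplete_weightU U hU (hU.map N.uniformContinuous)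
  exact ⟨V, hV⟩

end TransmissionData

end

/-! ### The theorem. -/

theorem mainTheorem4 (P : TransmissionData) :
    ((∃ α : ℝ, 0 < α ∧ α ≤ 2 ∧ ∃ δ : ℝ, 0 < δ ∧
        MonotoneOn (fun x : ℝ => x ^ α / P.a x) (Set.Ioo 0 δ)) → CompleteSpace P.EnergySpace) ∧
    Transmission.IsMDissipative P.A1 ∧
    ∃ T : ℝ → P.EnergySpace →L[ℂ] P.EnergySpace,
      Transmission.IsC0ContractionSemigroup T ∧ Transmission.IsGenerator P.A1 T ∧
      (∀ U₀ : P.EnergySpace,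
        Transmission.IsWeakSolution P.A1 U₀ (fun t => T t U₀) ∧
        ∀ U : ℝ → P.EnergySpace, Transmission.IsWeakSolution P.A1 U₀ U →
          Set.EqOn U (fun t => T t U₀) (Set.Ici 0)) ∧
      (∀ U₀ ∈ P.A1.domain,
        Transmission.IsStrongSolution P.A1 U₀ (fun t => T t U₀) ∧
        ∀ U : ℝ → P.EnergySpace, Transmission.IsStrongSolution P.A1 U₀ U →
          Set.EqOn U (fun t => T t U₀) (Set.Ici 0)) := by
  have hA := P.isMDissipative_A1
  obtain ⟨hD, T, hT, hTA⟩ := hA.exists_semigroup_of_graphComplete P.isGraphComplete_weightU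
    P.norm_weightU_A1_le
  refine ⟨?_, hA, T, hT, ?_, fun U₀ => ?_, fun U₀ hU₀ => ?_⟩
  · rintro ⟨α, -, hα, δ, hδ, hm⟩
    obtain ⟨K, hK0, hK⟩ := TransmissionData.exists_sq_div_sigma_le hα hδ hm
    exact TransmissionData.completeSpace_of_sq_div_sigma_le hK0 hK
  · refine Transmission.isGenerator_of_domain hA hT fun U => ?_
    simpa [hT.zero] using (hTA U 0 le_rfl).2
  · have h := Transmission.isWeakSolution_of_domain hD hT hTA U₀
    exact ⟨h, fun U hU => hU.eqOn hA P.exists_isAdjointPair_sub_eq h⟩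
  · have h := Transmission.isStrongSolution_of_domain hT hTA ⟨U₀, hU₀⟩
    exact ⟨h, fun U hU => hU.eqOn hA.1 h⟩
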